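/- Write $\mathbb H$ for the upper half-plane, $\tau=\tau_1+i\tau_2\in\mathbb H$, $q=e^{2\pi i\tau}$, $\zeta_n=e^{2\pi i/n}$, $\operatorname{sgn}(0)=0$, and $K_0(x)=\int_0^\infty e^{-x\cosh t}\,dt$ for $x>0$. Let $Q(\boldsymbol n)=6n_1^2-2n_2^2$ with bilinear form $B(\boldsymbol n,\boldsymbol m)=12n_1m_1-4n_2m_2$, and let $$\boldsymbol c(t)=\Big(\tfrac{\sinh t}{\sqrt6},\tfrac{\cosh t}{\sqrt2}\Big),\quad \boldsymbol c^\perp(t)=\Big(\tfrac{\cosh t}{\sqrt6},\tfrac{\sinh t}{\sqrt2}\Big),\quad \boldsymbol{c_1}=\tfrac1{2\sqrt3}(-1,3),\quad \boldsymbol{c_2}=\tfrac1{2\sqrt3}(1,3).$$ Let $t_i$ be the real number with $\boldsymbol c(t_i)=\boldsymbol{c_i}$ and put $\boldsymbol{c_i^\perp}=\boldsymbol c^\perp(t_i)$. For $\boldsymbol\mu\in\mathbb R^2$ let $\delta_{\boldsymbol\mu\in\mathbb Z^2}$ be $1$ if $\boldsymbol\mu\in\mathbb Z^2$ and $0$ otherwise,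 and define $$\widehat\Theta_{\boldsymbol\mu}(\tau)=\sqrt{\tau_2}\sum_{\boldsymbol n\in\mathbb Z^2+\boldsymbol\mu}q^{Q(\boldsymbol n)}\int_{t_1}^{t_2}e^{-\pi B(\boldsymbol n,\boldsymbol c(t))^2\tau_2}\,dt,$$ $$\begin{aligned}\Theta_{\boldsymbol\mu}(\tau)={}&\tfrac12\operatorname{sgn}(t_2-t_1)\sqrt{\tau_2}\sum_{\boldsymbol n\in\mathbb Z^2+\boldsymbol\mu,\ \boldsymbol n\ne\boldsymbol 0}\big(1-\operatorname{sgn}B(\boldsymbol n,\boldsymbol{c_1})\operatorname{sgn}B(\boldsymbol n,\boldsymbol{c_2})\big)K_0(2\pi Q(\boldsymbol n)\tau_2)e^{2\pi iQ(\boldsymbol n)\tau_1}\\&+\tfrac12\operatorname{sgn}(t_2-t_1)\sqrt{\tau_2}\sum_{\boldsymbol n\in\mathbb Z^2+\boldsymbol\mu,\ \boldsymbol n\ne\boldsymbol 0}\big(1-\operatorname{sgn}B(\boldsymbol n,\boldsymbol{c_1^\perp})\operatorname{sgn}B(\boldsymbol n,\boldsymbol{c_2^\perp})\big)K_0(-2\pi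 Q(\boldsymbol n)\tau_2)e^{2\pi iQ(\boldsymbol n)\tau_1}\\&+(t_2-t_1)\sqrt{\tau_2}\,\delta_{\boldsymbol\mu\in\mathbb Z^2},\end{aligned}$$ where terms whose sign factor is zero are read as zero. For $i\in\{1,2\}$ define the shadow contributions $$\varphi_{\boldsymbol\mu}^{[\boldsymbol{c_i}]}(\tau)=\sqrt{\tau_2}\sum_{\boldsymbol n\in\mathbb Z^2+\boldsymbol\mu}\alpha_{t_i}(\boldsymbol n\sqrt{\tau_2})\,q^{Q(\boldsymbol n)},$$ where $\alpha_{t_i}(\boldsymbol n)$ is $\int_{t_i}^\infty e^{-\pi B(\boldsymbol n,\boldsymbol c(t))^2}dt$ if $B(\boldsymbol n,\boldsymbol{c_i})B(\boldsymbol n,\boldsymbol{c_i^\perp})>0$, is $-\int_{-\infty}^{t_i}e^{-\pi B(\boldsymbol n,\boldsymbol c(t))^2}dt$ if this product is negative, and is $0$ otherwise. For $j\in\{0,1,2,3\}$ let $\boldsymbol{\mu_j}=(\frac j6,0)$, $\boldsymbol\lambda=(\frac12,\frac12)$ and $$G_j=\Theta_{\boldsymbol{\mu_j}}+\Theta_{\boldsymbol{\mu_j}+\boldsymbol\lambda},\qquad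 \widehat G_j=\widehat\Theta_{\boldsymbol{\mu_j}}+\widehat\Theta_{\boldsymbol{\mu_j}+\boldsymbol\lambda}.$$ **Proposition.** For $\boldsymbol\mu\in\{\boldsymbol{\mu_j},\boldsymbol{\mu_j}+\boldsymbol\lambda\}$, $0\le j\le3$, all the series above converge absolutely, and the following hold. 1. For all $j$, $G_j=\widehat G_j$. Equivalently, in $\widehat G_j=G_j+\sum_{\boldsymbol\mu\in\{\boldsymbol{\mu_j},\boldsymbol{\mu_j}+\boldsymbol\lambda\}}\big(\varphi_{\boldsymbol\mu}^{[\boldsymbol{c_1}]}-\varphi_{\boldsymbol\mu}^{[\boldsymbol{c_2}]}\big)$ the sum of the shadow contributions is $0$. 2. $(G_0,G_1,G_2,G_3)$ is a vector-valued Maass form for $\Gamma_0(2)$ with eigenvalue $\frac14$: the $G_j$ are smooth on $\mathbb H$; $-\tau_2^2(\partial_{\tau_1}^2+\partial_{\tau_2}^2)G_j=\frac14G_j$; for every $\gamma\in\mathrm{SL}_2(\mathbb Z)$, $G_j(\gamma\tau)$ grows at most polynomially in $\tau_2$ as $\tau_2\to\infty$, uniformly in $\tau_1$; and there is a multiplicative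 map $\Phi$ from $\Gamma_0(2)$ to the complex $4\times4$ matrices with $\Phi_I=I$, diagonal on the matrices $\pm\begin{pmatrix}1&n\\0&1\end{pmatrix}$, such that $$G_j\Big(\frac{a\tau+b}{c\tau+d}\Big)=\sum_{k=0}^3\Phi_M(j,k)\,G_k(\tau)\qquad\text{for all }M=\begin{pmatrix}a&b\\c&d\end{pmatrix}\in\Gamma_0(2),$$ and, for $T=\begin{pmatrix}1&1\\0&1\end{pmatrix}$ and $R=\begin{pmatrix}1&0\\2&1\end{pmatrix}$, $$\Phi_T=\begin{pmatrix}1&0&0&0\\0&\zeta_6&0&0\\0&0&\zeta_3^2&0\\0&0&0&-1\end{pmatrix},\qquad \Phi_R=\frac1{\sqrt3}\begin{pmatrix}0&2\zeta_{12}&0&\zeta_4^3\\\zeta_{12}&0&\zeta_{12}^{11}&0\\0&\zeta_{12}^{11}&0&\zeta_{12}\\\zeta_4^3&0&2\zeta_{12}&0\end{pmatrix}.$$ 3. With $\alpha_j=\frac{j^2}6$ there are coefficients $d_j(n)$ of at most polynomial growth in $n$ such that, with absolute convergence, $$G_j(\tau)=c_j\sqrt{\tau_2}+\sqrt{\tau_2}\sum_{n\in\mathbb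 Z+\alpha_j,\ n\ne0}d_j(n)K_0(2\pi|n|\tau_2)e^{2\pi in\tau_1},$$ where $c_0=2\operatorname{arctanh}(1/\sqrt3)\ne0$ and $c_1=c_2=c_3=0$. In particular this Maass form has a nonzero constant term. -/

import Mathlib

namespace MockMaass

open UpperHalfPlane Matrix.SpecialLinearGroup
open scoped MatrixGroups ContDiff

noncomputable section

/-! ### Vector-valued Maass forms -/

/-- The hyperbolic Laplacian `-y² (∂²/∂x² + ∂²/∂y²)` of a function on the upper half-plane. -/
def hypLaplacian (f : ℍ → ℂ) (τ : ℍ) : ℂ :=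
  -((τ.im : ℂ) ^ 2) * Laplacian.laplacian (f ∘ ofComplex) (τ : ℂ)

/-- `U` is a vector-valued Maass (wave) form of weight zero on `Γ` with multiplier system `Ψ` (a
representation of `Γ`, diagonal on the matrices `±(1 n; 0 1)` in `Γ`) and Laplace eigenvalue `ev`:
the components are smooth, satisfy `U_j(Mτ) = ∑ₖ Ψ_M(j,k) U_k(τ)` for `M ∈ Γ`, are
eigenfunctions of the hyperbolic Laplacian and grow at most polynomially at every cusp. -/
structure IsMaassForm {ι : Type} [Fintype ι] [DecidableEq ι] (Γ : Subgroup SL(2, ℤ))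
    (Ψ : Γ →* Matrix ι ι ℂ) (ev : ℂ) (U : ι → ℍ → ℂ) : Prop where
  smooth : ∀ j, ContDiffOn ℝ ∞ (U j ∘ ofComplex) {z : ℂ | 0 < z.im}
  diag : ∀ M : Γ, (M : SL(2, ℤ)) 1 0 = 0 → (Ψ M).IsDiag
  transform : ∀ (M : Γ) (j : ι) (τ : ℍ), U j ((M : SL(2, ℤ)) • τ) = ∑ k, Ψ M j k * U k τ
  eigen : ∀ (j : ι) (τ : ℍ), hypLaplacian (U j) τ = ev * U j τ
  growth : ∀ (j : ι) (γ : SL(2, ℤ)), ∃ N : ℕ,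
    (fun τ : ℍ => U j (γ • τ)) =O[atImInfty] (fun τ : ℍ => τ.im ^ N)

/-- The `K`-Bessel function of order zero (at `x > 0`). -/
def besselK0 (x : ℝ) : ℝ := ∫ t in Set.Ioi (0 : ℝ), Real.exp (-x * Real.cosh t)

/-- The absolutely convergent Fourier expansion (for Laplace eigenvalue `1/4`)
`U(τ) = c √τ₂ + √τ₂ ∑ d(n) K₀(2π|n|τ₂) e^{2πi n τ₁}`, where the sum runs over the nonzero
`n = m + α`, `m ∈ ℤ`, and where the coefficients `d(m + α)` (written `d m`) have polynomial growth.
The term `c √τ₂` is the constant term. -/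
structure HasFourierExpansion (U : ℍ → ℂ) (α : ℝ) (c : ℂ) (d : ℤ → ℂ) : Prop where
  coeff_growth : ∃ (C : ℝ) (N : ℕ), ∀ m : ℤ, ‖d m‖ ≤ C * (1 + |(m : ℝ)|) ^ N
  hasSum : ∀ τ : ℍ, HasSum
    (fun m : ℤ => if (m : ℝ) + α = 0 then 0 else
      (Real.sqrt τ.im : ℂ) * d m * (besselK0 (2 * Real.pi * |(m : ℝ) + α| * τ.im) : ℂ) *
        Complex.exp (2 * Real.pi * Complex.I * (((m : ℝ) + α : ℝ) : ℂ) * (τ.re : ℂ)))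
    (U τ - c * (Real.sqrt τ.im : ℂ))

/-! ### The quadratic form `6 n₁² - 2 n₂²` -/

def Q (n : ℝ × ℝ) : ℝ := 6 * n.1 ^ 2 - 2 * n.2 ^ 2

/-- The bilinear form with `B n n = 2 Q n`. -/
def B (n m : ℝ × ℝ) : ℝ := 12 * n.1 * m.1 - 4 * n.2 * m.2

/-- The component `C_Q` of `{Q = -1}`. -/
def CQ : Set (ℝ × ℝ) := {c | Q c = -1 ∧ 0 < c.2}

/-- The parametrization `c(t)` of `C_Q`. -/
def cVec (t : ℝ) : ℝ × ℝ := (Real.sinh t / Real.sqrt 6, Real.cosh t / Real.sqrt 2)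

/-- The parametrization `c^⊥(t)` of the component with positive first coordinate of `{Q = 1}`. -/
def cPerpVec (t : ℝ) : ℝ × ℝ := (Real.cosh t / Real.sqrt 6, Real.sinh t / Real.sqrt 2)

/-- For `c ∈ C_Q`, the parameter `t` with `c(t) = c`. -/
def param (c : ℝ × ℝ) : ℝ := Real.arsinh (Real.sqrt 6 * c.1)

/-- For `c = c(t) ∈ C_Q`, the orthogonal vector `c^⊥ = c^⊥(t)`. -/
def perp (c : ℝ × ℝ) : ℝ × ℝ := cPerpVec (param c)

theorem cVec_param {c : ℝ × ℝ} (hc : c ∈ CQ) : cVec (param c) = c := by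
  obtain ⟨h1, h2⟩ := hc
  have h6 : Real.sqrt 6 ≠ 0 := by positivity
  have h2' : Real.sqrt 2 ≠ 0 := by positivity
  ext
  · simp only [cVec, param, Real.sinh_arsinh]
    field_simp
  · simp only [cVec, param, Real.cosh_arsinh]
    rw [div_eq_iff h2', Real.sqrt_eq_iff_mul_self_eq (by positivity) (by positivity)]
    have e6 : Real.sqrt 6 ^ 2 = 6 := Real.sq_sqrt (by norm_num)
    have e2 : Real.sqrt 2 ^ 2 = 2 := Real.sq_sqrt (by norm_num)
    simp only [Q] at h1
    rw [mul_pow, e6, mul_mul_mul_comm, ← pow_two, ← pow_two, e2]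
    linarith

def c₁ : ℝ × ℝ := (-1 / (2 * Real.sqrt 3), 3 / (2 * Real.sqrt 3))

def c₂ : ℝ × ℝ := (1 / (2 * Real.sqrt 3), 3 / (2 * Real.sqrt 3))

theorem c₁_mem : c₁ ∈ CQ := by
  have e3 : Real.sqrt 3 ^ 2 = 3 := Real.sq_sqrt (by norm_num)
  refine ⟨?_, ?_⟩
  · simp only [Q, c₁, div_pow, mul_pow, e3]; norm_num
  · simp only [c₁]; positivity

theorem c₂_mem : c₂ ∈ CQ := by
  have e3 : Real.sqrt 3 ^ 2 = 3 := Real.sq_sqrt (by norm_num)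
  refine ⟨?_, ?_⟩
  · simp only [Q, c₂, div_pow, mul_pow, e3]; norm_num
  · simp only [c₂]; positivity

/-! ### Mock Maass theta functions, their completions and the shadow contributions -/

/-- The point `n + μ` of the coset `ℤ² + μ`. -/
def shift (μ : ℝ × ℝ) (n : ℤ × ℤ) : ℝ × ℝ := ((n.1 : ℝ) + μ.1, (n.2 : ℝ) + μ.2)

/-- `q^{Q(v)}` with `q = e^{2πiτ}`. -/
def qQ (v : ℝ × ℝ) (τ : ℍ) : ℂ := Complex.exp (2 * Real.pi * Complex.I * (Q v : ℂ) * (τ : ℂ))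

/-- The summand at `n + μ` of `Θ̂_μ`, without the factor `√τ₂`. -/
def thetaHatTerm (μ : ℝ × ℝ) (τ : ℍ) (n : ℤ × ℤ) : ℂ :=
  qQ (shift μ n) τ *
    ((∫ t in (param c₁)..(param c₂),
      Real.exp (-Real.pi * B (shift μ n) (cVec t) ^ 2 * τ.im) : ℝ) : ℂ)

/-- The completed mock Maass theta function `Θ̂_μ`. -/
def thetaHat (μ : ℝ × ℝ) (τ : ℍ) : ℂ :=
  (Real.sqrt τ.im : ℂ) * ∑' n : ℤ × ℤ, thetaHatTerm μ τ n

/-- The summand at `n + μ ≠ 0` of the first series in `Θ_μ`. The sign factor vanishes unless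
`Q(n + μ) > 0`. -/
def thetaPosTerm (μ : ℝ × ℝ) (τ : ℍ) (n : ℤ × ℤ) : ℂ :=
  if shift μ n = 0 then 0 else
    ((1 - Real.sign (B (shift μ n) c₁) * Real.sign (B (shift μ n) c₂) : ℝ) : ℂ) *
      (besselK0 (2 * Real.pi * Q (shift μ n) * τ.im) : ℂ) *
      Complex.exp (2 * Real.pi * Complex.I * (Q (shift μ n) : ℂ) * (τ.re : ℂ))

/-- The summand at `n + μ ≠ 0` of the second series in `Θ_μ`. The sign factor vanishes unless
`Q(n + μ) < 0`. -/
def thetaNegTerm (μ : ℝ × ℝ) (τ : ℍ) (n : ℤ × ℤ) : ℂ :=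
  if shift μ n = 0 then 0 else
    ((1 - Real.sign (B (shift μ n) (perp c₁)) * Real.sign (B (shift μ n) (perp c₂)) : ℝ) : ℂ) *
      (besselK0 (-2 * Real.pi * Q (shift μ n) * τ.im) : ℂ) *
      Complex.exp (2 * Real.pi * Complex.I * (Q (shift μ n) : ℂ) * (τ.re : ℂ))

open Classical in
/-- The mock Maass theta function `Θ_μ`. -/
def theta (μ : ℝ × ℝ) (τ : ℍ) : ℂ :=
  1 / 2 * (Real.sign (param c₂ - param c₁) : ℂ) * (Real.sqrt τ.im : ℂ) *
      (∑' n : ℤ × ℤ, thetaPosTerm μ τ n) +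
    1 / 2 * (Real.sign (param c₂ - param c₁) : ℂ) * (Real.sqrt τ.im : ℂ) *
      (∑' n : ℤ × ℤ, thetaNegTerm μ τ n) +
    (if ∃ m : ℤ × ℤ, μ = ((m.1 : ℝ), (m.2 : ℝ)) then
      ((param c₂ - param c₁ : ℝ) : ℂ) * (Real.sqrt τ.im : ℂ) else 0)

/-- The function `α_{t₀}`, for `c = c(t₀)`. -/
def shadowCoeff (c : ℝ × ℝ) (v : ℝ × ℝ) : ℝ :=
  if 0 < B v c * B v (perp c) then
    ∫ t in Set.Ioi (param c), Real.exp (-Real.pi * B v (cVec t) ^ 2)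
  else if B v c * B v (perp c) < 0 then
    -∫ t in Set.Iic (param c), Real.exp (-Real.pi * B v (cVec t) ^ 2)
  else 0

/-- The summand at `n + μ` of `φ_μ^{[c]}`, without the factor `√τ₂`. -/
def shadowTerm (c μ : ℝ × ℝ) (τ : ℍ) (n : ℤ × ℤ) : ℂ :=
  (shadowCoeff c (Real.sqrt τ.im • shift μ n) : ℂ) * qQ (shift μ n) τ

/-- The function `φ_μ^{[c]}`. -/
def shadow (c μ : ℝ × ℝ) (τ : ℍ) : ℂ :=
  (Real.sqrt τ.im : ℂ) * ∑' n : ℤ × ℤ, shadowTerm c μ τ n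

/-! ### The functions `G_j` and the multipliers -/

def muVec (j : Fin 4) : ℝ × ℝ := (((j : ℕ) : ℝ) / 6, 0)

def lamVec : ℝ × ℝ := (1 / 2, 1 / 2)

def G (j : Fin 4) (τ : ℍ) : ℂ := theta (muVec j) τ + theta (muVec j + lamVec) τ

def GHat (j : Fin 4) (τ : ℍ) : ℂ := thetaHat (muVec j) τ + thetaHat (muVec j + lamVec) τ

/-- The shadow contributions to `Ĝ_j`: the sum over `μ ∈ {μ_j, μ_j + λ}` of
`φ_μ^{[c₁]} - φ_μ^{[c₂]}`. -/
def shadowG (j : Fin 4) (τ : ℍ) : ℂ :=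
  (shadow c₁ (muVec j) τ - shadow c₂ (muVec j) τ) +
    (shadow c₁ (muVec j + lamVec) τ - shadow c₂ (muVec j + lamVec) τ)

def ζ (n : ℕ) : ℂ := Complex.exp (2 * Real.pi * Complex.I / n)

/-- `T = (1 1; 0 1)` as an element of `Γ₀(2)`. -/
def T : CongruenceSubgroup.Gamma0 2 :=
  ⟨ModularGroup.T, by
    rw [CongruenceSubgroup.Gamma0_mem, ModularGroup.coe_T]
    simp⟩

def matR : SL(2, ℤ) := ⟨!![1, 0; 2, 1], by simp [Matrix.det_fin_two]⟩

/-- `R = (1 0; 2 1)` as an element of `Γ₀(2)`. -/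
def R : CongruenceSubgroup.Gamma0 2 :=
  ⟨matR, by
    rw [CongruenceSubgroup.Gamma0_mem]
    change ((2 : ℤ) : ZMod 2) = 0
    decide⟩

def PhiT : Matrix (Fin 4) (Fin 4) ℂ :=
  !![1, 0, 0, 0;
     0, ζ 6, 0, 0;
     0, 0, ζ 3 ^ 2, 0;
     0, 0, 0, -1]

def PhiR : Matrix (Fin 4) (Fin 4) ℂ :=
  (1 / (Real.sqrt 3 : ℂ)) •
  !![0, 2 * ζ 12, 0, ζ 4 ^ 3;
     ζ 12, 0, ζ 12 ^ 11, 0;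
     0, ζ 12 ^ 11, 0, ζ 12;
     ζ 4 ^ 3, 0, 2 * ζ 12, 0]

end

end MockMaass

namespace MockMaass

open UpperHalfPlane Matrix.SpecialLinearGroup
open scoped MatrixGroups ContDiff

noncomputable section

/-! ### Geometry of the quadratic form -/

/-! In the coordinates of `pt` the form is `x² - 3y²`, and the cosets of `μ_j` and `μ_j + λ`
together are a single coset `(j/2, j/6)` of the norm-form lattice `ℤ[√3]`. Multiplication by the
unit `-(2 - √3)` preserves this coset and `Q`, and it translates the parameter `t` by `log (2 + √3)
= t₂ - t₁`. Summed over the coset, contributions from `t₁` therefore equal those from `t₂`; this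
cancellation gives both the vanishing of the shadows and the eigenvalue equation.

Equality of `G` and `Ĝ`: a nonzero lattice vector has `Q ≠ 0`, since `√3` is irrational, so its
majorant is `|Q| cosh 2(t - s)` for some axis `s` (`IsAxis`). The kernel integrated over `[t₁, t₂]`
is a difference of incomplete Bessel integrals; completing each to half of `K₀` gives the
sign-weighted `K₀` term plus a difference of shadows (`IsAxis.integral_kern`). The shadows cancel by
the unit (`shadowVal_unitEquiv`), and the zero vector gives `t₂ - t₁`. Grouping the terms by the
value of `Q` is the Fourier expansion. Only vectors with axis in `[t₁, t₂]` contribute, and for them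
`|Q|` is the value at `s` of a positive definite form, which bounds their number.

Modularity: Poisson summation (`tsum_kern_inv`) gives the Weil representation of the discriminant
group `ℤ/2 × ℤ/6` on the twelve functions `cosetForm a b`. Since `R` acts as `S T⁻² S`, its matrix
consists of Gauss sums; they vanish off the right parities, and the symmetry `v ↦ -v` leaves four
functions (`thetaVec_R_smul`). A Euclidean descent extends this to `Γ₀(2)`, and linear independence
of the four functions, from their distinct `T`-eigenvalues, makes the matrices unique and hence
multiplicative. Growth at every cusp follows from the action of `SL(2, ℤ)` on all twelve functions.

Eigenvalue: for the kernel `k`, `-y² Δ(√y k) = √y k / 4 - √y ∂ₜ² k / 4` (`hasDerivAt_kernDeriv`).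
After integration the last term is a boundary term, which the unit cancels (`expInt_theta_eigen`).
-/

lemma sqrt_three_sq : Real.sqrt 3 ^ 2 = 3 := Real.sq_sqrt (by norm_num)

lemma sqrt_two_sq : Real.sqrt 2 ^ 2 = 2 := Real.sq_sqrt (by norm_num)

lemma sqrt_six_eq : Real.sqrt 6 = Real.sqrt 2 * Real.sqrt 3 := by
  rw [← Real.sqrt_mul (by norm_num)]; norm_num

/-- The point of the `(n₁, n₂)`-plane at which `Q` takes the value `x² - 3y²`. -/
def pt (x y : ℝ) : ℝ × ℝ := ((x - y) / 2, (x - 3 * y) / 2)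

lemma Q_pt (x y : ℝ) : Q (pt x y) = x ^ 2 - 3 * y ^ 2 := by
  simp only [Q, pt]; ring

lemma pt_neg (x y : ℝ) : pt (-x) (-y) = -pt x y := by
  ext <;> simp [pt] <;> ring

/-- The positive definite majorant of `Q` at the parameter `t`. -/
def maj (t : ℝ) (v : ℝ × ℝ) : ℝ := (B v (cVec t) ^ 2 + B v (cPerpVec t) ^ 2) / 4

lemma B_cVec (v : ℝ × ℝ) (t : ℝ) :
    B v (cVec t) = 2 * Real.sqrt 2 * (Real.sqrt 3 * v.1 * Real.sinh t - v.2 * Real.cosh t) := by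
  simp only [B, cVec]
  have h6 : Real.sqrt 6 ≠ 0 := by positivity
  have h2 : Real.sqrt 2 ≠ 0 := by positivity
  have h3 : Real.sqrt 3 ≠ 0 := by positivity
  rw [sqrt_six_eq]
  field_simp
  linear_combination (2 * v.2 * Real.cosh t * Real.sqrt 3 -
    2 * v.1 * Real.sqrt 3 ^ 2 * Real.sinh t) * sqrt_two_sq -
    (4 * v.1 * Real.sinh t) * sqrt_three_sq

lemma B_cPerpVec (v : ℝ × ℝ) (t : ℝ) :
    B v (cPerpVec t) =
      2 * Real.sqrt 2 * (Real.sqrt 3 * v.1 * Real.cosh t - v.2 * Real.sinh t) := by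
  simp only [B, cPerpVec]
  have h6 : Real.sqrt 6 ≠ 0 := by positivity
  have h2 : Real.sqrt 2 ≠ 0 := by positivity
  have h3 : Real.sqrt 3 ≠ 0 := by positivity
  rw [sqrt_six_eq]
  field_simp
  linear_combination (2 * v.2 * Real.sinh t * Real.sqrt 3 -
    2 * v.1 * Real.sqrt 3 ^ 2 * Real.cosh t) * sqrt_two_sq -
    (4 * v.1 * Real.cosh t) * sqrt_three_sq

/-- The vectors `c(t)` and `c^⊥(t)` are orthogonal with `Q = -1` and `Q = 1`; this expands `Q v` in
that basis. -/
lemma B_sq_sub_B_sq (v : ℝ × ℝ) (t : ℝ) :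
    B v (cPerpVec t) ^ 2 - B v (cVec t) ^ 2 = 4 * Q v := by
  rw [B_cVec, B_cPerpVec]
  simp only [Q, mul_pow, sqrt_two_sq]
  linear_combination (24 * v.1 ^ 2 - 8 * v.2 ^ 2) * Real.cosh_sq t +
    8 * v.1 ^ 2 * (Real.cosh t ^ 2 - Real.sinh t ^ 2) * sqrt_three_sq

lemma maj_eq (v : ℝ × ℝ) (t : ℝ) : maj t v = Q v + B v (cVec t) ^ 2 / 2 := by
  have := B_sq_sub_B_sq v t
  rw [maj]; linarith

lemma abs_Q_le_maj (v : ℝ × ℝ) (t : ℝ) : |Q v| ≤ maj t v := by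
  have := B_sq_sub_B_sq v t
  rw [maj, abs_le]
  constructor <;> nlinarith [sq_nonneg (B v (cVec t)), sq_nonneg (B v (cPerpVec t))]

lemma B_cVec_add (v : ℝ × ℝ) (t s : ℝ) : B v (cVec (t + s)) =
    B v (cVec t) * Real.cosh s + B v (cPerpVec t) * Real.sinh s := by
  simp only [B_cVec, B_cPerpVec, Real.sinh_add, Real.cosh_add]; ring

lemma B_cPerpVec_add (v : ℝ × ℝ) (t s : ℝ) : B v (cPerpVec (t + s)) =
    B v (cPerpVec t) * Real.cosh s + B v (cVec t) * Real.sinh s := by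
  simp only [B_cVec, B_cPerpVec, Real.sinh_add, Real.cosh_add]; ring

lemma hasDerivAt_B_cVec (v : ℝ × ℝ) (t : ℝ) :
    HasDerivAt (fun t => B v (cVec t)) (B v (cPerpVec t)) t := by
  simp only [B_cVec, B_cPerpVec]
  exact (((Real.hasDerivAt_sinh t).const_mul _).sub
    ((Real.hasDerivAt_cosh t).const_mul _)).const_mul _

lemma hasDerivAt_B_cPerpVec (v : ℝ × ℝ) (t : ℝ) :
    HasDerivAt (fun t => B v (cPerpVec t)) (B v (cVec t)) t := by
  simp only [B_cVec, B_cPerpVec]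
  exact (((Real.hasDerivAt_cosh t).const_mul _).sub
    ((Real.hasDerivAt_sinh t).const_mul _)).const_mul _

lemma hasDerivAt_maj (v : ℝ × ℝ) (t : ℝ) :
    HasDerivAt (fun t => maj t v) (B v (cVec t) * B v (cPerpVec t)) t := by
  have := (((hasDerivAt_B_cVec v t).pow 2).add ((hasDerivAt_B_cPerpVec v t).pow 2)).div_const 4
  refine this.congr_deriv ?_
  simp; ring

lemma continuous_maj (v : ℝ × ℝ) : Continuous fun t => maj t v :=
  continuous_iff_continuousAt.2 fun t => (hasDerivAt_maj v t).continuousAt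

lemma B_neg (v w : ℝ × ℝ) : B (-v) w = -B v w := by simp [B]; ring

lemma Q_neg (v : ℝ × ℝ) : Q (-v) = Q v := by simp [Q]

lemma maj_neg (t : ℝ) (v : ℝ × ℝ) : maj t (-v) = maj t v := by simp [maj, B_neg]

/-- With `majSinh`, these are `cosh` and `sinh` of `2t - β`, where `cosh β = 2` and `sinh β = √3`.
-/
def majCosh (t : ℝ) : ℝ := 2 * Real.cosh (2 * t) - Real.sqrt 3 * Real.sinh (2 * t)

def majSinh (t : ℝ) : ℝ := 2 * Real.sinh (2 * t) - Real.sqrt 3 * Real.cosh (2 * t)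

lemma maj_pt (t x y : ℝ) : maj t (pt x y) =
    majCosh t * (x ^ 2 + 3 * y ^ 2) + 2 * Real.sqrt 3 * majSinh t * x * y := by
  have h : Real.cosh t ^ 2 = 1 + Real.sinh t ^ 2 := by rw [Real.cosh_sq]; ring
  rw [maj, B_cVec, B_cPerpVec]
  simp only [mul_pow, sqrt_two_sq, majCosh, majSinh, Real.cosh_two_mul, Real.sinh_two_mul, pt]
  have h3 := sqrt_three_sq
  linear_combination ((x - y) ^ 2 / 2 * (Real.cosh t ^ 2 + Real.sinh t ^ 2) +
    2 * (Real.cosh t ^ 2 + Real.sinh t ^ 2) * x * y) * h3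

lemma majCosh_sq (t : ℝ) : majCosh t ^ 2 = 1 + majSinh t ^ 2 := by
  have h : Real.cosh (2 * t) ^ 2 = 1 + Real.sinh (2 * t) ^ 2 := by rw [Real.cosh_sq]; ring
  simp only [majCosh, majSinh]
  linear_combination (4 - Real.sqrt 3 ^ 2) * h - sqrt_three_sq

lemma majCosh_pos (t : ℝ) : 0 < majCosh t := by
  have h1 : Real.sqrt 3 < 2 := by
    rw [Real.sqrt_lt' (by norm_num)]; norm_num
  have h2 := Real.sinh_lt_cosh (2 * t)
  have h3 := Real.cosh_pos (2 * t)
  have h4 : 0 < Real.sqrt 3 := by positivity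
  simp only [majCosh]
  nlinarith

lemma continuous_majCosh : Continuous majCosh := by
  unfold majCosh; fun_prop

lemma continuous_majSinh : Continuous majSinh := by
  unfold majSinh; fun_prop

/-- Since `2√3 |xy| ≤ x² + 3y²`, the majorant is at least `(C - |S|)(x² + 3y²)` with `C = majCosh
t`, `S = majSinh t`. Here `C - |S| = 1 / (C + |S|)`, which is bounded below on a compact interval.
-/
lemma exists_le_maj (t₁ t₂ : ℝ) : ∃ κ : ℝ, 0 < κ ∧ ∀ t ∈ Set.Icc t₁ t₂, ∀ x y : ℝ,
    κ * (x ^ 2 + y ^ 2) ≤ maj t (pt x y) := by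
  have hc : Continuous fun t => majCosh t + |majSinh t| :=
    continuous_majCosh.add continuous_majSinh.abs
  obtain ⟨K, hK⟩ := (isCompact_Icc (a := t₁) (b := t₂)).bddAbove_image hc.continuousOn
  refine ⟨1 / max K 1, by positivity, fun t ht x y => ?_⟩
  have h1 : majCosh t + |majSinh t| ≤ max K 1 :=
    (hK ⟨t, ht, rfl⟩).trans (le_max_left _ _)
  have h2 : (majCosh t - |majSinh t|) * (majCosh t + |majSinh t|) = 1 := by
    have := majCosh_sq t
    have h := sq_abs (majSinh t)
    linear_combination this - h
  have h3 : 0 < majCosh t + |majSinh t| := by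
    have := majCosh_pos t
    positivity
  have h4 : 1 / max K 1 ≤ majCosh t - |majSinh t| := by
    rw [eq_div_of_mul_eq h3.ne' h2]
    exact one_div_le_one_div_of_le h3 h1
  have h5 : |2 * Real.sqrt 3 * majSinh t * x * y| ≤ |majSinh t| * (x ^ 2 + 3 * y ^ 2) := by
    have : |2 * Real.sqrt 3 * majSinh t * x * y| = |majSinh t| * |2 * x * (Real.sqrt 3 * y)| := by
      rw [← abs_mul]; congr 1; ring
    rw [this]
    refine mul_le_mul_of_nonneg_left ?_ (abs_nonneg _)
    rw [abs_le]
    have h3 := sqrt_three_sq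
    constructor <;>
      nlinarith [sq_nonneg (x + Real.sqrt 3 * y), sq_nonneg (x - Real.sqrt 3 * y), sq_nonneg y]
  rw [maj_pt]
  have h6 : 0 < 1 / max K 1 := by positivity
  have h7 := neg_abs_le (2 * Real.sqrt 3 * majSinh t * x * y)
  nlinarith [mul_le_mul_of_nonneg_right h4 (show 0 ≤ x ^ 2 + 3 * y ^ 2 by positivity),
    mul_nonneg h6.le (sq_nonneg y)]

/-! ### The two base points -/

lemma sinh_param_c₂ : Real.sinh (param c₂) = 1 / Real.sqrt 2 := by
  simp only [param, Real.sinh_arsinh, c₂, sqrt_six_eq]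
  have h2 : Real.sqrt 2 ≠ 0 := by positivity
  have h3 : Real.sqrt 3 ≠ 0 := by positivity
  field_simp
  exact sqrt_two_sq

lemma param_c₁ : param c₁ = -param c₂ := by
  simp only [param, c₁, c₂, ← Real.arsinh_neg]
  congr 1; ring

lemma cosh_param_c₂ : Real.cosh (param c₂) = Real.sqrt 3 / Real.sqrt 2 := by
  have h := congrArg Prod.snd (cVec_param c₂_mem)
  have h2 : Real.sqrt 2 ≠ 0 := by positivity
  have h3 : Real.sqrt 3 ≠ 0 := by positivity
  rw [cVec] at h
  simp only at h
  rw [div_eq_iff h2] at h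
  rw [h, c₂]
  field_simp
  nlinarith [sqrt_three_sq, sqrt_two_sq]

lemma param_c₂_pos : 0 < param c₂ := by
  rw [← Real.sinh_pos_iff, sinh_param_c₂]; positivity

lemma param_c₁_lt : param c₁ < param c₂ := by
  rw [param_c₁]; linarith [param_c₂_pos]

lemma param_c₂_eq_artanh : param c₂ = Real.artanh (1 / Real.sqrt 3) := by
  rw [← Real.artanh_tanh (param c₂), Real.tanh_eq_sinh_div_cosh, sinh_param_c₂, cosh_param_c₂]
  congr 1
  have h2 : Real.sqrt 2 ≠ 0 := by positivity
  field_simp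

/-! ### Lattice cosets -/

/-- The points of the coset of `(a/2, b/6)` in the lattice with norm form `x² - 3y²`. -/
def latPt (a b : ℤ) (n : ℤ × ℤ) : ℝ × ℝ := pt (n.1 + a / 2) (n.2 + b / 6)

/-- The coset `(μ_j + ℤ²) ∪ (μ_j + λ + ℤ²)` is the coset `latPt j j`. -/
def cosetEquiv : (ℤ × ℤ) ⊕ (ℤ × ℤ) ≃ ℤ × ℤ where
  toFun := Sum.elim (fun m => (3 * m.1 - m.2, m.1 - m.2)) fun m => (3 * m.1 - m.2 + 1, m.1 - m.2)
  -- The number `n.1 - 3 * n.2` is `2 m₂` on the first coset and `2 m₂ + 1` on the second: its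
  -- parity tells the cosets apart and its half recovers `m₂`.
  invFun n := if (n.1 - 3 * n.2) % 2 = 0
    then Sum.inl (n.2 + (n.1 - 3 * n.2) / 2, (n.1 - 3 * n.2) / 2)
    else Sum.inr (n.2 + (n.1 - 3 * n.2) / 2, (n.1 - 3 * n.2) / 2)
  left_inv := by
    rintro (⟨m₁, m₂⟩ | ⟨m₁, m₂⟩)
    · have h1 : (3 * m₁ - m₂ - 3 * (m₁ - m₂)) % 2 = 0 := by lia
      have h2 : (3 * m₁ - m₂ - 3 * (m₁ - m₂)) / 2 = m₂ := by lia
      simp [h1, h2]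
    · have h1 : (3 * m₁ - m₂ + 1 - 3 * (m₁ - m₂)) % 2 = 1 := by lia
      have h2 : (3 * m₁ - m₂ + 1 - 3 * (m₁ - m₂)) / 2 = m₂ := by lia
      simp [h1, h2]
  right_inv := by
    rintro ⟨a, b⟩
    by_cases h : (a - 3 * b) % 2 = 0
    · simp only [h, if_true, Sum.elim_inl, Prod.mk.injEq]; constructor <;> lia
    · simp only [h, if_false, Sum.elim_inr, Prod.mk.injEq]; constructor <;> lia

lemma shift_muVec (j : Fin 4) (m : ℤ × ℤ) :
    shift (muVec j) m = latPt (j : ℕ) (j : ℕ) (cosetEquiv (Sum.inl m)) := by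
  ext <;> simp [shift, muVec, latPt, pt, cosetEquiv] <;> ring

lemma shift_muVec_add (j : Fin 4) (m : ℤ × ℤ) :
    shift (muVec j + lamVec) m = latPt (j : ℕ) (j : ℕ) (cosetEquiv (Sum.inr m)) := by
  ext <;> simp [shift, muVec, lamVec, latPt, pt, cosetEquiv] <;> ring

lemma summable_shift {F : ℝ × ℝ → ℂ} {j : Fin 4}
    (h : Summable fun n => F (latPt (j : ℕ) (j : ℕ) n)) :
    Summable (fun m => F (shift (muVec j) m)) ∧
      Summable fun m => F (shift (muVec j + lamVec) m) := by
  have h' := cosetEquiv.summable_iff.2 h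
  constructor
  · simp only [shift_muVec]; exact h'.comp_injective Sum.inl_injective
  · simp only [shift_muVec_add]; exact h'.comp_injective Sum.inr_injective

lemma tsum_shift_add {F : ℝ × ℝ → ℂ} {j : Fin 4}
    (h : Summable fun n => F (latPt (j : ℕ) (j : ℕ) n)) :
    ∑' m, F (shift (muVec j) m) + ∑' m, F (shift (muVec j + lamVec) m) =
      ∑' n, F (latPt (j : ℕ) (j : ℕ) n) := by
  have h' := cosetEquiv.summable_iff.2 h
  simp only [shift_muVec, shift_muVec_add]
  exact (Summable.tsum_sum (h'.comp_injective Sum.inl_injective)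
    (h'.comp_injective Sum.inr_injective)).symm.trans 
    (cosetEquiv.tsum_eq fun n => F (latPt (j : ℕ) (j : ℕ) n))

/-- The automorphism of the coset `latPt j j` given by the negative of the fundamental unit. -/
def unitEquiv (j : ℤ) : ℤ × ℤ ≃ ℤ × ℤ where
  toFun n := (-2 * n.1 + 3 * n.2 - j, n.1 - 2 * n.2)
  invFun n := (-2 * n.1 - 3 * n.2 - 2 * j, -n.1 - 2 * n.2 - j)
  left_inv n := by ext <;> simp <;> ring
  right_inv n := by ext <;> simp <;> ring

lemma latPt_unitEquiv (j : ℤ) (n : ℤ × ℤ) : latPt j j (unitEquiv j n) =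
    (-(2 * (latPt j j n).1 + (latPt j j n).2), -(3 * (latPt j j n).1 + 2 * (latPt j j n).2)) := by
  ext <;> simp [latPt, unitEquiv, pt] <;> ring

/-- The unit is an isometry acting on the hyperbola as translation by `t₂ - t₁`. The factor `-1` is
needed for it to map the coset `(j/2, j/6)` to itself rather than to its negative. -/
lemma B_cVec_unitEquiv (j : ℤ) (n : ℤ × ℤ) (t : ℝ) :
    B (latPt j j (unitEquiv j n)) (cVec (param c₂ + t)) =
      -B (latPt j j n) (cVec (param c₁ + t)) := by
  have h2 : Real.sqrt 2 ≠ 0 := by positivity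
  rw [latPt_unitEquiv, param_c₁, B_cVec, B_cVec]
  simp only [Real.sinh_add, Real.cosh_add, Real.sinh_neg, Real.cosh_neg, sinh_param_c₂,
    cosh_param_c₂]
  field_simp
  ring_nf
  have h3 : Real.sqrt 3 ^ 2 = 3 := sqrt_three_sq
  rw [h3]; ring

lemma B_cPerpVec_unitEquiv (j : ℤ) (n : ℤ × ℤ) (t : ℝ) :
    B (latPt j j (unitEquiv j n)) (cPerpVec (param c₂ + t)) =
      -B (latPt j j n) (cPerpVec (param c₁ + t)) := by
  have h2 : Real.sqrt 2 ≠ 0 := by positivity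
  rw [latPt_unitEquiv, param_c₁, B_cPerpVec, B_cPerpVec]
  simp only [Real.sinh_add, Real.cosh_add, Real.sinh_neg, Real.cosh_neg, sinh_param_c₂,
    cosh_param_c₂]
  field_simp
  ring_nf
  have h3 : Real.sqrt 3 ^ 2 = 3 := sqrt_three_sq
  rw [h3]; ring

lemma Q_unitEquiv (j : ℤ) (n : ℤ × ℤ) :
    Q (latPt j j (unitEquiv j n)) = Q (latPt j j n) := by
  rw [latPt_unitEquiv]; simp only [Q]; ring

/-- After clearing denominators, a nontrivial zero of `x² - 3y²` would make `√3` rational. -/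
lemma eq_zero_of_Q_latPt {a b : ℤ} {n : ℤ × ℤ} (h : Q (latPt a b n) = 0) : latPt a b n = 0 := by
  have h1 : (6 * (2 * n.1 + a) : ℤ) ^ 2 = 3 * (2 * (6 * n.2 + b)) ^ 2 := by
    rw [latPt, Q_pt] at h
    have : ((6 * (2 * n.1 + a) : ℤ) : ℝ) ^ 2 = 3 * ((2 * (6 * n.2 + b) : ℤ) : ℝ) ^ 2 := by
      push_cast; linarith
    exact_mod_cast this
  have h2 : (2 * (6 * n.2 + b) : ℤ) = 0 := by
    by_contra h0
    have hirr : Irrational (Real.sqrt 3) := Nat.Prime.irrational_sqrt Nat.prime_three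
    apply hirr
    refine ⟨|((6 * (2 * n.1 + a) : ℤ) : ℚ) / ((2 * (6 * n.2 + b) : ℤ) : ℚ)|, ?_⟩
    have h1' : ((6 * (2 * n.1 + a) : ℤ) : ℝ) ^ 2 = 3 * ((2 * (6 * n.2 + b) : ℤ) : ℝ) ^ 2 := by
      exact_mod_cast h1
    have h0' : ((2 * (6 * n.2 + b) : ℤ) : ℝ) ≠ 0 := by exact_mod_cast h0
    rw [Rat.cast_abs, Rat.cast_div, Rat.cast_intCast, Rat.cast_intCast, ← Real.sqrt_sq_eq_abs,
      div_pow, h1', mul_div_cancel_right₀ _ (pow_ne_zero 2 h0')]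
  have h3 : (6 * (2 * n.1 + a) : ℤ) = 0 := by
    rw [h2] at h1; simpa using h1
  have h4 : (n.1 : ℝ) + a / 2 = 0 := by
    have : ((6 * (2 * n.1 + a) : ℤ) : ℝ) = 0 := by exact_mod_cast h3
    push_cast at this; linarith
  have h5 : (n.2 : ℝ) + b / 6 = 0 := by
    have : ((2 * (6 * n.2 + b) : ℤ) : ℝ) = 0 := by exact_mod_cast h2
    push_cast at this; linarith
  simp [latPt, h4, h5, pt]

end

noncomputable section

/-! ### Summability over lattices -/

/-- The constant is determinant over trace, `λ₁λ₂ / (λ₁ + λ₂)`, which lies below the smaller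
eigenvalue. -/
lemma exists_quad_lower {A D b : ℝ} (hA : 0 < A) (h : b ^ 2 < A * D) :
    ∃ κ : ℝ, 0 < κ ∧ ∀ x y : ℝ, κ * (x ^ 2 + y ^ 2) ≤ A * x ^ 2 + 2 * b * x * y + D * y ^ 2 := by
  have hD : 0 < D := by
    by_contra! hD
    nlinarith [sq_nonneg b]
  refine ⟨(A * D - b ^ 2) / (A + D), div_pos (by linarith) (by linarith), fun x y => ?_⟩
  set κ := (A * D - b ^ 2) / (A + D) with hκ
  have h0 : κ * (A + D) = A * D - b ^ 2 := by
    rw [hκ, div_mul_cancel₀]; positivity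
  have hp : 0 < A - κ := by
    rw [hκ, sub_pos, div_lt_iff₀ (by positivity)]
    nlinarith [sq_nonneg b]
  have h1 : 0 ≤ (A - κ) * ((A - κ) * x ^ 2 + 2 * b * x * y + (D - κ) * y ^ 2) := by
    have : (A - κ) * ((A - κ) * x ^ 2 + 2 * b * x * y + (D - κ) * y ^ 2) =
        ((A - κ) * x + b * y) ^ 2 + (κ * y) ^ 2 := by
      linear_combination -y ^ 2 * h0
    rw [this]; positivity
  have h2 := nonneg_of_mul_nonneg_right h1 hp
  linarith

lemma summable_exp_sq {κ : ℝ} (hκ : 0 < κ) (x : ℝ) :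
    Summable fun n : ℤ => Real.exp (-κ * ((n : ℝ) + x) ^ 2) := by
  -- The parameter `|x| κ / π` reproduces the cross term in `(n + x)² ≥ n² - 2|x||n|`.
  have h := summable_pow_mul_jacobiTheta₂_term_bound (|x| * κ / Real.pi)
    (div_pos hκ Real.pi_pos) 0
  refine Summable.of_nonneg_of_le (fun _ => (Real.exp_pos _).le) (fun n => ?_) h
  rw [pow_zero, one_mul, Real.exp_le_exp]
  have hpi := Real.pi_pos.ne'
  have e : -Real.pi * (κ / Real.pi * (n : ℝ) ^ 2 - 2 * (|x| * κ / Real.pi) * (|n| : ℤ)) =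
      -κ * ((n : ℝ) ^ 2 - 2 * |x| * |(n : ℝ)|) := by
    push_cast; field_simp
  rw [e]
  have h1 : -(|x| * |(n : ℝ)|) ≤ x * n := by rw [← abs_mul]; exact neg_abs_le _
  nlinarith [sq_nonneg x]

lemma summable_exp_sq_add {κ : ℝ} (hκ : 0 < κ) (x y : ℝ) :
    Summable fun n : ℤ × ℤ =>
      Real.exp (-κ * (((n.1 : ℝ) + x) ^ 2 + ((n.2 : ℝ) + y) ^ 2)) := by
  have := (summable_exp_sq hκ x).mul_of_nonneg (summable_exp_sq hκ y)
    (fun _ => (Real.exp_pos _).le) (fun _ => (Real.exp_pos _).le)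
  refine this.congr fun n => ?_
  rw [← Real.exp_add]; congr 1; ring

/-! ### Poisson summation for binary quadratic forms -/

lemma tsum_exp_quadratic {a : ℂ} (ha : 0 < a.re) (b x : ℂ) :
    ∑' n : ℤ, Complex.exp (-Real.pi * (a * (n + x) ^ 2 + 2 * b * (n + x))) =
      1 / a ^ (1 / 2 : ℂ) * ∑' k : ℤ, Complex.exp (-Real.pi * k ^ 2 / a +
        2 * Real.pi * Complex.I * k * (x + b / a) + Real.pi * b ^ 2 / a) := by
  have ha0 : a ≠ 0 := fun h => by simp [h] at ha
  calc _ = ∑' n : ℤ, Complex.exp (-Real.pi * (a * x ^ 2 + 2 * b * x)) *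
        Complex.exp (-Real.pi * a * n ^ 2 + 2 * Real.pi * (-(a * x + b)) * n) :=
        tsum_congr fun n => by rw [← Complex.exp_add]; congr 1; ring
    _ = 1 / a ^ (1 / 2 : ℂ) * ∑' k : ℤ, Complex.exp (-Real.pi * (a * x ^ 2 + 2 * b * x)) *
        Complex.exp (-Real.pi / a * (k + Complex.I * (-(a * x + b))) ^ 2) := by
        rw [tsum_mul_left, Complex.tsum_exp_neg_quadratic ha, mul_left_comm, ← tsum_mul_left]
    _ = _ := by
        congr 1
        refine tsum_congr fun n => ?_
        rw [← Complex.exp_add]; congr 1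
        field_simp
        linear_combination (-(a * x + b) ^ 2) * Complex.I_sq

/-- Poisson summation one variable at a time: `F₂` is the half-transformed summand, and absolute
summability permits the exchanges of order. -/
lemma tsum_prod_eq_of_tsum_eq {F₁ F₂ F₃ : ℤ → ℤ → ℂ} {c₁ c₂ : ℂ}
    (h₁ : Summable fun n : ℤ × ℤ => F₁ n.1 n.2) (h₂ : Summable fun n : ℤ × ℤ => F₂ n.1 n.2)
    (h₃ : Summable fun n : ℤ × ℤ => F₃ n.1 n.2)
    (e₁ : ∀ n, ∑' m, F₁ m n = c₁ * ∑' k, F₂ k n) (e₂ : ∀ k, ∑' n, F₂ k n = c₂ * ∑' l, F₃ k l) :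
    ∑' n : ℤ × ℤ, F₁ n.1 n.2 = c₁ * c₂ * ∑' n : ℤ × ℤ, F₃ n.1 n.2 := by
  rw [h₃.tsum_prod, h₁.tsum_prod]
  dsimp only
  rw [← Summable.tsum_comm (f := F₁) h₁]
  simp only [e₁]
  rw [tsum_mul_left, Summable.tsum_comm (f := F₂) h₂]
  simp only [e₂]
  rw [tsum_mul_left, mul_assoc]

/-- Poisson summation for `exp (-π (a u² + 2 b u v + c v²))`. -/
lemma tsum_exp_quadratic_two {a b c x y : ℂ} (ha : 0 < a.re) (hd : 0 < (c - b ^ 2 / a).re)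
    (h₁ : Summable fun n : ℤ × ℤ => Complex.exp (-Real.pi *
      (a * (n.1 + x) ^ 2 + 2 * b * (n.1 + x) * (n.2 + y) + c * (n.2 + y) ^ 2)))
    (h₂ : Summable fun n : ℤ × ℤ => Complex.exp (-Real.pi *
      (n.1 ^ 2 / a - 2 * Complex.I * n.1 * (x + b / a * (n.2 + y)) +
        (c - b ^ 2 / a) * (n.2 + y) ^ 2)))
    (h₃ : Summable fun n : ℤ × ℤ => Complex.exp (-Real.pi *
      ((c * n.1 ^ 2 - 2 * b * n.1 * n.2 + a * n.2 ^ 2) / (a * c - b ^ 2)) +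
        2 * Real.pi * Complex.I * (n.1 * x + n.2 * y))) :
    ∑' n : ℤ × ℤ, Complex.exp (-Real.pi *
      (a * (n.1 + x) ^ 2 + 2 * b * (n.1 + x) * (n.2 + y) + c * (n.2 + y) ^ 2)) =
    1 / (a ^ (1 / 2 : ℂ) * (c - b ^ 2 / a) ^ (1 / 2 : ℂ)) *
      ∑' n : ℤ × ℤ, Complex.exp (-Real.pi *
      ((c * n.1 ^ 2 - 2 * b * n.1 * n.2 + a * n.2 ^ 2) / (a * c - b ^ 2)) +
        2 * Real.pi * Complex.I * (n.1 * x + n.2 * y)) := by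
  have ha0 : a ≠ 0 := fun h => by simp [h] at ha
  set d := c - b ^ 2 / a with hd_def
  have hd0 : d ≠ 0 := fun h => by simp [h] at hd
  have had : a * c - b ^ 2 = a * d := by rw [hd_def]; field_simp
  have hc : c = d + b ^ 2 / a := by rw [hd_def]; ring
  rw [show (1 : ℂ) / (a ^ (1 / 2 : ℂ) * d ^ (1 / 2 : ℂ)) =
    1 / a ^ (1 / 2 : ℂ) * (1 / d ^ (1 / 2 : ℂ)) by rw [one_div_mul_one_div]]
  refine tsum_prod_eq_of_tsum_eq (F₁ := fun m n : ℤ => Complex.exp (-Real.pi *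
      (a * (m + x) ^ 2 + 2 * b * (m + x) * (n + y) + c * (n + y) ^ 2)))
    (F₂ := fun k n : ℤ => Complex.exp (-Real.pi *
      (k ^ 2 / a - 2 * Complex.I * k * (x + b / a * (n + y)) + d * (n + y) ^ 2)))
    (F₃ := fun k l : ℤ => Complex.exp (-Real.pi *
      ((c * k ^ 2 - 2 * b * k * l + a * l ^ 2) / (a * c - b ^ 2)) +
        2 * Real.pi * Complex.I * (k * x + l * y))) h₁ h₂ h₃ (fun n => ?_) fun k => ?_
  · calc _ = ∑' m : ℤ, Complex.exp (-Real.pi * c * (n + y) ^ 2) * Complex.exp (-Real.pi *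
          (a * (m + x) ^ 2 + 2 * (b * (n + y)) * (m + x))) :=
          tsum_congr fun n => by rw [← Complex.exp_add]; congr 1; ring
      _ = 1 / a ^ (1 / 2 : ℂ) * ∑' k : ℤ, Complex.exp (-Real.pi * c * (n + y) ^ 2) *
          Complex.exp (-Real.pi * k ^ 2 / a + 2 * Real.pi * Complex.I * k *
            (x + b * (n + y) / a) + Real.pi * (b * (n + y)) ^ 2 / a) := by
          rw [tsum_mul_left, tsum_exp_quadratic ha, mul_left_comm, ← tsum_mul_left]
      _ = _ := by
          congr 1
          refine tsum_congr fun k => ?_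
          rw [← Complex.exp_add, hc]; congr 1
          field_simp
          ring
  · calc _ = ∑' n : ℤ, Complex.exp (-Real.pi * (k ^ 2 / a) + 2 * Real.pi * Complex.I * k * x) *
          Complex.exp (-Real.pi * (d * (n + y) ^ 2 + 2 * (-(Complex.I * k * b / a)) * (n + y))) :=
          tsum_congr fun n => by rw [← Complex.exp_add]; congr 1; ring
      _ = 1 / d ^ (1 / 2 : ℂ) * ∑' l : ℤ,
          Complex.exp (-Real.pi * (k ^ 2 / a) + 2 * Real.pi * Complex.I * k * x) *
          Complex.exp (-Real.pi * l ^ 2 / d + 2 * Real.pi * Complex.I * l *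
            (y + -(Complex.I * k * b / a) / d) + Real.pi * (-(Complex.I * k * b / a)) ^ 2 / d) := by
          rw [tsum_mul_left, tsum_exp_quadratic hd, mul_left_comm, ← tsum_mul_left]
      _ = _ := by
          congr 1
          refine tsum_congr fun l => ?_
          rw [← Complex.exp_add, had, hc]; congr 1
          field_simp
          ring_nf
          simp only [Complex.I_sq]
          ring

/-- Both arguments lie in `(-π/2, π/2)`, so the principal logarithms add without a branch jump. -/
lemma cpow_half_mul_cpow_half {a d : ℂ} {r : ℝ} (ha : 0 < a.re) (hd : 0 < d.re)
    (hr : 0 ≤ r) (h : a * d = r) :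
    a ^ (1 / 2 : ℂ) * d ^ (1 / 2 : ℂ) = Real.sqrt r := by
  have h0 : a * d ≠ 0 := mul_ne_zero (fun h => by simp [h] at ha) (fun h => by simp [h] at hd)
  have h1 := Complex.abs_arg_lt_pi_div_two_iff.2 (Or.inl ha)
  have h2 := Complex.abs_arg_lt_pi_div_two_iff.2 (Or.inl hd)
  rw [abs_lt] at h1 h2
  have ha0 := left_ne_zero_of_mul h0
  have hd0 := right_ne_zero_of_mul h0
  rw [Complex.cpow_def_of_ne_zero ha0, Complex.cpow_def_of_ne_zero hd0, ← Complex.exp_add,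
    ← add_mul, ← Complex.log_mul ha0 hd0 ⟨by linarith, by linarith⟩,
    ← Complex.cpow_def_of_ne_zero h0, h, Real.sqrt_eq_rpow, Complex.ofReal_cpow hr]
  simp

/-! ### The theta kernel -/

/-- The summand `q^{Q(v)} exp (-π B(v, c(t))² τ₂)` of the Siegel theta function. -/
def kern (t : ℝ) (z : ℂ) (v : ℝ × ℝ) : ℂ :=
  Complex.exp (((2 * Real.pi * Q v * z.re : ℝ) : ℂ) * Complex.I -
    ((2 * Real.pi * maj t v * z.im : ℝ) : ℂ))

lemma norm_kern (t : ℝ) (z : ℂ) (v : ℝ × ℝ) :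
    ‖kern t z v‖ = Real.exp (-(2 * Real.pi * maj t v * z.im)) := by
  rw [kern, Complex.norm_exp]; simp

lemma qQ_mul_exp (t : ℝ) (τ : ℍ) (v : ℝ × ℝ) :
    qQ v τ * (Real.exp (-Real.pi * B v (cVec t) ^ 2 * τ.im) : ℝ) = kern t τ v := by
  rw [qQ, kern, Complex.ofReal_exp, ← Complex.exp_add, maj_eq]
  congr 1
  have e : (τ : ℂ) = τ.re + τ.im * Complex.I := (Complex.re_add_im _).symm
  simp only [coe_re, coe_im]
  rw [e]
  push_cast
  linear_combination 2 * Real.pi * Q v * τ.im * Complex.I_sq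

lemma kern_neg (t : ℝ) (z : ℂ) (v : ℝ × ℝ) : kern t z (-v) = kern t z v := by
  simp only [kern, Q_neg, maj_neg]

lemma continuous_kern (z : ℂ) (v : ℝ × ℝ) : Continuous fun t => kern t z v := by
  have := continuous_maj v
  unfold kern
  fun_prop

/-- A bound uniform in `t` and in `Im z ≥ y₀`. It serves the exchange of sum and integral, the
growth at infinity and the comparison of the Bessel series. -/
lemma exists_kern_bound (t₁ t₂ : ℝ) {y₀ : ℝ} (hy₀ : 0 < y₀) {p q : ℝ} (hp : p ≠ 0) (hq : q ≠ 0)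
    (x y : ℝ) : ∃ u : ℤ × ℤ → ℝ, Summable u ∧ ∀ n, ∀ t ∈ Set.Icc t₁ t₂, ∀ z : ℂ, y₀ ≤ z.im →
      ‖kern t z (pt (p * (n.1 + x)) (q * (n.2 + y)))‖ ≤ u n := by
  obtain ⟨κ, hκ, h⟩ := exists_le_maj t₁ t₂
  have hm : 0 < min (p ^ 2) (q ^ 2) := lt_min (by positivity) (by positivity)
  refine ⟨_, summable_exp_sq_add
    (show 0 < 2 * Real.pi * y₀ * κ * min (p ^ 2) (q ^ 2) by positivity) x y, fun n t ht z hz => ?_⟩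
  rw [norm_kern, Real.exp_le_exp, neg_mul, neg_le_neg_iff]
  have h1 := h t ht (p * (n.1 + x)) (q * (n.2 + y))
  have h2 : min (p ^ 2) (q ^ 2) * (((n.1 : ℝ) + x) ^ 2 + ((n.2 : ℝ) + y) ^ 2) ≤
      (p * (n.1 + x)) ^ 2 + (q * (n.2 + y)) ^ 2 := by
    rw [mul_add, mul_pow, mul_pow]
    gcongr
    · exact min_le_left _ _
    · exact min_le_right _ _
  calc _ = 2 * Real.pi * y₀ * (κ * (min (p ^ 2) (q ^ 2) *
        (((n.1 : ℝ) + x) ^ 2 + ((n.2 : ℝ) + y) ^ 2))) := by ring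
    _ ≤ 2 * Real.pi * z.im * maj t (pt (p * (n.1 + x)) (q * (n.2 + y))) :=
        mul_le_mul (by gcongr) ((mul_le_mul_of_nonneg_left h2 hκ.le).trans h1) (by positivity)
          (by have := hy₀.trans_le hz; positivity)
    _ = _ := by ring

lemma summable_norm_kern (t : ℝ) {z : ℂ} (hz : 0 < z.im) (p q x y : ℝ) (hp : p ≠ 0) (hq : q ≠ 0) :
    Summable fun n : ℤ × ℤ => ‖kern t z (pt (p * (n.1 + x)) (q * (n.2 + y)))‖ := by
  obtain ⟨u, hu, h⟩ := exists_kern_bound t t hz hp hq x y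
  exact Summable.of_nonneg_of_le (fun _ => norm_nonneg _)
    (fun n => h n t ⟨le_rfl, le_rfl⟩ z le_rfl) hu

lemma kern_pt (t x y : ℝ) (z : ℂ) : kern t z (pt x y) = Complex.exp (-Real.pi *
    (2 * (majCosh t * z.im - z.re * Complex.I) * x ^ 2 +
      2 * (2 * Real.sqrt 3 * majSinh t * z.im) * x * y +
      6 * (majCosh t * z.im + z.re * Complex.I) * y ^ 2)) := by
  rw [kern, Q_pt, maj_pt]
  congr 1
  push_cast
  ring

/-- The action of `τ ↦ -1/τ` on the Siegel theta function of a coset. -/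
lemma tsum_kern_inv (t : ℝ) (p q : ℤ) (τ : ℍ) :
    ∑' n : ℤ × ℤ, kern t τ (latPt p q n) =
      1 / (Real.sqrt 12 * ‖(τ : ℂ)‖ : ℝ) * ∑' n : ℤ × ℤ,
        Complex.exp (2 * Real.pi * Complex.I * (n.1 * p / 2 - n.2 * q / 6)) *
          kern t (-1 / (τ : ℂ)) (pt (n.1 / 2) (n.2 / 6)) := by
  set x := (τ : ℂ).re with hx
  set y := (τ : ℂ).im with hy
  have hy0 : 0 < y := τ.im_pos
  set C := majCosh t with hC
  set S := majSinh t with hS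
  have hC0 : 0 < C := majCosh_pos t
  have hCS : C ^ 2 = 1 + S ^ 2 := majCosh_sq t
  have hCS' : (C : ℂ) ^ 2 = 1 + (S : ℂ) ^ 2 := by exact_mod_cast hCS
  have h3' : (Real.sqrt 3 : ℂ) ^ 2 = 3 := by exact_mod_cast sqrt_three_sq
  set N := x ^ 2 + y ^ 2 with hN
  have hN0 : 0 < N := by positivity
  have hNc : (N : ℂ) ≠ 0 := by exact_mod_cast hN0.ne'
  have hnorm : ‖(τ : ℂ)‖ ^ 2 = N := by
    rw [Complex.sq_norm, Complex.normSq_apply]; ring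
  have hre : (-1 / (τ : ℂ)).re = -x / N := by
    rw [neg_div, one_div, Complex.neg_re, Complex.inv_re, Complex.normSq_apply, neg_div, hN]
    simp only [← hx, ← hy, pow_two]
  have him : (-1 / (τ : ℂ)).im = y / N := by
    rw [neg_div, one_div, Complex.neg_im, Complex.inv_im, Complex.normSq_apply, hN]
    simp only [← hx, ← hy, pow_two, neg_div, neg_neg]
  set a : ℂ := 2 * (C * y - x * Complex.I) with ha
  set b : ℂ := 2 * Real.sqrt 3 * S * y with hb
  set c : ℂ := 6 * (C * y + x * Complex.I) with hc
  have hare : a.re = 2 * (C * y) := by simp [ha]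
  have haim : a.im = -(2 * x) := by simp [ha]
  have ha_pos : 0 < a.re := by rw [hare]; positivity
  have ha0 : a ≠ 0 := fun h => by simp [h] at ha_pos
  -- The relation `C² = 1 + S²` removes `t` from the determinant, so the factor produced by Poisson
  -- summation does not depend on `t` and survives integration.
  have hdet : a * c - b ^ 2 = (12 * N : ℝ) := by
    rw [ha, hb, hc, hN]
    push_cast
    linear_combination 12 * (y : ℂ) ^ 2 * hCS' - 12 * (x : ℂ) ^ 2 * Complex.I_sq -
      4 * (S : ℂ) ^ 2 * y ^ 2 * h3'
  have hd : c - b ^ 2 / a = (12 * N : ℝ) * a⁻¹ := by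
    rw [← hdet]; field_simp
  have hM : 0 < Complex.normSq a := Complex.normSq_pos.2 ha0
  have hr : 0 < (a⁻¹).re := by
    rw [Complex.inv_re]; positivity
  have hd_re : (c - b ^ 2 / a).re = 12 * N * (a⁻¹).re := by rw [hd, Complex.re_ofReal_mul]
  have hd_pos : 0 < (c - b ^ 2 / a).re := by rw [hd_re]; positivity
  have e₁ : ∀ n : ℤ × ℤ, kern t τ (latPt p q n) = Complex.exp (-Real.pi *
      (a * (n.1 + (p / 2 : ℂ)) ^ 2 + 2 * b * (n.1 + (p / 2 : ℂ)) * (n.2 + (q / 6 : ℂ)) +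
        c * (n.2 + (q / 6 : ℂ)) ^ 2)) := by
    intro n
    rw [latPt, kern_pt]
    push_cast
    rfl
  -- The dual quadratic form is again the kernel, at `-1/τ` and on the dual lattice `½ℤ × ⅙ℤ`, but
  -- with the second frequency negated.
  have e₃ : ∀ n : ℤ × ℤ, Complex.exp (2 * Real.pi * Complex.I * (n.1 * p / 2 - (-n.2) * q / 6)) *
      kern t (-1 / (τ : ℂ)) (pt (n.1 / 2) (-n.2 / 6)) = Complex.exp (-Real.pi *
      ((c * n.1 ^ 2 - 2 * b * n.1 * n.2 + a * n.2 ^ 2) / (a * c - b ^ 2)) +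
        2 * Real.pi * Complex.I * (n.1 * (p / 2 : ℂ) + n.2 * (q / 6 : ℂ))) := by
    intro n
    rw [kern_pt, ← Complex.exp_add, hre, him, hdet]
    congr 1
    push_cast
    rw [ha, hb, hc]
    field_simp
    ring
  have h₁ : Summable fun n : ℤ × ℤ => Complex.exp (-Real.pi *
      (a * (n.1 + (p / 2 : ℂ)) ^ 2 + 2 * b * (n.1 + (p / 2 : ℂ)) * (n.2 + (q / 6 : ℂ)) +
        c * (n.2 + (q / 6 : ℂ)) ^ 2)) := by
    refine Summable.of_norm ?_
    refine (summable_norm_kern t hy0 1 1 (p / 2) (q / 6) one_ne_zero one_ne_zero).congr fun n => ?_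
    rw [← e₁, one_mul, one_mul, latPt]
  -- The norm of the half-transformed term is the exponential of `-π` times a real binary form in
  -- `n.1` and `n.2 + q/6`. That form is positive definite because `S² x² < C² (x² + y²)`.
  have h₂ : Summable fun n : ℤ × ℤ => Complex.exp (-Real.pi *
      (n.1 ^ 2 / a - 2 * Complex.I * n.1 * ((p / 2 : ℂ) + b / a * (n.2 + (q / 6 : ℂ))) +
        (c - b ^ 2 / a) * (n.2 + (q / 6 : ℂ)) ^ 2)) := by
    set r := (a⁻¹).re with hr_def
    set s := (a⁻¹).im with hs_def
    have hrv : r = 2 * (C * y) / Complex.normSq a := by rw [hr_def, Complex.inv_re, hare]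
    have hsv : s = 2 * x / Complex.normSq a := by rw [hs_def, Complex.inv_im, haim, neg_neg]
    have hdisc : (2 * Real.sqrt 3 * S * y * s) ^ 2 < r * (12 * N * r) := by
      have e1 : (2 * Real.sqrt 3 * S * y * s) ^ 2 =
          (S ^ 2 * x ^ 2) * (48 * y ^ 2 / Complex.normSq a ^ 2) := by
        rw [hsv]; field_simp
        rw [sqrt_three_sq]; ring
      have e2 : r * (12 * N * r) = (C ^ 2 * N) * (48 * y ^ 2 / Complex.normSq a ^ 2) := by
        rw [hrv]; field_simp; ring
      rw [e1, e2]
      refine mul_lt_mul_of_pos_right ?_ (by positivity)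
      rw [hCS, hN]
      have h1 : 0 < y ^ 2 := by positivity
      nlinarith [mul_nonneg (sq_nonneg S) h1.le, sq_nonneg x]
    obtain ⟨κ, hκ, hle⟩ := exists_quad_lower hr hdisc
    refine Summable.of_norm ?_
    refine Summable.of_nonneg_of_le (fun _ => norm_nonneg _) (fun n => ?_)
      (summable_exp_sq_add (show 0 < Real.pi * κ by positivity) 0 (q / 6))
    rw [Complex.norm_exp, Real.exp_le_exp]
    have e : (-Real.pi * (n.1 ^ 2 / a - 2 * Complex.I * n.1 * ((p / 2 : ℂ) +
        b / a * (n.2 + (q / 6 : ℂ))) + (c - b ^ 2 / a) * (n.2 + (q / 6 : ℂ)) ^ 2) : ℂ).re =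
        -Real.pi * (r * (n.1 : ℝ) ^ 2 + 2 * (2 * Real.sqrt 3 * S * y * s) * n.1 *
          ((n.2 : ℝ) + q / 6) + 12 * N * r * ((n.2 : ℝ) + q / 6) ^ 2) := by
      have ea : a⁻¹ = r + s * Complex.I := (Complex.re_add_im _).symm
      have e' : (-Real.pi * (n.1 ^ 2 / a - 2 * Complex.I * n.1 * ((p / 2 : ℂ) +
          b / a * (n.2 + (q / 6 : ℂ))) + (c - b ^ 2 / a) * (n.2 + (q / 6 : ℂ)) ^ 2) : ℂ) =
          ((-Real.pi * (r * (n.1 : ℝ) ^ 2 + 2 * (2 * Real.sqrt 3 * S * y * s) * n.1 *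
            ((n.2 : ℝ) + q / 6) + 12 * N * r * ((n.2 : ℝ) + q / 6) ^ 2) : ℝ) : ℂ) +
          ((-Real.pi * (s * (n.1 : ℝ) ^ 2 - 2 * n.1 * (p / 2) -
            2 * n.1 * (2 * Real.sqrt 3 * S * y * r) * ((n.2 : ℝ) + q / 6) +
            12 * N * s * ((n.2 : ℝ) + q / 6) ^ 2) : ℝ) : ℂ) * Complex.I := by
        rw [hd, div_eq_mul_inv _ a, div_eq_mul_inv _ a, ea, hb]
        push_cast
        linear_combination (Real.pi * 2 * n.1 * (2 * Real.sqrt 3 * S * y) * s *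
          (n.2 + (q / 6 : ℂ))) * Complex.I_sq
      rw [e', Complex.add_re, Complex.ofReal_re, Complex.re_ofReal_mul, Complex.I_re, mul_zero,
        add_zero]
    rw [e, neg_mul, neg_mul, neg_le_neg_iff, mul_assoc]
    have := hle n.1 ((n.2 : ℝ) + q / 6)
    rw [add_zero]
    exact mul_le_mul_of_nonneg_left this Real.pi_pos.le
  have h₃ : Summable fun n : ℤ × ℤ => Complex.exp (-Real.pi *
      ((c * n.1 ^ 2 - 2 * b * n.1 * n.2 + a * n.2 ^ 2) / (a * c - b ^ 2)) +
        2 * Real.pi * Complex.I * (n.1 * (p / 2 : ℂ) + n.2 * (q / 6 : ℂ))) := by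
    refine Summable.of_norm ?_
    have him0 : 0 < (-1 / (τ : ℂ)).im := by rw [him]; positivity
    refine (summable_norm_kern t him0 (1 / 2) (-1 / 6) 0 0 (by norm_num) (by norm_num)).congr
      fun n => ?_
    rw [← e₃, norm_mul]
    have : ‖Complex.exp (2 * Real.pi * Complex.I * (n.1 * p / 2 - (-n.2) * q / 6))‖ = 1 := by
      rw [Complex.norm_exp]; simp
    rw [this, one_mul, add_zero, add_zero]
    congr 3 <;> ring
  rw [tsum_congr e₁, tsum_exp_quadratic_two ha_pos hd_pos h₁ h₂ h₃,
    cpow_half_mul_cpow_half ha_pos hd_pos (by positivity : 0 ≤ 12 * N)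
      (by rw [hd, mul_left_comm, mul_inv_cancel₀ ha0, mul_one]), Real.sqrt_mul (by norm_num),
    ← hnorm, Real.sqrt_sq (norm_nonneg _)]
  congr 1
  -- Reflecting the second summation index undoes the sign in `e₃`.
  rw [← tsum_congr e₃, ← (Equiv.prodCongr (Equiv.refl ℤ) (Equiv.neg ℤ)).tsum_eq]
  refine tsum_congr fun n => ?_
  simp

end

noncomputable section

/-! ### The integrated Siegel theta functions of the cosets -/

/-- The integral over `[t₁, t₂]` of the Siegel theta function of the coset `(a/2, b/6)`. -/
def cosetForm (a b : ℤ) (τ : ℍ) : ℂ :=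
  (Real.sqrt τ.im : ℂ) * ∑' n : ℤ × ℤ, ∫ t in (param c₁)..(param c₂), kern t τ (latPt a b n)

/-- The weights `w` make room for the unimodular characters on the dual side of Poisson summation.
-/
lemma hasSum_integral_kern (t₁ t₂ : ℝ) {z : ℂ} (hz : 0 < z.im) {p q : ℝ} (hp : p ≠ 0)
    (hq : q ≠ 0) (x y : ℝ) {w : ℤ × ℤ → ℂ} (hw : ∀ n, ‖w n‖ ≤ 1) :
    HasSum (fun n : ℤ × ℤ => w n * ∫ t in t₁..t₂, kern t z (pt (p * (n.1 + x)) (q * (n.2 + y))))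
      (∫ t in t₁..t₂, ∑' n : ℤ × ℤ, w n * kern t z (pt (p * (n.1 + x)) (q * (n.2 + y)))) := by
  obtain ⟨u, hu, h⟩ := exists_kern_bound (min t₁ t₂) (max t₁ t₂) hz hp hq x y
  have hb : ∀ n, ∀ t ∈ Set.uIoc t₁ t₂,
      ‖w n * kern t z (pt (p * (n.1 + x)) (q * (n.2 + y)))‖ ≤ u n := by
    intro n t ht
    rw [norm_mul]
    calc _ ≤ 1 * ‖kern t z (pt (p * (n.1 + x)) (q * (n.2 + y)))‖ := by gcongr; exact hw n
      _ ≤ u n := by rw [one_mul]; exact h n t (Set.Ioc_subset_Icc_self ht) z le_rfl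
  have := intervalIntegral.hasSum_integral_of_dominated_convergence (μ := MeasureTheory.volume)
    (a := t₁) (b := t₂)
    (F := fun (n : ℤ × ℤ) t => w n * kern t z (pt (p * (n.1 + x)) (q * (n.2 + y))))
    (fun n _ => u n) (fun n => (continuous_const.mul (continuous_kern z _)).aestronglyMeasurable)
    (fun n => Filter.Eventually.of_forall (hb n)) (Filter.Eventually.of_forall fun _ _ => hu)
    intervalIntegrable_const
    (Filter.Eventually.of_forall fun t ht =>
      (Summable.of_norm_bounded hu fun n => hb n t ht).hasSum)
  simpa only [intervalIntegral.integral_const_mul] using this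

lemma latPt_eq (a b : ℤ) (n : ℤ × ℤ) :
    latPt a b n = pt (1 * (n.1 + ((a : ℝ) / 2))) (1 * (n.2 + ((b : ℝ) / 6))) := by
  rw [latPt, one_mul, one_mul]

lemma hasSum_integral_kern_latPt (a b : ℤ) {z : ℂ} (hz : 0 < z.im) (t₁ t₂ : ℝ) :
    HasSum (fun n : ℤ × ℤ => ∫ t in t₁..t₂, kern t z (latPt a b n))
      (∫ t in t₁..t₂, ∑' n : ℤ × ℤ, kern t z (latPt a b n)) := by
  have := hasSum_integral_kern t₁ t₂ hz one_ne_zero one_ne_zero ((a : ℝ) / 2) ((b : ℝ) / 6)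
    (w := fun _ => 1) (by simp)
  simpa only [one_mul, latPt] using this

lemma norm_integral_kern_le (t₁ t₂ : ℝ) (ht : t₁ ≤ t₂) {y₀ : ℝ} (hy₀ : 0 < y₀) (a b : ℤ) :
    ∃ u : ℤ × ℤ → ℝ, Summable u ∧ ∀ n, ∀ z : ℂ, y₀ ≤ z.im →
      ‖∫ t in t₁..t₂, kern t z (latPt a b n)‖ ≤ u n := by
  obtain ⟨u, hu, h⟩ := exists_kern_bound t₁ t₂ hy₀ one_ne_zero one_ne_zero ((a : ℝ) / 2)
    ((b : ℝ) / 6)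
  refine ⟨fun n => u n * |t₂ - t₁|, hu.mul_right _, fun n z hz => ?_⟩
  refine intervalIntegral.norm_integral_le_of_norm_le_const fun t h' => ?_
  rw [Set.uIoc_of_le ht] at h'
  have := h n t (Set.Ioc_subset_Icc_self h') z hz
  rwa [← latPt_eq] at this

lemma cosetForm_isBigO (a b : ℤ) :
    (fun τ : ℍ => cosetForm a b τ) =O[atImInfty] fun τ : ℍ => τ.im ^ 1 := by
  obtain ⟨u, hu, h⟩ := norm_integral_kern_le _ _ param_c₁_lt.le one_pos a b
  refine Asymptotics.IsBigO.of_bound (∑' n, u n) ?_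
  rw [atImInfty_basis.eventually_iff]
  refine ⟨1, trivial, fun τ (hτ : 1 ≤ τ.im) => ?_⟩
  have h0 : 0 ≤ ∑' n, u n := tsum_nonneg fun n => (norm_nonneg _).trans (h n τ hτ)
  have h1 : ‖∑' n : ℤ × ℤ, ∫ t in (param c₁)..(param c₂), kern t τ (latPt a b n)‖ ≤ ∑' n, u n :=
    tsum_of_norm_bounded hu.hasSum fun n => h n τ hτ
  have h2 : Real.sqrt τ.im ≤ τ.im := by
    rw [Real.sqrt_le_left τ.im_pos.le]; nlinarith
  rw [cosetForm, norm_mul, Complex.norm_real, Real.norm_of_nonneg (Real.sqrt_nonneg _), pow_one,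
    Real.norm_of_nonneg τ.im_pos.le, mul_comm]
  exact mul_le_mul h1 h2 (Real.sqrt_nonneg _) h0

lemma latPt_add (a b k l : ℤ) (n : ℤ × ℤ) :
    latPt (a + 2 * k) (b + 6 * l) n = latPt a b ((Equiv.addRight (k, l)) n) := by
  simp only [latPt, Equiv.coe_addRight, Prod.fst_add, Prod.snd_add]
  congr 1 <;> push_cast <;> ring

lemma cosetForm_add (a b k l : ℤ) : cosetForm (a + 2 * k) (b + 6 * l) = cosetForm a b := by
  funext τ
  simp only [cosetForm, latPt_add]
  congr 1
  exact (Equiv.addRight ((k, l) : ℤ × ℤ)).tsum_eq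
    fun n => ∫ t in (param c₁)..(param c₂), kern t τ (latPt a b n)

lemma latPt_neg (a b : ℤ) (n : ℤ × ℤ) : latPt (-a) (-b) n = -latPt a b (Equiv.neg _ n) := by
  rw [latPt, latPt, ← pt_neg]
  congr 1 <;> simp <;> ring

lemma cosetForm_neg (a b : ℤ) : cosetForm (-a) (-b) = cosetForm a b := by
  funext τ
  simp only [cosetForm, latPt_neg, kern_neg]
  congr 1
  exact (Equiv.neg (ℤ × ℤ)).tsum_eq
    fun n => ∫ t in (param c₁)..(param c₂), kern t τ (latPt a b n)

/-! ### Translations -/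

lemma Q_latPt (a b : ℤ) (n : ℤ × ℤ) : Q (latPt a b n) =
    ((n.1 ^ 2 + n.1 * a - 3 * n.2 ^ 2 - n.2 * b : ℤ) : ℝ) + (3 * a ^ 2 - b ^ 2) / 12 := by
  rw [latPt, Q_pt]; push_cast; ring

lemma ζ_twelve_zpow (k : ℤ) : ζ 12 ^ k = Complex.exp (2 * Real.pi * Complex.I * (k / 12)) := by
  rw [ζ, ← Complex.exp_int_mul]
  congr 1
  push_cast
  ring

lemma ζ_twelve_zpow_mul (k : ℤ) : ζ 12 ^ (12 * k) = 1 := by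
  rw [ζ_twelve_zpow, ← Complex.exp_int_mul_two_pi_mul_I k]
  congr 1
  push_cast
  ring

lemma ζ_twelve_ne_zero : ζ 12 ≠ 0 := Complex.exp_ne_zero _

/-- On the coset, `Q` takes values in `ℤ + (3a² - b²)/12`, while the majorant meets only `Im τ`. -/
lemma kern_vadd (t : ℝ) (a b m : ℤ) (τ : ℍ) (n : ℤ × ℤ) :
    kern t ((m : ℝ) +ᵥ τ : ℍ) (latPt a b n) =
      ζ 12 ^ (m * (3 * a ^ 2 - b ^ 2)) * kern t τ (latPt a b n) := by
  have h : Complex.exp (((m * (n.1 ^ 2 + n.1 * a - 3 * n.2 ^ 2 - n.2 * b) : ℤ) : ℂ) *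
      (2 * Real.pi * Complex.I)) = 1 := Complex.exp_int_mul_two_pi_mul_I _
  rw [ζ_twelve_zpow, ← one_mul (_ * _), ← h, kern, kern, ← Complex.exp_add, ← Complex.exp_add]
  congr 1
  rw [coe_re, coe_im, vadd_re, vadd_im, Q_latPt]
  push_cast
  rw [coe_re, coe_im]
  ring

lemma cosetForm_T_zpow (a b m : ℤ) (τ : ℍ) : cosetForm a b (ModularGroup.T ^ m • τ) =
    ζ 12 ^ (m * (3 * a ^ 2 - b ^ 2)) * cosetForm a b τ := by
  rw [modular_T_zpow_smul]
  simp only [cosetForm, kern_vadd, intervalIntegral.integral_const_mul, tsum_mul_left, vadd_im]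
  ring

/-! ### Inversion -/

/-- Splits a sum over the dual lattice `½ℤ × ⅙ℤ`, indexed by `ℤ²`, into the twelve cosets of the
lattice. -/
lemma tsum_eq_sum_residues {F : ℤ × ℤ → ℂ} (h : Summable F) :
    ∑' m, F m = ∑ r : Fin 2, ∑ s : Fin 6, ∑' n : ℤ × ℤ, F (n.1 * 2 + (r : ℕ), n.2 * 6 + (s : ℕ)) := by
  let e : (Fin 2 × Fin 6) × (ℤ × ℤ) ≃ ℤ × ℤ := (Equiv.prodComm _ _).trans
    ((Equiv.prodProdProdComm _ _ _ _).trans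
      (Equiv.prodCongr (Int.divModEquiv 2).symm (Int.divModEquiv 6).symm))
  have h' : Summable fun x => F (e x) := e.summable_iff.2 h
  rw [← e.tsum_eq, h'.tsum_prod, tsum_fintype, Fintype.sum_prod_type]
  rfl

lemma coe_S_smul (τ : ℍ) : ((ModularGroup.S • τ : ℍ) : ℂ) = -1 / (τ : ℂ) := by
  rw [modular_S_smul]
  simp [inv_neg, neg_div]

lemma im_S_smul (τ : ℍ) : (ModularGroup.S • τ : ℍ).im = τ.im / ‖(τ : ℂ)‖ ^ 2 := by
  rw [← coe_im, coe_S_smul, neg_div, one_div, Complex.neg_im, Complex.inv_im, Complex.sq_norm,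
    neg_div, neg_neg, coe_im]

lemma S_smul_S_smul (τ : ℍ) : ModularGroup.S • ModularGroup.S • τ = τ := by
  apply UpperHalfPlane.ext
  rw [coe_S_smul, coe_S_smul]
  have := τ.ne_zero
  field_simp

lemma exp_character (p q r s : ℤ) (n : ℤ × ℤ) :
    Complex.exp (2 * Real.pi * Complex.I *
      (((n.1 * 2 + r : ℤ) : ℂ) * p / 2 - ((n.2 * 6 + s : ℤ) : ℂ) * q / 6)) =
      ζ 12 ^ (6 * r * p - 2 * s * q) := by
  have h := Complex.exp_int_mul_two_pi_mul_I (n.1 * p - n.2 * q)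
  rw [ζ_twelve_zpow, ← one_mul (Complex.exp (2 * Real.pi * Complex.I * (_ / 12))), ← h,
    ← Complex.exp_add]
  congr 1
  push_cast
  ring

lemma pt_residue (r s : ℤ) (n : ℤ × ℤ) :
    pt (((n.1 * 2 + r : ℤ) : ℝ) / 2) (((n.2 * 6 + s : ℤ) : ℝ) / 6) = latPt r s n := by
  rw [latPt]; congr 1 <;> push_cast <;> ring

lemma norm_exp_character (p q : ℤ) (n : ℤ × ℤ) :
    ‖Complex.exp (2 * Real.pi * Complex.I * (n.1 * p / 2 - n.2 * q / 6))‖ = 1 := by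
  rw [Complex.norm_exp]; simp

/-- The Weil representation: `12` is the order of the discriminant group, and `6rp - 2sq` is `12`
times the bilinear pairing of `(r/2, s/6)` with `(p/2, q/6)`. -/
lemma cosetForm_S_smul (p q : ℤ) (τ : ℍ) : cosetForm p q (ModularGroup.S • τ) =
    1 / (Real.sqrt 12 : ℂ) * ∑ r : Fin 2, ∑ s : Fin 6,
      ζ 12 ^ (6 * ((r : ℕ) : ℤ) * p - 2 * ((s : ℕ) : ℤ) * q) *
        cosetForm ((r : ℕ) : ℤ) ((s : ℕ) : ℤ) τ := by
  set σ := ModularGroup.S • τ with hσ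
  have hτ : τ = ModularGroup.S • σ := by rw [hσ, S_smul_S_smul]
  have hz : 0 < (-1 / (σ : ℂ)).im := by rw [← coe_S_smul]; exact (ModularGroup.S • σ).im_pos
  have hchar := norm_exp_character p q
  have hsum := hasSum_integral_kern (param c₁) (param c₂) hz (p := 1 / 2) (q := 1 / 6)
    (by norm_num) (by norm_num) 0 0 (fun n => (hchar n).le)
  have epos : ∀ n : ℤ × ℤ, pt (1 / 2 * (n.1 + 0)) (1 / 6 * (n.2 + 0)) = pt (n.1 / 2) (n.2 / 6) := by
    intro n; congr 1 <;> ring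
  simp only [epos] at hsum
  have hσ0 : (‖(σ : ℂ)‖ : ℂ) ≠ 0 := by
    have := σ.ne_zero
    exact_mod_cast norm_ne_zero_iff.2 this
  have him : (Real.sqrt τ.im : ℂ) = Real.sqrt σ.im / ‖(σ : ℂ)‖ := by
    rw [hτ, im_S_smul, Real.sqrt_div σ.im_pos.le, Real.sqrt_sq (norm_nonneg _)]
    push_cast; rfl
  have h1 : cosetForm p q σ = (Real.sqrt σ.im : ℂ) * (1 / (Real.sqrt 12 * ‖(σ : ℂ)‖ : ℝ)) *
      ∑' n : ℤ × ℤ, Complex.exp (2 * Real.pi * Complex.I * (n.1 * p / 2 - n.2 * q / 6)) *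
        ∫ t in (param c₁)..(param c₂), kern t (-1 / (σ : ℂ)) (pt (n.1 / 2) (n.2 / 6)) := by
    rw [cosetForm, (hasSum_integral_kern_latPt p q σ.im_pos _ _).tsum_eq, hsum.tsum_eq, mul_assoc]
    congr 1
    rw [← intervalIntegral.integral_const_mul]
    congr 1
    funext t
    exact tsum_kern_inv t p q σ
  rw [h1, tsum_eq_sum_residues hsum.summable]
  have e : (Real.sqrt σ.im : ℂ) * (1 / (Real.sqrt 12 * ‖(σ : ℂ)‖ : ℝ)) =
      1 / (Real.sqrt 12 : ℂ) * Real.sqrt τ.im := by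
    rw [him]; push_cast; field_simp
  rw [e, mul_assoc, Finset.mul_sum]
  congr 1
  refine Finset.sum_congr rfl fun r _ => ?_
  rw [Finset.mul_sum]
  refine Finset.sum_congr rfl fun s _ => ?_
  rw [cosetForm, mul_left_comm, ← tsum_mul_left (a := ζ 12 ^ _)]
  congr 1
  refine tsum_congr fun n => ?_
  have e1 := exp_character p q ((r : ℕ) : ℤ) ((s : ℕ) : ℤ) n
  have e2 := pt_residue ((r : ℕ) : ℤ) ((s : ℕ) : ℤ) n
  rw [e1, e2, ← coe_S_smul, ← hτ]

end

noncomputable section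

/-! ### The vector `Ĝ` and its transformation laws -/

lemma thetaHatTerm_eq (μ : ℝ × ℝ) (τ : ℍ) (n : ℤ × ℤ) :
    thetaHatTerm μ τ n = ∫ t in (param c₁)..(param c₂), kern t τ (shift μ n) := by
  rw [thetaHatTerm, ← intervalIntegral.integral_ofReal, ← intervalIntegral.integral_const_mul]
  simp only [qQ_mul_exp]

/-- The components of the vector-valued form, as integrated Siegel theta functions. -/
def thetaVec (τ : ℍ) (j : Fin 4) : ℂ := cosetForm (j : ℕ) (j : ℕ) τ

lemma summable_thetaHat_coset (j : Fin 4) (τ : ℍ) : Summable fun n : ℤ × ℤ =>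
    ∫ t in (param c₁)..(param c₂), kern t τ (latPt (j : ℕ) (j : ℕ) n) :=
  (hasSum_integral_kern_latPt _ _ τ.im_pos _ _).summable

lemma GHat_eq (j : Fin 4) (τ : ℍ) : GHat j τ = thetaVec τ j := by
  have h := tsum_shift_add (F := fun v => ∫ t in (param c₁)..(param c₂), kern t τ v)
    (summable_thetaHat_coset j τ)
  rw [GHat, thetaHat, thetaHat, ← mul_add, thetaVec, cosetForm, ← h]
  simp only [thetaHatTerm_eq]

/-! ### Twelfth roots of unity and Gauss sums -/

lemma ζ_twelve_eq : ζ 12 = Real.sqrt 3 / 2 + Complex.I / 2 := by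
  have h : ζ 12 = Complex.exp ((Real.pi / 6 : ℝ) * Complex.I) := by
    rw [ζ]; congr 1; push_cast; ring
  rw [h, Complex.exp_mul_I, ← Complex.ofReal_cos, ← Complex.ofReal_sin, Real.cos_pi_div_six,
    Real.sin_pi_div_six]
  push_cast
  ring

/-- The minimal polynomial of `ζ 12`. Together with `sqrt_three_eq` it reduces the evaluation of the
Gauss sums to polynomial identities. -/
lemma ζ_twelve_pow_four : ζ 12 ^ 4 = ζ 12 ^ 2 - 1 := by
  have h3 : (Real.sqrt 3 : ℂ) ^ 2 = 3 := by exact_mod_cast sqrt_three_sq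
  have h2 : ζ 12 ^ 2 = 1 / 2 + Real.sqrt 3 / 2 * Complex.I := by
    rw [ζ_twelve_eq]; linear_combination 1 / 4 * h3 + 1 / 4 * Complex.I_sq
  rw [show 4 = 2 * 2 from rfl, pow_mul, h2]
  linear_combination 1 / 4 * Complex.I ^ 2 * h3 + 3 / 4 * Complex.I_sq

lemma ζ_twelve_pow_six : ζ 12 ^ 6 = -1 := by
  linear_combination (ζ 12 ^ 2 + 1) * ζ_twelve_pow_four

lemma sqrt_three_eq : (Real.sqrt 3 : ℂ) = 2 * ζ 12 - ζ 12 ^ 3 := by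
  have h3 : (Real.sqrt 3 : ℂ) ^ 2 = 3 := by exact_mod_cast sqrt_three_sq
  rw [ζ_twelve_eq]
  linear_combination (Real.sqrt 3 / 8 + 3 * Complex.I / 8) * h3 +
    (3 * Real.sqrt 3 / 8 + Complex.I / 8) * Complex.I_sq

lemma ζ_twelve_zpow_eq (m : ℤ) : ζ 12 ^ m = ζ 12 ^ (m % 12).toNat := by
  have h : m = 12 * (m / 12) + ((m % 12).toNat : ℤ) := by lia
  conv_lhs => rw [h, zpow_add₀ ζ_twelve_ne_zero, ζ_twelve_zpow_mul, one_mul, zpow_natCast]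

lemma ζ_four : ζ 4 = ζ 12 ^ 3 := by
  rw [ζ, ζ, ← Complex.exp_nat_mul]; congr 1; push_cast; ring

lemma ζ_three : ζ 3 = ζ 12 ^ 4 := by
  rw [ζ, ζ, ← Complex.exp_nat_mul]; congr 1; push_cast; ring

lemma ζ_six : ζ 6 = ζ 12 ^ 2 := by
  rw [ζ, ζ, ← Complex.exp_nat_mul]; congr 1; push_cast; ring

/-- The quadratic Gauss sum modulo `6` in the transformation of `τ ↦ τ / (2τ + 1)`. -/
def gaussSix (k : ℤ) : ℂ := ∑ s : Fin 6, ζ 12 ^ (2 * ((s : ℕ) : ℤ) ^ 2 - 2 * ((s : ℕ) : ℤ) * k)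

def gaussTwo (k : ℤ) : ℂ := ∑ r : Fin 2, ζ 12 ^ (6 * ((r : ℕ) : ℤ) * k - 6 * ((r : ℕ) : ℤ) ^ 2)

lemma gaussTwo_even (k : ℤ) : gaussTwo (2 * k) = 0 := by
  have h : (6 * (2 * k) - 6 : ℤ) = 12 * (k - 1) + 6 := by ring
  simp only [gaussTwo, Fin.sum_univ_two]
  simp [h, zpow_add₀ ζ_twelve_ne_zero, ζ_twelve_zpow_mul]
  have := ζ_twelve_pow_six
  norm_cast
  rw [this]; ring

lemma gaussTwo_odd (k : ℤ) : gaussTwo (2 * k + 1) = 2 := by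
  have h : (6 * (2 * k + 1) - 6 : ℤ) = 12 * k := by ring
  simp only [gaussTwo, Fin.sum_univ_two]
  simp [h, ζ_twelve_zpow_mul]
  norm_num

/-- Replacing `s` by `s + 3` multiplies each summand by `-(-1)^k`, which explains the vanishing for
even `k`. The sum has period `6` in `k`, so the values are checked residue by residue. -/
lemma gaussSix_eq (k : ℤ) : gaussSix k =
    if k % 2 = 0 then 0 else if k % 6 = 3 then -2 * Real.sqrt 3 * ζ 12 ^ 3
      else 2 * Real.sqrt 3 * ζ 12 := by
  have hper : gaussSix k = gaussSix (k % 6) := by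
    rw [gaussSix, gaussSix]
    refine Finset.sum_congr rfl fun s _ => ?_
    have : 2 * ((s : ℕ) : ℤ) ^ 2 - 2 * ((s : ℕ) : ℤ) * k =
        12 * (-((s : ℕ) : ℤ) * (k / 6)) +
          (2 * ((s : ℕ) : ℤ) ^ 2 - 2 * ((s : ℕ) : ℤ) * (k % 6)) := by
      have := Int.emod_add_mul_ediv k 6
      linear_combination (2 * ((s : ℕ) : ℤ)) * this
    rw [this, zpow_add₀ ζ_twelve_ne_zero, ζ_twelve_zpow_mul, one_mul]
  have h4 := ζ_twelve_pow_four
  have h6 := ζ_twelve_pow_six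
  have h8 : ζ 12 ^ 8 = -ζ 12 ^ 2 := by linear_combination ζ 12 ^ 2 * h6
  have h10 : ζ 12 ^ 10 = 1 - ζ 12 ^ 2 := by linear_combination ζ 12 ^ 4 * h6 - h4
  have h2 : k % 2 = (k % 6) % 2 := by lia
  rw [hper, h2, sqrt_three_eq]
  have h0 : 0 ≤ k % 6 := by lia
  have h5 : k % 6 < 6 := by lia
  generalize k % 6 = m at h0 h5
  interval_cases m <;>
    simp [gaussSix, Fin.sum_univ_six, ζ_twelve_zpow_eq, h8, h10, h4, h6] <;>
    first
      | linear_combination 0 * h4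
      | linear_combination 2 * h4
      | linear_combination -2 * h4 + 2 * h6
      | linear_combination 4 * h4 - 2 * h6

/-- As matrices, `S T⁻² S = -R`, and `-1` acts trivially. -/
lemma matR_smul (τ : ℍ) :
    matR • τ = ModularGroup.S • ModularGroup.T ^ (-2 : ℤ) • ModularGroup.S • τ := by
  apply UpperHalfPlane.ext
  rw [coe_S_smul, modular_T_zpow_smul, coe_vadd, coe_S_smul, specialLinearGroup_apply]
  have h0 := τ.ne_zero
  have h1 : (2 : ℂ) * τ + 1 ≠ 0 := fun h => by
    have := congrArg Complex.im h
    simp at this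
    exact τ.im_pos.ne' this
  have h2 : ((-2 : ℤ) : ℝ) + -1 / (τ : ℂ) = -(2 * τ + 1) / τ := by
    push_cast; field_simp; ring
  rw [h2, neg_div (τ : ℂ) (2 * τ + 1), neg_div_neg_eq, one_div_div]
  simp [matR]

/-- The discriminant group splits as `ℤ/2 × ℤ/6` and so do the characters, so the inner Gauss sum of
the composite is a product of two. -/
lemma sum_mul_sum_swap {c : ℂ} {A : Fin 2 → Fin 6 → ℂ} {B : Fin 2 → Fin 6 → Fin 2 → Fin 6 → ℂ}
    {a : Fin 2 → Fin 2 → ℂ} {b : Fin 6 → Fin 6 → ℂ} {F : Fin 2 → Fin 6 → ℂ}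
    (h : ∀ r s r' s', A r s * B r s r' s' = a r r' * b s s') :
    c * ∑ r, ∑ s, A r s * (c * ∑ r', ∑ s', B r s r' s' * F r' s') =
      c ^ 2 * ∑ r', ∑ s', (∑ r, a r r') * (∑ s, b s s') * F r' s' := by
  have e1 : ∀ r s, A r s * (c * ∑ r', ∑ s', B r s r' s' * F r' s') =
      c * ∑ x : Fin 2 × Fin 6, a r x.1 * b s x.2 * F x.1 x.2 := by
    intro r s
    rw [Fintype.sum_prod_type, mul_left_comm, Finset.mul_sum]
    congr 1
    refine Finset.sum_congr rfl fun r' _ => ?_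
    rw [Finset.mul_sum]
    refine Finset.sum_congr rfl fun s' _ => ?_
    rw [← h]; ring
  simp only [e1, ← Finset.mul_sum]
  rw [← mul_assoc, ← pow_two]
  congr 1
  rw [← Fintype.sum_prod_type' (f := fun r s => ∑ x : Fin 2 × Fin 6, a r x.1 * b s x.2 * F x.1 x.2),
    Finset.sum_comm, Fintype.sum_prod_type]
  refine Finset.sum_congr rfl fun r' _ => Finset.sum_congr rfl fun s' _ => ?_
  rw [Fintype.sum_prod_type, Finset.sum_mul_sum, Finset.sum_mul]
  exact Finset.sum_congr rfl fun r _ => by rw [Finset.sum_mul]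

lemma cosetForm_R_smul (p q : ℤ) (τ : ℍ) : cosetForm p q (matR • τ) =
    1 / 12 * ∑ r : Fin 2, ∑ s : Fin 6, gaussTwo (p + ((r : ℕ) : ℤ)) * gaussSix (q + ((s : ℕ) : ℤ)) *
      cosetForm ((r : ℕ) : ℤ) ((s : ℕ) : ℤ) τ := by
  have h12 : (1 / (Real.sqrt 12 : ℂ)) ^ 2 = 1 / 12 := by
    rw [div_pow, one_pow]
    congr 1
    exact_mod_cast Real.sq_sqrt (show (0 : ℝ) ≤ 12 by norm_num)
  rw [matR_smul, cosetForm_S_smul]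
  simp only [cosetForm_T_zpow, cosetForm_S_smul]
  have hmul : ∀ (k l : ℤ) (X : ℂ), ζ 12 ^ k * (ζ 12 ^ l * X) = ζ 12 ^ (k + l) * X := by
    intro k l X
    rw [zpow_add₀ ζ_twelve_ne_zero, mul_assoc]
  simp only [hmul]
  rw [sum_mul_sum_swap
    (a := fun r r' => ζ 12 ^ (6 * ((r : ℕ) : ℤ) * (p + ((r' : ℕ) : ℤ)) - 6 * ((r : ℕ) : ℤ) ^ 2))
    (b := fun s s' => ζ 12 ^ (2 * ((s : ℕ) : ℤ) ^ 2 - 2 * ((s : ℕ) : ℤ) * (q + ((s' : ℕ) : ℤ)))),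
    h12]
  · rfl
  · intro r s r' s'
    rw [← zpow_add₀ ζ_twelve_ne_zero, ← zpow_add₀ ζ_twelve_ne_zero]
    congr 1; ring

/-- Both Gauss sums need an odd argument, so only the three cosets `(r, s)` with `r` and `s` of
parity opposite to `j` occur. Of these, `v ↦ -v` identifies two, `(1, 5)` with `(1, 1)` or `(0, 4)`
with `(0, 2)`. Adding their coefficients yields the entries `2 ζ₁₂` and, through `ζ₁₂ - ζ₁₂³`, the
entries `ζ₁₂¹¹`. -/
lemma thetaVec_R_smul (τ : ℍ) : thetaVec (matR • τ) = PhiR.mulVec (thetaVec τ) := by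
  have f15 : cosetForm 1 5 τ = cosetForm 1 1 τ := by
    have h := congrFun (cosetForm_add (-1) (-1) 1 1) τ
    have h' := congrFun (cosetForm_neg 1 1) τ
    norm_num at h h'
    rw [h, h']
  have f04 : cosetForm 0 4 τ = cosetForm 0 2 τ := by
    have h := congrFun (cosetForm_add 0 (-2) 0 1) τ
    have h' := congrFun (cosetForm_neg 0 2) τ
    norm_num at h h'
    rw [h, h']
  have f22 : cosetForm 2 2 τ = cosetForm 0 2 τ := by
    have h := congrFun (cosetForm_add 0 2 1 0) τ
    norm_num at h
    exact h
  have f33 : cosetForm 3 3 τ = cosetForm 1 3 τ := by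
    have h := congrFun (cosetForm_add 1 3 1 0) τ
    norm_num at h
    exact h
  have g0 : gaussTwo 0 = 0 := gaussTwo_even 0
  have g1 : gaussTwo 1 = 2 := gaussTwo_odd 0
  have g2 : gaussTwo 2 = 0 := gaussTwo_even 1
  have g3 : gaussTwo 3 = 2 := gaussTwo_odd 1
  have g4 : gaussTwo 4 = 0 := gaussTwo_even 2
  have h3 : (Real.sqrt 3 : ℂ) ^ 2 = 3 := by exact_mod_cast sqrt_three_sq
  have h0 : (Real.sqrt 3 : ℂ) ≠ 0 := fun h => by simp [h] at h3
  have hinv : (1 / (Real.sqrt 3 : ℂ)) = Real.sqrt 3 / 3 := by field_simp; rw [h3]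
  have h9 : ζ 12 ^ 9 = -ζ 12 ^ 3 := by linear_combination ζ 12 ^ 3 * ζ_twelve_pow_six
  have h11 : ζ 12 ^ 11 = ζ 12 - ζ 12 ^ 3 := by
    linear_combination ζ 12 ^ 5 * ζ_twelve_pow_six - ζ 12 * ζ_twelve_pow_four
  have h9' : ζ 4 ^ 3 = -ζ 12 ^ 3 := by rw [ζ_four, ← h9]; ring
  funext j
  rw [PhiR, hinv, Matrix.smul_mulVec, Pi.smul_apply, thetaVec, cosetForm_R_smul]
  simp only [Fin.sum_univ_two, Fin.sum_univ_six, gaussSix_eq]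
  fin_cases j <;>
    simp [g0, g1, g2, g3, g4, f15, f04, f22, f33, h9', h11, thetaVec, Matrix.mulVec, dotProduct,
      Fin.sum_univ_four] <;>
    ring

end

noncomputable section

lemma thetaVec_T_zpow_smul (m : ℤ) (τ : ℍ) (j : Fin 4) :
    thetaVec (ModularGroup.T ^ m • τ) j = (ζ 12 ^ (2 * (j : ℕ) ^ 2)) ^ m * thetaVec τ j := by
  rw [thetaVec, cosetForm_T_zpow, thetaVec, ← zpow_natCast, ← zpow_mul]
  congr 2
  push_cast
  ring

/-! ### Linear independence -/

lemma kern_I (t : ℝ) (v : ℝ × ℝ) :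
    kern t UpperHalfPlane.I v = (Real.exp (-(2 * Real.pi * maj t v)) : ℝ) := by
  rw [kern]; simp

/-- At `τ = i` the kernel is a positive real number, so nothing can cancel. -/
lemma cosetForm_I_ne_zero (a b : ℤ) : cosetForm a b UpperHalfPlane.I ≠ 0 := by
  have hs := (hasSum_integral_kern_latPt a b UpperHalfPlane.I.im_pos (param c₁) (param c₂)).summable
  simp only [kern_I, intervalIntegral.integral_ofReal] at hs
  have hs' := Complex.summable_ofReal.1 hs
  have hpos : ∀ n : ℤ × ℤ, 0 < ∫ t in (param c₁)..(param c₂),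
      Real.exp (-(2 * Real.pi * maj t (latPt a b n))) := fun n => by
    refine intervalIntegral.intervalIntegral_pos_of_pos ?_ (fun t => Real.exp_pos _) param_c₁_lt
    have := continuous_maj (latPt a b n)
    exact Continuous.intervalIntegrable (by fun_prop) _ _
  have h := hs'.tsum_pos (fun n => (hpos n).le) (0, 0) (hpos _)
  rw [cosetForm]
  simp only [kern_I, intervalIntegral.integral_ofReal, ← Complex.ofReal_tsum]
  refine mul_ne_zero ?_ (by exact_mod_cast h.ne')
  simp

/-- The `T`-eigenvalues `ζ₁₂^(2k²)` have exponents `0, 2, 8, 18 ≡ 6` modulo `12` and are distinct.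
Evaluating a linear relation at the translates of `i` by `0, …, 3` gives an invertible Vandermonde
system. -/
lemma eq_zero_of_forall_dotProduct_thetaVec {w : Fin 4 → ℂ}
    (h : ∀ τ, ∑ k, w k * thetaVec τ k = 0) : w = 0 := by
  have hinj : Function.Injective fun k : Fin 4 => ζ 12 ^ (2 * (k : ℕ) ^ 2) := by
    have hp : IsPrimitiveRoot (ζ 12) 12 := by
      have := Complex.isPrimitiveRoot_exp 12 (by norm_num)
      exact this
    have h6 := ζ_twelve_pow_six
    have key : ∀ k l : ℕ, k < 12 → l < 12 → ζ 12 ^ k = ζ 12 ^ l → k = l :=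
      fun k l hk hl => hp.pow_inj hk hl
    have h18 : ζ 12 ^ 18 = ζ 12 ^ 6 := by linear_combination (ζ 12 ^ 12 - ζ 12 ^ 6) * h6 +
      (ζ 12 ^ 6 - 1) * h6 - (ζ 12 ^ 6 - 1) * h6
    intro k l hkl
    fin_cases k <;> fin_cases l <;> simp [h18] at hkl ⊢ <;>
      first
        | exact absurd (key 0 2 (by norm_num) (by norm_num) (by simpa using hkl)) (by norm_num)
        | exact absurd (key 2 0 (by norm_num) (by norm_num) (by simpa using hkl)) (by norm_num)
        | exact absurd (key 0 8 (by norm_num) (by norm_num) (by simpa using hkl)) (by norm_num)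
        | exact absurd (key 8 0 (by norm_num) (by norm_num) (by simpa using hkl)) (by norm_num)
        | exact absurd (key 0 6 (by norm_num) (by norm_num) (by simpa using hkl)) (by norm_num)
        | exact absurd (key 6 0 (by norm_num) (by norm_num) (by simpa using hkl)) (by norm_num)
        | exact absurd (key _ _ (by norm_num) (by norm_num) hkl) (by norm_num)
  have hv := Matrix.eq_zero_of_forall_pow_sum_mul_pow_eq_zero
    (v := fun k => w k * thetaVec UpperHalfPlane.I k) hinj fun i => by
      rw [← h (ModularGroup.T ^ ((i : ℕ) : ℤ) • UpperHalfPlane.I)]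
      refine Finset.sum_congr rfl fun k _ => ?_
      rw [thetaVec_T_zpow_smul, zpow_natCast]
      ring
  funext k
  exact (mul_eq_zero.1 (congrFun hv k)).resolve_right (cosetForm_I_ne_zero _ _)

lemma matrix_eq_of_mulVec_thetaVec {A A' : Matrix (Fin 4) (Fin 4) ℂ}
    (h : ∀ τ, A.mulVec (thetaVec τ) = A'.mulVec (thetaVec τ)) : A = A' := by
  ext j k
  have := eq_zero_of_forall_dotProduct_thetaVec (w := fun k => A j k - A' j k) fun τ => by
    have := congrFun (h τ) j
    simp only [Matrix.mulVec, dotProduct] at this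
    simp only [sub_mul, Finset.sum_sub_distrib, this, sub_self]
  exact sub_eq_zero.1 (congrFun this k)

/-! ### The group generated by `T`, `R` and `-1` -/

/-- `A` describes the action of `g` on `thetaVec`. -/
def IsThetaMultiplier (g : SL(2, ℤ)) (A : Matrix (Fin 4) (Fin 4) ℂ) : Prop :=
  ∀ τ : ℍ, thetaVec (g • τ) = A.mulVec (thetaVec τ)

/-- Uniqueness turns the pointwise chosen matrices into a homomorphism and identifies its values at
`T` and `R`. -/
lemma IsThetaMultiplier.unique {g : SL(2, ℤ)} {A A' : Matrix (Fin 4) (Fin 4) ℂ}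
    (h : IsThetaMultiplier g A) (h' : IsThetaMultiplier g A') : A = A' :=
  matrix_eq_of_mulVec_thetaVec fun τ => (h τ).symm.trans (h' τ)

lemma IsThetaMultiplier.one : IsThetaMultiplier 1 1 := fun τ => by simp

lemma IsThetaMultiplier.mul {g g' : SL(2, ℤ)} {A A' : Matrix (Fin 4) (Fin 4) ℂ}
    (h : IsThetaMultiplier g A) (h' : IsThetaMultiplier g' A') :
    IsThetaMultiplier (g * g') (A * A') := fun τ => by
  rw [mul_smul, h, h', Matrix.mulVec_mulVec]

/-- If `w A = 0`, then `w · thetaVec τ = (w A) · thetaVec (g⁻¹ τ) = 0` for all `τ`, so `w = 0` by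
linear independence; hence `A` is invertible. -/
lemma IsThetaMultiplier.exists_inv {g : SL(2, ℤ)} {A : Matrix (Fin 4) (Fin 4) ℂ}
    (h : IsThetaMultiplier g A) : ∃ A', IsThetaMultiplier g⁻¹ A' := by
  have hA : IsUnit A := by
    rw [← Matrix.vecMul_injective_iff_isUnit]
    intro w w' hw
    rw [← sub_eq_zero]
    refine eq_zero_of_forall_dotProduct_thetaVec fun τ => ?_
    have h1 : Matrix.vecMul (w - w') A = 0 := by
      rw [Matrix.sub_vecMul]; exact sub_eq_zero.2 hw
    have h2 := h (g⁻¹ • τ)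
    rw [smul_inv_smul] at h2
    change (w - w') ⬝ᵥ thetaVec τ = 0
    rw [h2, Matrix.dotProduct_mulVec, h1, zero_dotProduct]
  obtain ⟨A', hA'⟩ := hA.exists_left_inv
  refine ⟨A', fun τ => ?_⟩
  have h2 := h (g⁻¹ • τ)
  rw [smul_inv_smul] at h2
  rw [h2, Matrix.mulVec_mulVec, hA', Matrix.one_mulVec]

lemma isThetaMultiplier_T_zpow (m : ℤ) : IsThetaMultiplier (ModularGroup.T ^ m)
    (Matrix.diagonal fun j : Fin 4 => (ζ 12 ^ (2 * (j : ℕ) ^ 2)) ^ m) := fun τ => by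
  funext j
  rw [thetaVec_T_zpow_smul, Matrix.mulVec_diagonal]

lemma isThetaMultiplier_of_lower_left_eq_zero {g : SL(2, ℤ)} (hg : g 1 0 = 0) :
    ∃ d : Fin 4 → ℂ, IsThetaMultiplier g (Matrix.diagonal d) := by
  obtain ⟨m, hm⟩ := ModularGroup.exists_eq_T_zpow_of_c_eq_zero hg
  exact ⟨_, fun τ => by rw [hm]; exact isThetaMultiplier_T_zpow m τ⟩

lemma exists_isThetaMultiplier_of_mul {g h : SL(2, ℤ)} {A : Matrix (Fin 4) (Fin 4) ℂ}
    (hh : IsThetaMultiplier h A) (hgh : ∃ A, IsThetaMultiplier (g * h) A) :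
    ∃ A, IsThetaMultiplier g A := by
  obtain ⟨A', hA'⟩ := hgh
  obtain ⟨A'', hA''⟩ := hh.exists_inv
  exact ⟨A' * A'', by simpa using hA'.mul hA''⟩

/-- Euclidean descent on `|c| + |d|` for the bottom row `(c, d)`. Right multiplication by `R^{±1}`
replaces `c` by `c ± 2d` when `|d| < |c|`, and `T^{±1}` replaces `d` by `d ± c` otherwise; one of
the signs lowers the sum. The descent stops at `c = 0`. -/
lemma exists_isThetaMultiplier (g : SL(2, ℤ)) (hg : g 1 0 % 2 = 0) :
    ∃ A, IsThetaMultiplier g A := by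
  have hR : IsThetaMultiplier matR PhiR := thetaVec_R_smul
  obtain ⟨A', hR'⟩ := hR.exists_inv
  have hT := isThetaMultiplier_T_zpow
  have aux : ∀ (N : ℕ) (g : SL(2, ℤ)), g 1 0 % 2 = 0 → (g 1 0).natAbs + (g 1 1).natAbs ≤ N →
      ∃ A, IsThetaMultiplier g A := by
    intro N
    induction N with
    | zero =>
      intro g hg hN
      have : g 1 0 = 0 := by lia
      obtain ⟨d, hd⟩ := isThetaMultiplier_of_lower_left_eq_zero this
      exact ⟨_, hd⟩
    | succ N ih =>
      intro g hg hN
      by_cases hc : g 1 0 = 0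
      · obtain ⟨d, hd⟩ := isThetaMultiplier_of_lower_left_eq_zero hc
        exact ⟨_, hd⟩
      -- An odd `d` is nonzero, which makes one of `c ± 2d` strictly smaller than `c`. An even `d`
      -- would make the determinant even.
      have hd : g 1 1 % 2 = 1 := by
        have hdet := Matrix.det_fin_two (g : Matrix (Fin 2) (Fin 2) ℤ)
        rw [g.det_coe] at hdet
        by_contra h
        have h0 : g 1 1 % 2 = 0 := by lia
        obtain ⟨k, hk⟩ := Int.dvd_of_emod_eq_zero hg
        obtain ⟨l, hl⟩ := Int.dvd_of_emod_eq_zero h0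
        rw [hk, hl] at hdet
        have : (1 : ℤ) = 2 * (g 0 0 * l - g 0 1 * k) := by linear_combination hdet
        lia
      have eT : ∀ m : ℤ, (g * ModularGroup.T ^ m) 1 0 = g 1 0 ∧
          (g * ModularGroup.T ^ m) 1 1 = g 1 1 + m * g 1 0 := by
        intro m
        constructor <;>
          simp [Matrix.mul_apply, Fin.sum_univ_two, ModularGroup.coe_T_zpow, mul_comm, add_comm]
      have eR : (g * matR) 1 0 = g 1 0 + 2 * g 1 1 ∧ (g * matR) 1 1 = g 1 1 := by
        constructor
        · change (g.1 * !![1, 0; 2, 1] : Matrix (Fin 2) (Fin 2) ℤ) 1 0 = _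
          simp [Matrix.mul_apply, Fin.sum_univ_two, mul_comm]
        · change (g.1 * !![1, 0; 2, 1] : Matrix (Fin 2) (Fin 2) ℤ) 1 1 = _
          simp [Matrix.mul_apply, Fin.sum_univ_two]
      have eR' : (g * matR⁻¹) 1 0 = g 1 0 - 2 * g 1 1 ∧ (g * matR⁻¹) 1 1 = g 1 1 := by
        constructor
        · change (g.1 * Matrix.adjugate !![1, 0; 2, 1] : Matrix (Fin 2) (Fin 2) ℤ) 1 0 = _
          simp [Matrix.mul_apply, Fin.sum_univ_two, Matrix.adjugate_fin_two, mul_comm]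
          ring
        · change (g.1 * Matrix.adjugate !![1, 0; 2, 1] : Matrix (Fin 2) (Fin 2) ℤ) 1 1 = _
          simp [Matrix.mul_apply, Fin.sum_univ_two, Matrix.adjugate_fin_two]
      obtain ⟨eT1, eT2⟩ := eT 1
      obtain ⟨eT1', eT2'⟩ := eT (-1)
      rcases lt_or_ge (g 1 1).natAbs (g 1 0).natAbs with hlt | hge
      · by_cases hs : (g 1 0 + 2 * g 1 1).natAbs < (g 1 0).natAbs
        · exact exists_isThetaMultiplier_of_mul hR (ih _ (by rw [eR.1]; lia)
            (by rw [eR.1, eR.2]; lia))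
        · exact exists_isThetaMultiplier_of_mul hR' (ih _ (by rw [eR'.1]; lia)
            (by rw [eR'.1, eR'.2]; lia))
      · by_cases hs : (g 1 1 + 1 * g 1 0).natAbs < (g 1 1).natAbs
        · exact exists_isThetaMultiplier_of_mul (hT 1) (ih _ (by rw [eT1]; exact hg)
            (by rw [eT1, eT2]; lia))
        · exact exists_isThetaMultiplier_of_mul (hT (-1)) (ih _ (by rw [eT1']; exact hg)
            (by rw [eT1', eT2']; lia))
  exact aux _ g hg le_rfl

lemma exists_isThetaMultiplier_Gamma0 (M : CongruenceSubgroup.Gamma0 2) :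
    ∃ A, IsThetaMultiplier (M : SL(2, ℤ)) A := by
  refine exists_isThetaMultiplier _ ?_
  have h := CongruenceSubgroup.Gamma0_mem.1 M.2
  have h' := (ZMod.intCast_zmod_eq_zero_iff_dvd _ 2).1 h
  exact Int.emod_eq_zero_of_dvd (by exact_mod_cast h')

/-- The multiplier system of `thetaVec`. -/
def thetaMultiplier : CongruenceSubgroup.Gamma0 2 →* Matrix (Fin 4) (Fin 4) ℂ where
  toFun M := (exists_isThetaMultiplier_Gamma0 M).choose
  map_one' := (exists_isThetaMultiplier_Gamma0 1).choose_spec.unique IsThetaMultiplier.one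
  map_mul' M M' := (exists_isThetaMultiplier_Gamma0 (M * M')).choose_spec.unique
    ((exists_isThetaMultiplier_Gamma0 M).choose_spec.mul
      (exists_isThetaMultiplier_Gamma0 M').choose_spec)

lemma isThetaMultiplier_thetaMultiplier (M : CongruenceSubgroup.Gamma0 2) :
    IsThetaMultiplier M (thetaMultiplier M) := (exists_isThetaMultiplier_Gamma0 M).choose_spec

lemma thetaMultiplier_R : thetaMultiplier R = PhiR :=
  (isThetaMultiplier_thetaMultiplier R).unique thetaVec_R_smul

lemma thetaMultiplier_T : thetaMultiplier T = PhiT := by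
  refine (isThetaMultiplier_thetaMultiplier T).unique fun τ => ?_
  have h := isThetaMultiplier_T_zpow 1 τ
  rw [zpow_one] at h
  have h6 := ζ_twelve_pow_six
  have e : PhiT = Matrix.diagonal fun j : Fin 4 => (ζ 12 ^ (2 * (j : ℕ) ^ 2)) ^ (1 : ℤ) := by
    ext i j
    fin_cases i <;> fin_cases j <;> simp [PhiT, ζ_six, ζ_three]
    · ring
    · linear_combination -(ζ 12 ^ 12 - ζ 12 ^ 6 + 1) * h6
  rw [e]
  exact h

lemma thetaMultiplier_isDiag (M : CongruenceSubgroup.Gamma0 2) (hM : (M : SL(2, ℤ)) 1 0 = 0) :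
    (thetaMultiplier M).IsDiag := by
  obtain ⟨d, hd⟩ := isThetaMultiplier_of_lower_left_eq_zero hM
  rw [(isThetaMultiplier_thetaMultiplier M).unique hd]
  exact Matrix.isDiag_diagonal d

/-! ### Growth at the cusps -/

/-- The span of all twelve coset functions is stable under the whole modular group, so growth at any
cusp reduces to growth at infinity. -/
lemma exists_cosetForm_smul_eq (g : SL(2, ℤ)) : ∀ (p : Fin 2) (q : Fin 6),
    ∃ K : Fin 2 → Fin 6 → ℂ, ∀ τ : ℍ, cosetForm (p : ℕ) (q : ℕ) (g • τ) =
      ∑ r, ∑ s, K r s * cosetForm ((r : ℕ) : ℤ) ((s : ℕ) : ℤ) τ := by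
  have hg : g ∈ Subgroup.closure {ModularGroup.S, ModularGroup.T} := by
    rw [SpecialLinearGroup.SL2Z_generators]; trivial
  have hT : ∀ (m : ℤ) (p : Fin 2) (q : Fin 6), ∃ K : Fin 2 → Fin 6 → ℂ, ∀ τ : ℍ,
      cosetForm (p : ℕ) (q : ℕ) (ModularGroup.T ^ m • τ) =
      ∑ r, ∑ s, K r s * cosetForm ((r : ℕ) : ℤ) ((s : ℕ) : ℤ) τ := by
    intro m p q
    refine ⟨fun r s => if r = p then if s = q then
      ζ 12 ^ (m * (3 * ((p : ℕ) : ℤ) ^ 2 - ((q : ℕ) : ℤ) ^ 2)) else 0 else 0, fun τ => ?_⟩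
    rw [cosetForm_T_zpow]
    simp
  have hS : ∀ (p : Fin 2) (q : Fin 6), ∃ K : Fin 2 → Fin 6 → ℂ, ∀ τ : ℍ,
      cosetForm (p : ℕ) (q : ℕ) (ModularGroup.S • τ) =
      ∑ r, ∑ s, K r s * cosetForm ((r : ℕ) : ℤ) ((s : ℕ) : ℤ) τ := by
    intro p q
    refine ⟨fun r s => 1 / (Real.sqrt 12 : ℂ) *
      ζ 12 ^ (6 * ((r : ℕ) : ℤ) * ((p : ℕ) : ℤ) - 2 * ((s : ℕ) : ℤ) * ((q : ℕ) : ℤ)),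
      fun τ => ?_⟩
    rw [cosetForm_S_smul, Finset.mul_sum]
    refine Finset.sum_congr rfl fun r _ => ?_
    rw [Finset.mul_sum]
    refine Finset.sum_congr rfl fun s _ => ?_
    rw [← mul_assoc]
  induction hg using Subgroup.closure_induction'' with
  | mem x hx =>
    rcases hx with rfl | rfl
    · exact hS
    · simpa using hT 1
  | inv_mem x hx =>
    rcases hx with rfl | rfl
    · have : ∀ τ : ℍ, ModularGroup.S⁻¹ • τ = ModularGroup.S • τ := fun τ => by
        rw [inv_smul_eq_iff, S_smul_S_smul]
      simpa only [this] using hS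
    · simpa using hT (-1)
  | one => simpa using hT 0
  | mul x y _ _ hx hy =>
    intro p q
    obtain ⟨K, hK⟩ := hx p q
    choose L hL using hy
    refine ⟨fun r s => ∑ r', ∑ s', K r' s' * L r' s' r s, fun τ => ?_⟩
    rw [mul_smul, hK]
    simp only [hL, Finset.mul_sum, Finset.sum_mul]
    simp only [← Fintype.sum_prod_type']
    refine Fintype.sum_equiv ⟨fun x => (x.2.2.1, x.2.2.2, x.1, x.2.1),
      fun x => (x.2.2.1, x.2.2.2, x.1, x.2.1), fun _ => rfl, fun _ => rfl⟩ _ _ fun x => ?_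
    rw [mul_assoc]
    rfl

lemma thetaVec_smul_isBigO (j : Fin 4) (g : SL(2, ℤ)) :
    (fun τ : ℍ => thetaVec (g • τ) j) =O[atImInfty] fun τ : ℍ => τ.im ^ 1 := by
  have h : ∃ (p : Fin 2) (q : Fin 6) (k l : ℤ), ((j : ℕ) : ℤ) = ((p : ℕ) : ℤ) + 2 * k ∧
      ((j : ℕ) : ℤ) = ((q : ℕ) : ℤ) + 6 * l :=
    ⟨⟨j % 2, by lia⟩, ⟨j % 6, by lia⟩, (j : ℕ) / 2, (j : ℕ) / 6, by
      dsimp only; lia, by dsimp only; lia⟩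
  obtain ⟨p, q, k, l, hp, hq⟩ := h
  have e : ∀ τ, thetaVec τ j = cosetForm (p : ℕ) (q : ℕ) τ := by
    intro τ
    rw [thetaVec, ← cosetForm_add (p : ℕ) (q : ℕ) k l, ← hp, ← hq]
  obtain ⟨K, hK⟩ := exists_cosetForm_smul_eq g p q
  simp only [e, hK]
  exact Asymptotics.IsBigO.fun_sum fun r _ => Asymptotics.IsBigO.fun_sum fun s _ =>
    (cosetForm_isBigO _ _).const_mul_left _

end

noncomputable section

/-! ### Superpositions of exponentials `exp (i u x - v y)` on the upper half-plane -/

open MeasureTheory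

/-- The real-linear map `x + iy ↦ x a + y b`. -/
def gradCLM (a b : ℂ) : ℂ →L[ℝ] ℂ := Complex.reCLM.smulRight a + Complex.imCLM.smulRight b

lemma gradCLM_apply (a b w : ℂ) : gradCLM a b w = w.re * a + w.im * b := by
  simp [gradCLM]

lemma norm_gradCLM_le (a b : ℂ) : ‖gradCLM a b‖ ≤ ‖a‖ + ‖b‖ := by
  refine (gradCLM a b).opNorm_le_bound (by positivity) fun w => ?_
  rw [gradCLM_apply]
  calc _ ≤ ‖(w.re : ℂ) * a‖ + ‖(w.im : ℂ) * b‖ := norm_add_le _ _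
    _ ≤ ‖w‖ * ‖a‖ + ‖w‖ * ‖b‖ := by
        rw [norm_mul, norm_mul, Complex.norm_real, Complex.norm_real]
        gcongr
        · exact Complex.abs_re_le_norm w
        · exact Complex.abs_im_le_norm w
    _ = _ := by ring

lemma gradCLM_add (a b a' b' : ℂ) :
    gradCLM a b + gradCLM a' b' = gradCLM (a + a') (b + b') := by
  refine ContinuousLinearMap.ext fun w => ?_
  simp only [_root_.add_apply, gradCLM_apply]
  ring

lemma hasFDerivAt_exp_mul (u v : ℝ) (z : ℂ) :
    HasFDerivAt (fun z : ℂ => Complex.exp (((u * z.re : ℝ) : ℂ) * Complex.I - ((v * z.im : ℝ) : ℂ)))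
      (gradCLM ((u * Complex.I) *
          Complex.exp (((u * z.re : ℝ) : ℂ) * Complex.I - ((v * z.im : ℝ) : ℂ)))
        (-v * Complex.exp (((u * z.re : ℝ) : ℂ) * Complex.I - ((v * z.im : ℝ) : ℂ)))) z := by
  have e : (fun z : ℂ => ((u * z.re : ℝ) : ℂ) * Complex.I - ((v * z.im : ℝ) : ℂ)) =
      gradCLM (u * Complex.I) (-v) := by
    funext z
    rw [gradCLM_apply]; push_cast; ring
  have h : HasFDerivAt (fun z : ℂ => ((u * z.re : ℝ) : ℂ) * Complex.I - ((v * z.im : ℝ) : ℂ))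
      (gradCLM (u * Complex.I) (-v)) z := by
    rw [e]; exact (gradCLM (u * Complex.I) (-v)).hasFDerivAt
  refine h.cexp.congr_fderiv ?_
  refine ContinuousLinearMap.ext fun w => ?_
  simp only [_root_.smul_apply, gradCLM_apply, smul_eq_mul]
  ring

variable {α : Type*} [MeasurableSpace α]

/-- The superposition `∫ g exp (i u x - v y) dμ`. -/
def expInt (μ : Measure α) (u v : α → ℝ) (g : α → ℂ) (z : ℂ) : ℂ :=
  ∫ a, g a * Complex.exp (((u a * z.re : ℝ) : ℂ) * Complex.I - ((v a * z.im : ℝ) : ℂ)) ∂μ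

/-- The amplitude `g` is integrable against all `exp (-v y)`, `y > 0`. -/
def ExpDecay (μ : Measure α) (v : α → ℝ) (g : α → ℂ) : Prop :=
  AEStronglyMeasurable g μ ∧ ∀ y > 0, Integrable (fun a => ‖g a‖ * Real.exp (-(y * v a))) μ

variable {μ : Measure α} {u v : α → ℝ} {g : α → ℂ}

/-- Half of the decay absorbs the weight: `v ≤ (2/y) exp (y v / 2)`. The class is thus closed under
the factors `i u` and `-v` that differentiation produces. -/
lemma ExpDecay.mul (hg : ExpDecay μ v g) {w : α → ℂ} (hw : Measurable w)
    (hv : Measurable v) (hwv : ∀ a, ‖w a‖ ≤ v a) : ExpDecay μ v fun a => w a * g a := by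
  refine ⟨hw.aestronglyMeasurable.mul hg.1, fun y hy => ?_⟩
  refine ((hg.2 (y / 2) (by positivity)).const_mul (2 / y)).mono' ?_ ?_
  · exact ((hw.aestronglyMeasurable.mul hg.1).norm).mul
      (by fun_prop : Measurable fun a => Real.exp (-(y * v a))).aestronglyMeasurable
  · refine Filter.Eventually.of_forall fun a => ?_
    rw [norm_mul, norm_norm, norm_mul, Real.norm_of_nonneg (Real.exp_pos _).le]
    have h1 : v a ≤ 2 / y * Real.exp (y / 2 * v a) := by
      have := Real.add_one_le_exp (y / 2 * v a)
      rw [div_mul_eq_mul_div, le_div_iff₀ hy]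
      linarith
    calc ‖w a‖ * ‖g a‖ * Real.exp (-(y * v a))
        ≤ (2 / y * Real.exp (y / 2 * v a)) * ‖g a‖ * Real.exp (-(y * v a)) := by
          gcongr
          exact (hwv a).trans h1
      _ = 2 / y * (‖g a‖ * (Real.exp (y / 2 * v a) * Real.exp (-(y * v a)))) := by ring
      _ = _ := by rw [← Real.exp_add]; congr 3; ring

lemma ExpDecay.const_mul (hg : ExpDecay μ v g) (c : ℂ) : ExpDecay μ v fun a => c * g a := by
  refine ⟨hg.1.const_mul c, fun y hy => ((hg.2 y hy).const_mul ‖c‖).congr ?_⟩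
  exact Filter.Eventually.of_forall fun a => by simp only [norm_mul]; ring

lemma ExpDecay.mul_I_mul (hg : ExpDecay μ v g) (hu : Measurable u) (hv : Measurable v)
    (huv : ∀ a, |u a| ≤ v a) : ExpDecay μ v fun a => u a * Complex.I * g a :=
  hg.mul (by fun_prop) hv fun a => by simpa using huv a

lemma ExpDecay.neg_mul (hg : ExpDecay μ v g) (hv : Measurable v) (huv : ∀ a, |u a| ≤ v a) :
    ExpDecay μ v fun a => -v a * g a :=
  hg.mul (by fun_prop) hv fun a => by
    simp [abs_of_nonneg ((abs_nonneg _).trans (huv a))]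

lemma norm_exp_sub (x y : ℝ) : ‖Complex.exp ((x : ℂ) * Complex.I - (y : ℂ))‖ = Real.exp (-y) := by
  rw [Complex.norm_exp]; simp

lemma ExpDecay.integrable (hg : ExpDecay μ v g) (hu : Measurable u) (hv : Measurable v) {z : ℂ}
    (hz : 0 < z.im) : Integrable (fun a => g a *
      Complex.exp (((u a * z.re : ℝ) : ℂ) * Complex.I - ((v a * z.im : ℝ) : ℂ))) μ := by
  refine (hg.2 z.im hz).mono' (hg.1.mul (Measurable.aestronglyMeasurable (by fun_prop))) ?_
  refine Filter.Eventually.of_forall fun a => ?_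
  rw [norm_mul, norm_exp_sub, mul_comm (v a)]

lemma hasFDerivAt_expInt (hg : ExpDecay μ v g) (hu : Measurable u) (hv : Measurable v)
    (huv : ∀ a, |u a| ≤ v a) {z : ℂ} (hz : 0 < z.im) :
    HasFDerivAt (expInt μ u v g) (gradCLM (expInt μ u v (fun a => u a * Complex.I * g a) z)
      (expInt μ u v (fun a => -v a * g a) z)) z := by
  -- On this neighbourhood of `z` the derivative of the integrand is dominated by its size at height
  -- `Im z / 2`.
  have hopen : IsOpen {w : ℂ | z.im / 2 < w.im} := isOpen_lt continuous_const Complex.continuous_im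
  have h1 := hg.mul_I_mul hu hv huv
  have h2 := hg.neg_mul hv huv
  have hi1 := h1.integrable hu hv hz
  have hi2 := h2.integrable hu hv hz
  set F' : ℂ → α → ℂ →L[ℝ] ℂ := fun z a => gradCLM
    (u a * Complex.I * g a *
      Complex.exp (((u a * z.re : ℝ) : ℂ) * Complex.I - ((v a * z.im : ℝ) : ℂ)))
    (-v a * g a *
      Complex.exp (((u a * z.re : ℝ) : ℂ) * Complex.I - ((v a * z.im : ℝ) : ℂ))) with hF'
  have hF'int : Integrable (F' z) μ := by
    have h1 := (ContinuousLinearMap.smulRightL ℝ ℂ ℂ Complex.reCLM).integrable_comp hi1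
    have h2 := (ContinuousLinearMap.smulRightL ℝ ℂ ℂ Complex.imCLM).integrable_comp hi2
    exact h1.add h2
  have hderiv := hasFDerivAt_integral_of_dominated_of_fderiv_le (𝕜 := ℝ) (μ := μ) (x₀ := z)
    (s := {w : ℂ | z.im / 2 < w.im})
    (F := fun z a => g a *
      Complex.exp (((u a * z.re : ℝ) : ℂ) * Complex.I - ((v a * z.im : ℝ) : ℂ)))
    (F' := F')
    (bound := fun a => ‖u a * Complex.I * g a‖ * Real.exp (-(z.im / 2 * v a)) +
      ‖-v a * g a‖ * Real.exp (-(z.im / 2 * v a)))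
    (hopen.mem_nhds (by simp only [Set.mem_ofPred_eq]; linarith))
    (Filter.Eventually.of_forall fun w =>
      hg.1.mul (Measurable.aestronglyMeasurable (by fun_prop)))
    (hg.integrable hu hv hz) hF'int.aestronglyMeasurable
    (Filter.Eventually.of_forall fun a w (hw : z.im / 2 < w.im) => ?_)
    ((h1.2 _ (by positivity)).add (h2.2 _ (by positivity)))
    (Filter.Eventually.of_forall fun a w _ => ?_)
  · refine hderiv.congr_fderiv ?_
    refine ContinuousLinearMap.ext fun x => ?_
    rw [ContinuousLinearMap.integral_apply hF'int]
    simp only [hF', gradCLM_apply, expInt]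
    rw [integral_add (hi1.const_mul _) (hi2.const_mul _), integral_const_mul, integral_const_mul]
  · refine (norm_gradCLM_le _ _).trans ?_
    have hva : 0 ≤ v a := (abs_nonneg _).trans (huv a)
    have : Real.exp (-(v a * w.im)) ≤ Real.exp (-(z.im / 2 * v a)) := by
      rw [Real.exp_le_exp, neg_le_neg_iff, mul_comm]
      exact mul_le_mul_of_nonneg_left hw.le hva
    rw [norm_mul _ (Complex.exp _), norm_mul _ (Complex.exp _), norm_exp_sub]
    gcongr
  · refine ((hasFDerivAt_exp_mul (u a) (v a) w).const_mul (g a)).congr_fderiv ?_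
    refine ContinuousLinearMap.ext fun x => ?_
    simp only [hF', gradCLM_apply, _root_.smul_apply, smul_eq_mul]
    ring

lemma isOpen_im_pos : IsOpen {z : ℂ | 0 < z.im} :=
  isOpen_lt continuous_const Complex.continuous_im

/-- Both partial derivatives are superpositions of the same kind with new amplitudes, so induction
on the order works once `g` is generalized. -/
lemma contDiffOn_expInt (hg : ExpDecay μ v g) (hu : Measurable u) (hv : Measurable v)
    (huv : ∀ a, |u a| ≤ v a) (n : ℕ) : ContDiffOn ℝ n (expInt μ u v g) {z | 0 < z.im} := by
  induction n generalizing g with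
  | zero =>
    rw [Nat.cast_zero, contDiffOn_zero]
    exact fun z hz => (hasFDerivAt_expInt hg hu hv huv hz).continuousAt.continuousWithinAt
  | succ n ih =>
    rw [Nat.cast_succ, contDiffOn_succ_iff_fderiv_of_isOpen isOpen_im_pos]
    refine ⟨fun z hz => (hasFDerivAt_expInt hg hu hv huv hz).differentiableAt.differentiableWithinAt,
      fun h => by simp at h, ?_⟩
    have h1 := ih (hg.mul_I_mul hu hv huv)
    have h2 := ih (hg.neg_mul hv huv)
    refine ContDiffOn.congr (f := fun z => gradCLM
      (expInt μ u v (fun a => u a * Complex.I * g a) z)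
      (expInt μ u v (fun a => -v a * g a) z)) ?_
      fun z hz => (hasFDerivAt_expInt hg hu hv huv hz).fderiv
    exact ((ContinuousLinearMap.smulRightL ℝ ℂ ℂ Complex.reCLM).contDiff.comp_contDiffOn h1).add
      ((ContinuousLinearMap.smulRightL ℝ ℂ ℂ Complex.imCLM).contDiff.comp_contDiffOn h2)

lemma hasFDerivAt_im_mul {φ : ℝ → ℝ} {φ' : ℝ} {f : ℂ → ℂ} {a b z : ℂ} (hφ : HasDerivAt φ φ' z.im)
    (hf : HasFDerivAt f (gradCLM a b) z) : HasFDerivAt (fun z : ℂ => (φ z.im : ℂ) * f z)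
      (gradCLM (φ z.im * a) (φ z.im * b + φ' * f z)) z := by
  have h1 : HasFDerivAt (fun z : ℂ => ((φ z.im : ℝ) : ℂ)) (gradCLM 0 φ') z := by
    have := (Complex.ofRealCLM.hasFDerivAt (x := φ z.im)).comp z
      (hφ.comp_hasFDerivAt z Complex.imCLM.hasFDerivAt)
    refine this.congr_fderiv (ContinuousLinearMap.ext fun w => ?_)
    simp [gradCLM_apply, mul_comm]
  refine (h1.mul hf).congr_fderiv (ContinuousLinearMap.ext fun w => ?_)
  simp [gradCLM_apply]
  ring

lemma laplacian_eq_of_hasFDerivAt {f a b : ℂ → ℂ} {z a₁ a₂ b₁ b₂ : ℂ} (hz : 0 < z.im)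
    (hf : ∀ w : ℂ, 0 < w.im → HasFDerivAt f (gradCLM (a w) (b w)) w)
    (ha : HasFDerivAt a (gradCLM a₁ a₂) z) (hb : HasFDerivAt b (gradCLM b₁ b₂) z) :
    Laplacian.laplacian f z = a₁ + b₂ := by
  have hfd : fderiv ℝ f =ᶠ[nhds z] fun w => gradCLM (a w) (b w) :=
    Filter.eventually_of_mem (isOpen_im_pos.mem_nhds hz) fun w hw => (hf w hw).fderiv
  have hd₁ := ((ContinuousLinearMap.smulRightL ℝ ℂ ℂ Complex.reCLM).hasFDerivAt
    (x := a z)).comp z ha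
  have hd₂ := ((ContinuousLinearMap.smulRightL ℝ ℂ ℂ Complex.imCLM).hasFDerivAt
    (x := b z)).comp z hb
  have hd : fderiv ℝ (fun w => gradCLM (a w) (b w)) z = _ := (hd₁.add hd₂).fderiv
  rw [InnerProductSpace.laplacian_eq_iteratedFDeriv_complexPlane]
  simp only [iteratedFDeriv_two_apply]
  rw [hfd.fderiv_eq, hd]
  simp [gradCLM_apply]

lemma ExpDecay.add {g' : α → ℂ} (hg : ExpDecay μ v g) (hg' : ExpDecay μ v g')
    (hv : Measurable v) : ExpDecay μ v fun a => g a + g' a := by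
  refine ⟨hg.1.add hg'.1, fun y hy => ((hg.2 y hy).add (hg'.2 y hy)).mono' ?_ ?_⟩
  · exact (hg.1.add hg'.1).norm.mul (Measurable.aestronglyMeasurable (by fun_prop))
  · refine Filter.Eventually.of_forall fun a => ?_
    rw [norm_mul, norm_norm, Real.norm_of_nonneg (Real.exp_pos _).le, Pi.add_apply, ← add_mul]
    gcongr
    exact norm_add_le _ _

lemma expInt_add {g' : α → ℂ} (hg : ExpDecay μ v g) (hg' : ExpDecay μ v g') (hu : Measurable u)
    (hv : Measurable v) {z : ℂ} (hz : 0 < z.im) :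
    expInt μ u v g z + expInt μ u v g' z = expInt μ u v (fun a => g a + g' a) z := by
  simp only [expInt, add_mul]
  rw [integral_add (hg.integrable hu hv hz) (hg'.integrable hu hv hz)]

lemma expInt_const_mul (c : ℂ) (z : ℂ) :
    expInt μ u v (fun a => c * g a) z = c * expInt μ u v g z := by
  simp only [expInt, mul_assoc, integral_const_mul]

lemma hasFDerivAt_sqrt_mul_expInt (hg : ExpDecay μ v g) (hu : Measurable u) (hv : Measurable v)
    (huv : ∀ a, |u a| ≤ v a) {z : ℂ} (hz : 0 < z.im) :
    HasFDerivAt (fun z : ℂ => (Real.sqrt z.im : ℂ) * expInt μ u v g z)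
      (gradCLM ((Real.sqrt z.im : ℂ) * expInt μ u v (fun a => u a * Complex.I * g a) z)
        ((Real.sqrt z.im : ℂ) * expInt μ u v (fun a => -v a * g a) z +
          ((1 / (2 * Real.sqrt z.im) : ℝ) : ℂ) * expInt μ u v g z)) z :=
  hasFDerivAt_im_mul (Real.hasDerivAt_sqrt hz.ne') (hasFDerivAt_expInt hg hu hv huv hz)

lemma gradCLM_hasFDerivAt_add {f₁ f₂ : ℂ → ℂ} {a b a' b' z : ℂ}
    (h₁ : HasFDerivAt f₁ (gradCLM a b) z) (h₂ : HasFDerivAt f₂ (gradCLM a' b') z) :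
    HasFDerivAt (fun z => f₁ z + f₂ z) (gradCLM (a + a') (b + b')) z := by
  rw [← gradCLM_add]; exact h₁.add h₂

/-- The Laplacian of `√y ∫ exp (i u x - v y)`. -/
lemma laplacian_sqrt_mul_expInt (hg : ExpDecay μ v g) (hu : Measurable u) (hv : Measurable v)
    (huv : ∀ a, |u a| ≤ v a) {z : ℂ} (hz : 0 < z.im) :
    Laplacian.laplacian (fun z : ℂ => (Real.sqrt z.im : ℂ) * expInt μ u v g z) z =
      Real.sqrt z.im * (expInt μ u v (fun a => (v a ^ 2 - u a ^ 2 - v a / z.im : ℝ) * g a) z -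
        expInt μ u v g z / (4 * z.im ^ 2)) := by
  have h1 := hg.mul_I_mul hu hv huv
  have h2 := hg.neg_mul hv huv
  have h11 := h1.mul_I_mul hu hv huv
  have h22 := h2.neg_mul hv huv
  have hs : 0 < Real.sqrt z.im := Real.sqrt_pos.2 hz
  have hss : Real.sqrt z.im ^ 2 = z.im := Real.sq_sqrt hz.le
  have hd : HasDerivAt (fun y : ℝ => 1 / (2 * Real.sqrt y))
      (-(1 / (4 * z.im * Real.sqrt z.im))) z.im := by
    have := ((Real.hasDerivAt_sqrt hz.ne').const_mul 2).inv (by positivity)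
    simp only [one_div]
    refine this.congr_deriv ?_
    rw [mul_pow, hss]
    field_simp
    ring
  have hsum := laplacian_eq_of_hasFDerivAt hz
    (fun w hw => hasFDerivAt_sqrt_mul_expInt hg hu hv huv hw)
    (hasFDerivAt_sqrt_mul_expInt h1 hu hv huv hz)
    (gradCLM_hasFDerivAt_add (hasFDerivAt_sqrt_mul_expInt h2 hu hv huv hz)
      (hasFDerivAt_im_mul hd (hasFDerivAt_expInt hg hu hv huv hz)))
  rw [hsum]
  -- The cross term of the product rule, `2 · (1 / (2√y)) ∂_y = √y · (1/y) ∂_y`, supplies the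
  -- summand `-v / y`.
  have h3 := h2.const_mul (1 / (z.im : ℂ))
  have e : expInt μ u v (fun a => (v a ^ 2 - u a ^ 2 - v a / z.im : ℝ) * g a) z =
      expInt μ u v (fun a => u a * Complex.I * (u a * Complex.I * g a)) z +
        expInt μ u v (fun a => -v a * (-v a * g a)) z +
        1 / z.im * expInt μ u v (fun a => -v a * g a) z := by
    have h12 := h11.add h22 hv
    rw [expInt_add h11 h22 hu hv hz, ← expInt_const_mul, expInt_add h12 h3 hu hv hz]
    congr 1
    funext a
    push_cast
    linear_combination (-(u a : ℂ) ^ 2 * g a) * Complex.I_sq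
  rw [e]
  have hz' : (z.im : ℂ) ≠ 0 := by exact_mod_cast hz.ne'
  have hs' : (Real.sqrt z.im : ℂ) ≠ 0 := by exact_mod_cast hs.ne'
  have hss' : (Real.sqrt z.im : ℂ) ^ 2 = z.im := by exact_mod_cast hss
  have hz2 : (z.im : ℂ) = (Real.sqrt z.im : ℂ) ^ 2 := hss'.symm
  generalize expInt μ u v (fun a => u a * Complex.I * (u a * Complex.I * g a)) z = X₁
  generalize expInt μ u v (fun a => -v a * (-v a * g a)) z = X₂
  generalize expInt μ u v (fun a => -v a * g a) z = X₃
  push_cast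
  field_simp
  rw [hz2]
  ring

end

noncomputable section

/-! ### Smoothness and the eigenvalue equation -/

open MeasureTheory

/-- Counting measure times Lebesgue measure merges the lattice sum and the `t`-integral into one
superposition of exponentials. -/
def thetaMeasure : Measure ((ℤ × ℤ) × ℝ) :=
  (Measure.count : Measure (ℤ × ℤ)).prod (volume.restrict (Set.Ioc (param c₁) (param c₂)))

def thetaFreq (j : ℤ) (a : (ℤ × ℤ) × ℝ) : ℝ := 2 * Real.pi * Q (latPt j j a.1)

def thetaDecay (j : ℤ) (a : (ℤ × ℤ) × ℝ) : ℝ := 2 * Real.pi * maj a.2 (latPt j j a.1)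

lemma measurable_thetaFreq (j : ℤ) : Measurable (thetaFreq j) :=
  measurable_from_prod_countable_right fun n =>
    (measurable_const : Measurable fun _ : ℝ => 2 * Real.pi * Q (latPt j j n))

lemma measurable_thetaDecay (j : ℤ) : Measurable (thetaDecay j) :=
  measurable_from_prod_countable_right fun n =>
    ((continuous_maj (latPt j j n)).measurable.const_mul (2 * Real.pi))

lemma abs_thetaFreq_le (j : ℤ) (a : (ℤ × ℤ) × ℝ) : |thetaFreq j a| ≤ thetaDecay j a := by
  rw [thetaFreq, thetaDecay, abs_mul, abs_of_pos (by positivity : 0 < 2 * Real.pi)]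
  exact mul_le_mul_of_nonneg_left (abs_Q_le_maj _ _) (by positivity)

lemma expDecay_theta (j : ℤ) : ExpDecay thetaMeasure (thetaDecay j) fun _ => 1 := by
  refine ⟨aestronglyMeasurable_const, fun y hy => ?_⟩
  have hm := measurable_thetaDecay j
  have hmeas : Measurable fun a => ‖(1 : ℂ)‖ * Real.exp (-(y * thetaDecay j a)) := by fun_prop
  have hcont : ∀ n : ℤ × ℤ,
      Continuous fun t => ‖(1 : ℂ)‖ * Real.exp (-(y * thetaDecay j (n, t))) := fun n => by
    have := continuous_maj (latPt j j n)
    change Continuous fun t => ‖(1 : ℂ)‖ * Real.exp (-(y * (2 * Real.pi * maj t (latPt j j n))))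
    fun_prop
  rw [thetaMeasure, integrable_prod_iff hmeas.aestronglyMeasurable]
  refine ⟨Filter.Eventually.of_forall fun n =>
    ((hcont n).integrableOn_Icc (a := param c₁) (b := param c₂)).mono_set Set.Ioc_subset_Icc_self, ?_⟩
  rw [integrable_count_iff]
  obtain ⟨w, hw, h⟩ := exists_kern_bound (param c₁) (param c₂) hy one_ne_zero one_ne_zero
    ((j : ℝ) / 2) ((j : ℝ) / 6)
  refine Summable.of_nonneg_of_le (fun _ => norm_nonneg _) (fun n => ?_)
    (hw.mul_right |param c₂ - param c₁|)
  rw [← intervalIntegral.integral_of_le param_c₁_lt.le]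
  refine intervalIntegral.norm_integral_le_of_norm_le_const fun t ht => ?_
  rw [Set.uIoc_of_le param_c₁_lt.le] at ht
  have h' := h n t (Set.Ioc_subset_Icc_self ht) (y * Complex.I) (by simp)
  rw [← latPt_eq, norm_kern] at h'
  rw [norm_norm, norm_one, one_mul, Real.norm_of_nonneg (Real.exp_pos _).le, thetaDecay]
  refine le_of_eq_of_le ?_ h'
  congr 2
  simp
  ring

lemma integrable_theta {j : ℤ} {g : (ℤ × ℤ) × ℝ → ℂ} (hg : ExpDecay thetaMeasure (thetaDecay j) g)
    {z : ℂ} (hz : 0 < z.im) :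
    Integrable (fun a => g a * kern a.2 z (latPt j j a.1)) thetaMeasure :=
  hg.integrable (measurable_thetaFreq j) (measurable_thetaDecay j) hz

lemma expInt_theta {j : ℤ} {g : (ℤ × ℤ) × ℝ → ℂ} (hg : ExpDecay thetaMeasure (thetaDecay j) g)
    {z : ℂ} (hz : 0 < z.im) : expInt thetaMeasure (thetaFreq j) (thetaDecay j) g z =
      ∑' n : ℤ × ℤ, ∫ t in (param c₁)..(param c₂), g (n, t) * kern t z (latPt j j n) := by
  have h := integrable_theta hg hz
  change ∫ a, g a * kern a.2 z (latPt j j a.1) ∂thetaMeasure = _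
  rw [thetaMeasure] at h ⊢
  rw [integral_prod _ h, integral_countable h.integral_prod_left]
  simp [intervalIntegral.integral_of_le param_c₁_lt.le]

lemma thetaVec_ofComplex (j : Fin 4) {z : ℂ} (hz : 0 < z.im) :
    ((fun τ => thetaVec τ j) ∘ ofComplex) z = (Real.sqrt z.im : ℂ) *
      expInt thetaMeasure (thetaFreq (j : ℕ)) (thetaDecay (j : ℕ)) (fun _ => 1) z := by
  rw [expInt_theta (expDecay_theta _) hz, Function.comp_apply, ofComplex_apply_of_im_pos hz,
    thetaVec, cosetForm]
  simp only [one_mul]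
  rfl

lemma contDiffOn_thetaVec (j : Fin 4) :
    ContDiffOn ℝ ∞ ((fun τ => thetaVec τ j) ∘ ofComplex) {z : ℂ | 0 < z.im} := by
  refine ContDiffOn.congr ?_ fun z hz => thetaVec_ofComplex j hz
  rw [contDiffOn_infty]
  intro n
  refine ContDiffOn.mul ?_ (contDiffOn_expInt (expDecay_theta _) (measurable_thetaFreq _)
    (measurable_thetaDecay _) (abs_thetaFreq_le _) n)
  refine Complex.ofRealCLM.contDiff.comp_contDiffOn ?_
  exact ContDiffOn.sqrt Complex.imCLM.contDiff.contDiffOn fun z hz => ne_of_gt hz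

/-- The `t`-derivative of the kernel. -/
def kernDeriv (t : ℝ) (z : ℂ) (v : ℝ × ℝ) : ℂ :=
  ((-(2 * Real.pi * z.im) * (B v (cVec t) * B v (cPerpVec t)) : ℝ) : ℂ) * kern t z v

lemma hasDerivAt_kern (t : ℝ) (z : ℂ) (v : ℝ × ℝ) :
    HasDerivAt (fun t => kern t z v) (kernDeriv t z v) t := by
  have h := ((hasDerivAt_maj v t).const_mul (2 * Real.pi)).mul_const z.im
  have h' := ((h.ofReal_comp).const_sub
    (((2 * Real.pi * Q v * z.re : ℝ) : ℂ) * Complex.I)).cexp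
  refine h'.congr_deriv ?_
  rw [kernDeriv, kern]
  push_cast
  ring

/-- With `b = B v c(t)` and `b' = B v c^⊥(t)`, the identities `b² + b'² = 4 maj` and `(b b')² = 4
(maj² - Q²)` make the second `t`-derivative equal to `4y²` times the weight `v² - u² - v/y` of
`laplacian_sqrt_mul_expInt`. -/
lemma hasDerivAt_kernDeriv (t : ℝ) {z : ℂ} (hz : 0 < z.im) (v : ℝ × ℝ) :
    HasDerivAt (fun t => kernDeriv t z v) ((4 * z.im ^ 2 *
      ((2 * Real.pi * maj t v) ^ 2 - (2 * Real.pi * Q v) ^ 2 - 2 * Real.pi * maj t v / z.im) : ℝ) *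
        kern t z v) t := by
  have h1 := (((hasDerivAt_B_cVec v t).fun_mul (hasDerivAt_B_cPerpVec v t)).const_mul
    (-(2 * Real.pi * z.im))).ofReal_comp
  refine (h1.mul (hasDerivAt_kern t z v)).congr_deriv ?_
  rw [kernDeriv, ← mul_assoc, ← add_mul, ← Complex.ofReal_mul, ← Complex.ofReal_add]
  congr 2
  have h := B_sq_sub_B_sq v t
  rw [show Q v = (B v (cPerpVec t) ^ 2 - B v (cVec t) ^ 2) / 4 by linarith, maj]
  field_simp
  ring

lemma continuous_kernDeriv_deriv (z : ℂ) (v : ℝ × ℝ) : Continuous fun t => ((4 * z.im ^ 2 *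
    ((2 * Real.pi * maj t v) ^ 2 - (2 * Real.pi * Q v) ^ 2 - 2 * Real.pi * maj t v / z.im) : ℝ) *
      kern t z v) := by
  have h1 := continuous_maj v
  have h2 := continuous_kern z v
  fun_prop

lemma summable_kernDeriv (t : ℝ) {z : ℂ} (hz : 0 < z.im) (j : ℤ) :
    Summable fun n : ℤ × ℤ => kernDeriv t z (latPt j j n) := by
  -- The comparison kernel lives at half the height; the spare decay absorbs the factor `|B v c · B
  -- v c^⊥| ≤ 2 maj`.
  have hz2 : 0 < ((z.im / 2 : ℝ) * Complex.I).im := by simp [hz]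
  refine Summable.of_norm_bounded ((summable_norm_kern t hz2 1 1 ((j : ℝ) / 2) ((j : ℝ) / 6)
    one_ne_zero one_ne_zero).mul_left 4) fun n => ?_
  rw [← latPt_eq]
  generalize latPt j j n = v
  rw [kernDeriv, norm_mul, norm_kern, norm_kern, Complex.norm_real, Real.norm_eq_abs, abs_mul,
    abs_neg, abs_of_pos (by positivity : 0 < 2 * Real.pi * z.im)]
  have him : ((z.im / 2 : ℝ) * Complex.I).im = z.im / 2 := by simp
  rw [him]
  have h1 : |B v (cVec t) * B v (cPerpVec t)| ≤ 2 * maj t v := by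
    rw [maj, abs_le]
    constructor <;>
      nlinarith [sq_nonneg (B v (cVec t) + B v (cPerpVec t)),
        sq_nonneg (B v (cVec t) - B v (cPerpVec t))]
  have h2 := Real.add_one_le_exp (Real.pi * maj t v * z.im)
  calc 2 * Real.pi * z.im * |B v (cVec t) * B v (cPerpVec t)| *
        Real.exp (-(2 * Real.pi * maj t v * z.im))
      ≤ 2 * Real.pi * z.im * (2 * maj t v) * Real.exp (-(2 * Real.pi * maj t v * z.im)) := by gcongr
    _ = 4 * (Real.pi * maj t v * z.im) * Real.exp (-(2 * Real.pi * maj t v * z.im)) := by ring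
    _ ≤ 4 * Real.exp (Real.pi * maj t v * z.im) * Real.exp (-(2 * Real.pi * maj t v * z.im)) := by
        gcongr; linarith
    _ = 4 * Real.exp (-(2 * Real.pi * maj t v * (z.im / 2))) := by
        rw [mul_assoc, ← Real.exp_add]; congr 2; ring

lemma maj_unitEquiv (j : ℤ) (n : ℤ × ℤ) :
    maj (param c₂) (latPt j j (unitEquiv j n)) = maj (param c₁) (latPt j j n) := by
  have h1 := B_cVec_unitEquiv j n 0
  have h2 := B_cPerpVec_unitEquiv j n 0
  rw [add_zero, add_zero] at h1 h2
  rw [maj, maj, h1, h2, neg_sq, neg_sq]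

lemma kernDeriv_unitEquiv (j : ℤ) (n : ℤ × ℤ) (z : ℂ) :
    kernDeriv (param c₂) z (latPt j j (unitEquiv j n)) = kernDeriv (param c₁) z (latPt j j n) := by
  have h1 := B_cVec_unitEquiv j n 0
  have h2 := B_cPerpVec_unitEquiv j n 0
  rw [add_zero, add_zero] at h1 h2
  rw [kernDeriv, kernDeriv, h1, h2, neg_mul_neg, kern, kern, Q_unitEquiv, maj_unitEquiv]

/-- The weight times the kernel is a total `t`-derivative, so only `kernDeriv` at the two endpoints
remains; `unitEquiv` matches the two lattice sums. -/
lemma expInt_theta_eigen (j : ℤ) {z : ℂ} (hz : 0 < z.im) :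
    expInt thetaMeasure (thetaFreq j) (thetaDecay j) (fun a =>
      (thetaDecay j a ^ 2 - thetaFreq j a ^ 2 - thetaDecay j a / z.im : ℝ) * 1) z = 0 := by
  have hv := measurable_thetaDecay j
  have hu := measurable_thetaFreq j
  have h0 := expDecay_theta j
  have hle := abs_thetaFreq_le j
  have hg : ExpDecay thetaMeasure (thetaDecay j) fun a =>
      (thetaDecay j a ^ 2 - thetaFreq j a ^ 2 - thetaDecay j a / z.im : ℝ) * 1 := by
    have h2 := h0.neg_mul hv hle
    have h22 := h2.neg_mul hv hle
    have h11 := (h0.mul_I_mul hu hv hle).mul_I_mul hu hv hle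
    have h := (h22.add h11 hv).add (h2.const_mul (1 / (z.im : ℂ))) hv
    convert h using 2 with a
    push_cast
    linear_combination -(thetaFreq j a : ℂ) ^ 2 * Complex.I_sq
  rw [expInt_theta hg hz]
  have hz' : (z.im : ℂ) ≠ 0 := by exact_mod_cast hz.ne'
  have hint : ∀ n : ℤ × ℤ, ∫ t in (param c₁)..(param c₂),
      ((thetaDecay j (n, t) ^ 2 - thetaFreq j (n, t) ^ 2 - thetaDecay j (n, t) / z.im : ℝ) * 1) *
        kern t z (latPt j j n) = 1 / (4 * z.im ^ 2) *
      (kernDeriv (param c₂) z (latPt j j n) - kernDeriv (param c₁) z (latPt j j n)) := by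
    intro n
    rw [← intervalIntegral.integral_eq_sub_of_hasDerivAt
      (fun t _ => hasDerivAt_kernDeriv t hz (latPt j j n))
      ((continuous_kernDeriv_deriv z _).intervalIntegrable _ _),
      ← intervalIntegral.integral_const_mul]
    congr 1
    funext t
    rw [thetaDecay, thetaFreq]
    push_cast
    field_simp
  simp only [hint]
  rw [tsum_mul_left, Summable.tsum_sub (summable_kernDeriv _ hz j) (summable_kernDeriv _ hz j),
    ← (unitEquiv j).tsum_eq]
  simp only [kernDeriv_unitEquiv, sub_self, mul_zero]

lemma hypLaplacian_thetaVec (j : Fin 4) (τ : ℍ) :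
    hypLaplacian (fun τ => thetaVec τ j) τ = 1 / 4 * thetaVec τ j := by
  have hz : 0 < (τ : ℂ).im := τ.im_pos
  have h : ((fun τ => thetaVec τ j) ∘ ofComplex) =ᶠ[nhds (τ : ℂ)] fun z =>
      (Real.sqrt z.im : ℂ) *
        expInt thetaMeasure (thetaFreq (j : ℕ)) (thetaDecay (j : ℕ)) (fun _ => 1) z :=
    Filter.eventually_of_mem (isOpen_im_pos.mem_nhds hz) fun z hz => thetaVec_ofComplex j hz
  have h' := thetaVec_ofComplex j hz
  rw [Function.comp_apply, ofComplex_apply] at h'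
  rw [hypLaplacian, (InnerProductSpace.laplacian_congr_nhds h).eq_of_nhds,
    laplacian_sqrt_mul_expInt (expDecay_theta _) (measurable_thetaFreq _)
    (measurable_thetaDecay _) (abs_thetaFreq_le _) hz, expInt_theta_eigen _ hz, h']
  have hz' : ((τ : ℂ).im : ℂ) ≠ 0 := by exact_mod_cast hz.ne'
  rw [coe_im] at hz' ⊢
  field_simp
  ring

end

noncomputable section

/-! ### Incomplete Bessel integrals -/

open MeasureTheory

lemma one_add_sq_le_cosh (x : ℝ) : 1 + x ^ 2 / 2 ≤ Real.cosh x := by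
  have h : (x / 2) ^ 2 ≤ Real.sinh (x / 2) ^ 2 := by
    rcases le_total 0 (x / 2) with h | h
    · exact pow_le_pow_left₀ h (Real.self_le_sinh_iff.2 h) 2
    · nlinarith [Real.sinh_le_self_iff.2 h]
  have h2 := Real.cosh_two_mul (x / 2)
  rw [Real.cosh_sq, mul_div_cancel₀ x two_ne_zero] at h2
  linarith

lemma exp_cosh_le {X : ℝ} (hX : 0 ≤ X) (x : ℝ) :
    Real.exp (-X * Real.cosh x) ≤ Real.exp (-X) * Real.exp (-(X / 2) * x ^ 2) := by
  rw [← Real.exp_add, Real.exp_le_exp]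
  nlinarith [one_add_sq_le_cosh x]

lemma integrable_exp_cosh {X : ℝ} (hX : 0 < X) : Integrable fun x => Real.exp (-X * Real.cosh x) :=
  ((integrable_exp_neg_mul_sq (half_pos hX)).const_mul (Real.exp (-X))).mono'
    (by fun_prop) (Filter.Eventually.of_forall fun x => by
      rw [Real.norm_of_nonneg (Real.exp_pos _).le]; exact exp_cosh_le hX.le x)

lemma integrable_exp_cosh_two_mul {X : ℝ} (hX : 0 < X) :
    Integrable fun x => Real.exp (-X * Real.cosh (2 * x)) :=
  (integrable_exp_cosh hX).comp_mul_left' two_ne_zero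

lemma besselK0_nonneg (X : ℝ) : 0 ≤ besselK0 X :=
  integral_nonneg fun _ => (Real.exp_pos _).le

/-- Gaussian comparison through `cosh x ≥ 1 + x²/2`. The lower bound `x₀` makes the prefactor
uniform, away from the singularity of `K₀` at zero. -/
lemma besselK0_le {x₀ X : ℝ} (hx₀ : 0 < x₀) (hX : x₀ ≤ X) :
    besselK0 X ≤ Real.sqrt (2 * Real.pi / x₀) * Real.exp (-X) := by
  have hX0 : 0 < X := hx₀.trans_le hX
  calc besselK0 X ≤ ∫ x in Set.Ioi (0 : ℝ), Real.exp (-X) * Real.exp (-(X / 2) * x ^ 2) :=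
        integral_mono (integrable_exp_cosh hX0).integrableOn
          ((integrable_exp_neg_mul_sq (half_pos hX0)).const_mul _).integrableOn
          fun x => exp_cosh_le hX0.le x
    _ = Real.exp (-X) * (Real.sqrt (Real.pi / (X / 2)) / 2) := by
        rw [integral_const_mul, integral_gaussian_Ioi]
    _ ≤ Real.exp (-X) * (Real.sqrt (2 * Real.pi / x₀) / 1) := by
        rw [div_div_eq_mul_div, mul_comm Real.pi]
        gcongr
        norm_num
    _ = _ := by ring

/-- `∫₀ᵘ exp (-X cosh 2s) ds`. -/
def coshInt (X u : ℝ) : ℝ := ∫ s in (0 : ℝ)..u, Real.exp (-X * Real.cosh (2 * s))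

lemma integral_Ioi_zero_exp_cosh (X : ℝ) :
    ∫ s in Set.Ioi (0 : ℝ), Real.exp (-X * Real.cosh (2 * s)) = besselK0 X / 2 := by
  have h := integral_comp_mul_left_Ioi (fun t => Real.exp (-X * Real.cosh t)) 0 two_pos
  rw [h, mul_zero, smul_eq_mul, besselK0]
  ring

lemma integral_Ioi_exp_cosh {X : ℝ} (hX : 0 < X) (u : ℝ) :
    ∫ s in Set.Ioi u, Real.exp (-X * Real.cosh (2 * s)) = besselK0 X / 2 - coshInt X u := by
  have h := intervalIntegral.integral_interval_add_Ioi
    (integrable_exp_cosh_two_mul hX).integrableOn (a := 0) (b := u)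
    (integrable_exp_cosh_two_mul hX).integrableOn
  rw [integral_Ioi_zero_exp_cosh] at h
  rw [coshInt]; linarith

lemma coshInt_neg (X u : ℝ) : coshInt X (-u) = -coshInt X u := by
  have h := intervalIntegral.integral_comp_neg (a := 0) (b := u)
    fun s => Real.exp (-X * Real.cosh (2 * s))
  simp only [mul_neg, Real.cosh_neg, neg_zero] at h
  rw [coshInt, coshInt, intervalIntegral.integral_symm, ← h]

lemma integral_Iic_eq_Ioi (X u : ℝ) :
    ∫ s in Set.Iic u, Real.exp (-X * Real.cosh (2 * s)) =
      ∫ s in Set.Ioi (-u), Real.exp (-X * Real.cosh (2 * s)) := by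
  rw [← integral_comp_neg_Iic]
  simp only [mul_neg, Real.cosh_neg]

/-- After a shift by `u`, the addition theorem gives `cosh 2(s + u) ≥ cosh 2s · cosh 2u` for `s, u ≥
0`. -/
lemma integral_Ioi_exp_cosh_le {X u : ℝ} (hX : 0 < X) (hu : 0 ≤ u) :
    ∫ s in Set.Ioi u, Real.exp (-X * Real.cosh (2 * s)) ≤ besselK0 (X * Real.cosh (2 * u)) := by
  have h1 : ∫ s in Set.Ioi u, Real.exp (-X * Real.cosh (2 * s)) =
      ∫ s in Set.Ioi (0 : ℝ), Real.exp (-X * Real.cosh (2 * (s + u))) := by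
    have := (measurePreserving_add_right volume u).setIntegral_preimage_emb
      (measurableEmbedding_addRight u) (fun s => Real.exp (-X * Real.cosh (2 * s))) (Set.Ioi u)
    rw [← this, Set.preimage_add_const_Ioi, sub_self]
  have hX' : 0 < X * Real.cosh (2 * u) := mul_pos hX (Real.cosh_pos _)
  have hK := besselK0_nonneg (X * Real.cosh (2 * u))
  have h2 := integral_Ioi_zero_exp_cosh (X * Real.cosh (2 * u))
  rw [h1]
  refine (setIntegral_mono_on ?_ (integrable_exp_cosh_two_mul hX').integrableOn
    measurableSet_Ioi fun s hs => ?_).trans (h2.trans_le (by linarith))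
  · exact ((integrable_exp_cosh_two_mul hX).comp_add_right u).integrableOn
  · rw [Real.exp_le_exp, mul_add, Real.cosh_add]
    have h3 : 0 ≤ Real.sinh (2 * s) := Real.sinh_nonneg_iff.2 (by linarith [Set.mem_Ioi.1 hs])
    have h4 : 0 ≤ Real.sinh (2 * u) := Real.sinh_nonneg_iff.2 (by linarith)
    nlinarith [mul_nonneg hX.le (mul_nonneg h3 h4)]

lemma setIntegral_Ioi_sub (f : ℝ → ℝ) (u s : ℝ) :
    ∫ t in Set.Ioi u, f (t - s) = ∫ t in Set.Ioi (u - s), f t := by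
  rw [← (measurePreserving_sub_right volume s).setIntegral_preimage_emb
      (measurableEmbedding_subRight s) f (Set.Ioi (u - s)), Set.preimage_sub_const_Ioi,
    sub_add_cancel]

lemma setIntegral_Iic_sub (f : ℝ → ℝ) (u s : ℝ) :
    ∫ t in Set.Iic u, f (t - s) = ∫ t in Set.Iic (u - s), f t := by
  rw [← (measurePreserving_sub_right volume s).setIntegral_preimage_emb
      (measurableEmbedding_subRight s) f (Set.Iic (u - s)), Set.preimage_sub_const_Iic,
    sub_add_cancel]

/-! ### The signed distance to the axis of a vector -/

/-- The values `B v c(t)` and `B v c^⊥(t)` vary like a hyperbolic sine and cosine around `s`, in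
the order given by the sign of `Q v`. -/
structure IsAxis (v : ℝ × ℝ) (s a : ℝ) : Prop where
  sq_eq : a ^ 2 = 4 * |Q v|
  cases : (0 < Q v ∧ ∀ t, B v (cVec t) = a * Real.sinh (t - s) ∧
      B v (cPerpVec t) = a * Real.cosh (t - s)) ∨
    (Q v < 0 ∧ ∀ t, B v (cVec t) = a * Real.cosh (t - s) ∧
      B v (cPerpVec t) = a * Real.sinh (t - s))

lemma exists_sinh_eq_cosh {x y : ℝ} (h : y ^ 2 < x ^ 2) :
    ∃ s, x * Real.sinh s = y * Real.cosh s := by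
  have hx : x ≠ 0 := by rintro rfl; nlinarith
  have h' : |y / x| < 1 := by
    rw [abs_div, div_lt_one (abs_pos.2 hx)]
    exact sq_lt_sq.1 h
  refine ⟨Real.artanh (y / x), ?_⟩
  have h2 := Real.tanh_artanh (abs_lt.1 h')
  rw [Real.tanh_eq_sinh_div_cosh, div_eq_div_iff (Real.cosh_pos _).ne' hx] at h2
  linarith

/-- The sign of `Q v` decides which of `B v c(t)` and `B v c^⊥(t)` vanishes at some `s`; the
addition theorems then give both functions for all `t`. -/
lemma exists_isAxis {v : ℝ × ℝ} (h : Q v ≠ 0) : ∃ s a, IsAxis v s a := by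
  have hsq : (Real.sqrt 3 * v.1) ^ 2 = 3 * v.1 ^ 2 := by rw [mul_pow, sqrt_three_sq]
  rcases lt_or_gt_of_ne h with h | h
  · obtain ⟨s, hs⟩ := exists_sinh_eq_cosh (x := v.2) (y := Real.sqrt 3 * v.1)
      (by rw [hsq]; rw [Q] at h; linarith)
    have h0 : B v (cPerpVec s) = 0 := by rw [B_cPerpVec]; rw [← hs]; ring
    have h1 := B_sq_sub_B_sq v s
    refine ⟨s, B v (cVec s), ?_, Or.inr ⟨h, fun t => ?_⟩⟩
    · rw [abs_of_neg h]; rw [h0] at h1; linarith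
    · have e1 := B_cVec_add v s (t - s)
      have e2 := B_cPerpVec_add v s (t - s)
      rw [add_sub_cancel, h0] at e1 e2
      exact ⟨by rw [e1]; ring, by rw [e2]; ring⟩
  · obtain ⟨s, hs⟩ := exists_sinh_eq_cosh (x := Real.sqrt 3 * v.1) (y := v.2)
      (by rw [hsq]; rw [Q] at h; linarith)
    have h0 : B v (cVec s) = 0 := by rw [B_cVec]; rw [hs]; ring
    have h1 := B_sq_sub_B_sq v s
    refine ⟨s, B v (cPerpVec s), ?_, Or.inl ⟨h, fun t => ?_⟩⟩
    · rw [abs_of_pos h]; rw [h0] at h1; linarith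
    · have e1 := B_cVec_add v s (t - s)
      have e2 := B_cPerpVec_add v s (t - s)
      rw [add_sub_cancel, h0] at e1 e2
      exact ⟨by rw [e1]; ring, by rw [e2]; ring⟩

variable {v : ℝ × ℝ} {s a : ℝ}

lemma IsAxis.Q_ne_zero (h : IsAxis v s a) : Q v ≠ 0 := by
  rcases h.cases with ⟨h, -⟩ | ⟨h, -⟩
  · exact h.ne'
  · exact h.ne

lemma IsAxis.ne_zero (h : IsAxis v s a) : a ≠ 0 := by
  have := abs_pos.2 h.Q_ne_zero
  have h2 := h.sq_eq
  rintro rfl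
  linarith

lemma IsAxis.maj_eq (h : IsAxis v s a) (t : ℝ) : maj t v = |Q v| * Real.cosh (2 * (t - s)) := by
  have h2 := h.sq_eq
  rw [maj, Real.cosh_two_mul]
  rcases h.cases with ⟨-, h⟩ | ⟨-, h⟩ <;> rw [(h t).1, (h t).2] <;>
    linear_combination (Real.cosh (t - s) ^ 2 + Real.sinh (t - s) ^ 2) / 4 * h2

lemma IsAxis.B_mul_B (h : IsAxis v s a) (t : ℝ) : B v (cVec t) * B v (cPerpVec t) =
    a ^ 2 * Real.cosh (t - s) * Real.sinh (t - s) := by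
  rcases h.cases with ⟨-, h⟩ | ⟨-, h⟩ <;> rw [(h t).1, (h t).2] <;> ring

lemma IsAxis.kern_eq (h : IsAxis v s a) (t : ℝ) (τ : ℍ) : kern t τ v =
    Complex.exp (2 * Real.pi * Complex.I * (Q v : ℂ) * (τ.re : ℂ)) *
      (Real.exp (-(2 * Real.pi * |Q v| * τ.im) * Real.cosh (2 * (t - s))) : ℝ) := by
  rw [kern, h.maj_eq, Complex.ofReal_exp, ← Complex.exp_add]
  congr 1
  rw [coe_re, coe_im]
  push_cast
  ring

/-! ### Termwise evaluation -/

/-- The summand of `φ_μ^{[c]}` at the vector `v`. -/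
def shadowVal (c : ℝ × ℝ) (τ : ℍ) (v : ℝ × ℝ) : ℂ :=
  (shadowCoeff c (Real.sqrt τ.im • v) : ℂ) * qQ v τ

lemma B_smul (r : ℝ) (v w : ℝ × ℝ) : B (r • v) w = r * B v w := by
  simp [B]; ring

lemma IsAxis.sub_pos_iff (h : IsAxis v s a) (t : ℝ) :
    0 < B v (cVec t) * B v (cPerpVec t) ↔ s < t := by
  have := h.ne_zero
  rw [h.B_mul_B, mul_pos_iff_of_pos_left (mul_pos (by positivity) (Real.cosh_pos _)), Real.sinh_pos_iff, sub_pos]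

lemma IsAxis.sub_neg_iff (h : IsAxis v s a) (t : ℝ) :
    B v (cVec t) * B v (cPerpVec t) < 0 ↔ t < s := by
  have := h.ne_zero
  rw [h.B_mul_B, ← neg_pos, ← mul_neg, mul_pos_iff_of_pos_left
    (mul_pos (by positivity) (Real.cosh_pos _)), neg_pos, Real.sinh_neg_iff, sub_neg]

/-- The sign test in `shadowCoeff` selects the tail on the side of `param c` away from the axis, and
the decay in `qQ` turns `B²` into the majorant. The tail is half of `K₀` minus an incomplete
integral, up to sign. -/
lemma IsAxis.shadowVal_eq (h : IsAxis v s a) {c : ℝ × ℝ} (hc : c ∈ CQ) (τ : ℍ) :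
    shadowVal c τ v = Complex.exp (2 * Real.pi * Complex.I * (Q v : ℂ) * (τ.re : ℂ)) *
      ((Real.sign (param c - s) * (besselK0 (2 * Real.pi * |Q v| * τ.im) / 2) -
        coshInt (2 * Real.pi * |Q v| * τ.im) (param c - s) : ℝ) : ℂ) := by
  have hy := τ.im_pos
  have hX : 0 < 2 * Real.pi * |Q v| * τ.im := by
    have := abs_pos.2 h.Q_ne_zero
    positivity
  have hq : qQ v τ = Complex.exp (2 * Real.pi * Complex.I * (Q v : ℂ) * (τ.re : ℂ)) *
      (Real.exp (-2 * Real.pi * Q v * τ.im) : ℝ) := by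
    rw [qQ, Complex.ofReal_exp, ← Complex.exp_add]
    congr 1
    have e : (τ : ℂ) = τ.re + τ.im * Complex.I := (Complex.re_add_im _).symm
    rw [e]
    push_cast
    linear_combination 2 * Real.pi * (Q v : ℂ) * τ.im * Complex.I_sq
  have hf : ∀ t, Real.exp (-2 * Real.pi * Q v * τ.im) *
      Real.exp (-Real.pi * B (Real.sqrt τ.im • v) (cVec t) ^ 2) =
        Real.exp (-(2 * Real.pi * |Q v| * τ.im) * Real.cosh (2 * (t - s))) := fun t => by
    rw [← Real.exp_add, B_smul, mul_pow, Real.sq_sqrt hy.le]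
    congr 1
    have h1 := h.maj_eq t
    rw [MockMaass.maj_eq] at h1
    linear_combination -2 * Real.pi * τ.im * h1
  have hB : B (Real.sqrt τ.im • v) c * B (Real.sqrt τ.im • v) (perp c) =
      τ.im * (B v (cVec (param c)) * B v (cPerpVec (param c))) := by
    rw [cVec_param hc, B_smul, B_smul, perp]
    linear_combination B v c * B v (cPerpVec (param c)) * Real.sq_sqrt hy.le
  have key : Real.exp (-2 * Real.pi * Q v * τ.im) * shadowCoeff c (Real.sqrt τ.im • v) =
      Real.sign (param c - s) * (besselK0 (2 * Real.pi * |Q v| * τ.im) / 2) -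
        coshInt (2 * Real.pi * |Q v| * τ.im) (param c - s) := by
    have hp : 0 < τ.im * (B v (cVec (param c)) * B v (cPerpVec (param c))) ↔ s < param c := by
      rw [mul_pos_iff_of_pos_left hy, h.sub_pos_iff]
    have hn : τ.im * (B v (cVec (param c)) * B v (cPerpVec (param c))) < 0 ↔ param c < s := by
      rw [← neg_pos, ← mul_neg, mul_pos_iff_of_pos_left hy, neg_pos, h.sub_neg_iff]
    simp only [shadowCoeff, hB, hp, hn]
    rcases lt_trichotomy s (param c) with h1 | h1 | h1
    · rw [if_pos h1, Real.sign_of_pos (sub_pos.2 h1), one_mul, ← integral_const_mul]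
      simp only [hf]
      rw [setIntegral_Ioi_sub fun t =>
        Real.exp (-(2 * Real.pi * |Q v| * τ.im) * Real.cosh (2 * t)), integral_Ioi_exp_cosh hX]
    · rw [if_neg (by simp [h1]), if_neg (by simp [h1]), h1]
      simp [coshInt]
    · rw [if_neg h1.not_gt, if_pos h1, Real.sign_of_neg (sub_neg.2 h1), mul_neg,
        ← integral_const_mul]
      simp only [hf]
      rw [setIntegral_Iic_sub fun t =>
        Real.exp (-(2 * Real.pi * |Q v| * τ.im) * Real.cosh (2 * t)), integral_Iic_eq_Ioi,
        integral_Ioi_exp_cosh hX, coshInt_neg]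
      ring
  rw [shadowVal, hq, ← key]
  push_cast
  ring

lemma IsAxis.norm_shadowVal_le (h : IsAxis v s a) {c : ℝ × ℝ} (hc : c ∈ CQ) (τ : ℍ) :
    ‖shadowVal c τ v‖ ≤ besselK0 (2 * Real.pi * maj (param c) v * τ.im) := by
  have hX : 0 < 2 * Real.pi * |Q v| * τ.im := by
    have := abs_pos.2 h.Q_ne_zero
    have := τ.im_pos
    positivity
  have hexp : ‖Complex.exp (2 * Real.pi * Complex.I * (Q v : ℂ) * (τ.re : ℂ))‖ = 1 := by
    rw [Complex.norm_exp]; simp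
  have hm : 2 * Real.pi * maj (param c) v * τ.im =
      2 * Real.pi * |Q v| * τ.im * Real.cosh (2 * (param c - s)) := by rw [h.maj_eq]; ring
  rw [h.shadowVal_eq hc, norm_mul, hexp, one_mul, Complex.norm_real, Real.norm_eq_abs, hm]
  generalize 2 * Real.pi * |Q v| * τ.im = X at *
  generalize param c - s = u
  have hpos : ∀ u : ℝ, 0 ≤ u → |besselK0 X / 2 - coshInt X u| ≤ besselK0 (X * Real.cosh (2 * u)) :=
    fun u hu => by
      rw [← integral_Ioi_exp_cosh hX, abs_of_nonneg (integral_nonneg fun _ => (Real.exp_pos _).le)]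
      exact integral_Ioi_exp_cosh_le hX hu
  rcases lt_trichotomy 0 u with hu | hu | hu
  · rw [Real.sign_of_pos hu, one_mul]
    exact hpos u hu.le
  · rw [← hu]
    simpa [coshInt] using besselK0_nonneg X
  · rw [Real.sign_of_neg hu, ← abs_neg, ← Real.cosh_neg]
    have := hpos (-u) (by linarith)
    rw [coshInt_neg] at this
    convert this using 2
    · ring
    · ring_nf

/-! ### Sign factors and the summands of `Θ_μ` -/

lemma sign_mul (x y : ℝ) : Real.sign (x * y) = Real.sign x * Real.sign y := by
  rcases lt_trichotomy x 0 with hx | hx | hx <;> rcases lt_trichotomy y 0 with hy | hy | hy <;>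
    simp [hx, hy, Real.sign_of_pos, Real.sign_of_neg, mul_pos_of_neg_of_neg,
      mul_neg_of_neg_of_pos, mul_neg_of_pos_of_neg]

lemma sign_sinh (x : ℝ) : Real.sign (Real.sinh x) = Real.sign x := by
  rcases lt_trichotomy x 0 with hx | hx | hx
  · rw [Real.sign_of_neg hx, Real.sign_of_neg (Real.sinh_neg_iff.2 hx)]
  · simp [hx]
  · rw [Real.sign_of_pos hx, Real.sign_of_pos (Real.sinh_pos_iff.2 hx)]

lemma sign_mul_self {x : ℝ} (hx : x ≠ 0) : Real.sign x * Real.sign x = 1 := by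
  rcases Real.sign_apply_eq_of_ne_zero x hx with h | h <;> rw [h] <;> norm_num

lemma one_sub_sign_mul_sign {x y : ℝ} (h : x < y) :
    1 - Real.sign x * Real.sign y = Real.sign y - Real.sign x := by
  rcases lt_trichotomy x 0 with hx | hx | hx
  · rw [Real.sign_of_neg hx]; ring
  · rw [hx] at h ⊢
    rw [Real.sign_of_pos h, Real.sign_zero]; ring
  · rw [Real.sign_of_pos hx, Real.sign_of_pos (hx.trans h)]; ring

/-- The sign factor of the first series in `Θ_μ`. -/
def posWeight (v : ℝ × ℝ) : ℝ := 1 - Real.sign (B v c₁) * Real.sign (B v c₂)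

/-- The sign factor of the second series in `Θ_μ`. -/
def negWeight (v : ℝ × ℝ) : ℝ := 1 - Real.sign (B v (perp c₁)) * Real.sign (B v (perp c₂))

/-- The `cosh`-type values keep one sign, so the weight of the wrong type vanishes; in the other,
`sign a` enters squared and drops out. -/
lemma IsAxis.weight_eq (h : IsAxis v s a) :
    (0 < Q v ∧ posWeight v = Real.sign (param c₂ - s) - Real.sign (param c₁ - s) ∧
      negWeight v = 0) ∨
    (Q v < 0 ∧ negWeight v = Real.sign (param c₂ - s) - Real.sign (param c₁ - s) ∧
      posWeight v = 0) := by
  have hlt : param c₁ - s < param c₂ - s := by linarith [param_c₁_lt]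
  have ha := sign_mul_self h.ne_zero
  have hcosh : ∀ x, Real.sign (Real.cosh x) = 1 := fun x => Real.sign_of_pos (Real.cosh_pos x)
  have h1 : B v c₁ = B v (cVec (param c₁)) := by rw [cVec_param c₁_mem]
  have h2 : B v c₂ = B v (cVec (param c₂)) := by rw [cVec_param c₂_mem]
  rw [posWeight, negWeight, perp, perp, h1, h2, ← one_sub_sign_mul_sign hlt]
  rcases h.cases with ⟨hQ, h⟩ | ⟨hQ, h⟩
  · refine Or.inl ⟨hQ, ?_, ?_⟩
    · rw [(h _).1, (h _).1, sign_mul, sign_mul, sign_sinh, sign_sinh]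
      linear_combination -Real.sign (param c₁ - s) * Real.sign (param c₂ - s) * ha
    · rw [(h _).2, (h _).2, sign_mul, sign_mul, hcosh, hcosh]
      linear_combination -ha
  · refine Or.inr ⟨hQ, ?_, ?_⟩
    · rw [(h _).2, (h _).2, sign_mul, sign_mul, sign_sinh, sign_sinh]
      linear_combination -Real.sign (param c₁ - s) * Real.sign (param c₂ - s) * ha
    · rw [(h _).1, (h _).1, sign_mul, sign_mul, hcosh, hcosh]
      linear_combination -ha

/-- The summand of the first series in `Θ_μ` at the vector `v`. -/
def posVal (τ : ℍ) (v : ℝ × ℝ) : ℂ :=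
  if v = 0 then 0 else (posWeight v : ℂ) * (besselK0 (2 * Real.pi * Q v * τ.im) : ℂ) *
    Complex.exp (2 * Real.pi * Complex.I * (Q v : ℂ) * (τ.re : ℂ))

/-- The summand of the second series in `Θ_μ` at the vector `v`. -/
def negVal (τ : ℍ) (v : ℝ × ℝ) : ℂ :=
  if v = 0 then 0 else (negWeight v : ℂ) * (besselK0 (-2 * Real.pi * Q v * τ.im) : ℂ) *
    Complex.exp (2 * Real.pi * Complex.I * (Q v : ℂ) * (τ.re : ℂ))

/-- The multiplicity with which `v` contributes to `Θ_μ`. -/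
def coneWeight (v : ℝ × ℝ) : ℝ := if v = 0 then 0 else (posWeight v + negWeight v) / 2

lemma Q_zero : Q 0 = 0 := by simp [Q]

lemma IsAxis.vec_ne_zero (h : IsAxis v s a) : v ≠ 0 := by
  rintro rfl
  exact h.Q_ne_zero Q_zero

/-- When `Q v < 0` the Bessel factor of `posVal` is irrelevant because the weight is zero, so `|Q
v|` may replace `Q v`. -/
lemma IsAxis.posVal_eq (h : IsAxis v s a) (τ : ℍ) : posVal τ v =
    (posWeight v : ℂ) * (besselK0 (2 * Real.pi * |Q v| * τ.im) : ℂ) *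
      Complex.exp (2 * Real.pi * Complex.I * (Q v : ℂ) * (τ.re : ℂ)) := by
  rw [posVal, if_neg h.vec_ne_zero]
  rcases h.weight_eq with ⟨hQ, -, -⟩ | ⟨-, -, hw⟩
  · rw [abs_of_pos hQ]
  · simp [hw]

lemma IsAxis.negVal_eq (h : IsAxis v s a) (τ : ℍ) : negVal τ v =
    (negWeight v : ℂ) * (besselK0 (2 * Real.pi * |Q v| * τ.im) : ℂ) *
      Complex.exp (2 * Real.pi * Complex.I * (Q v : ℂ) * (τ.re : ℂ)) := by
  rw [negVal, if_neg h.vec_ne_zero]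
  rcases h.weight_eq with ⟨-, -, hw⟩ | ⟨hQ, -, -⟩
  · simp [hw]
  · rw [abs_of_neg hQ, show 2 * Real.pi * -Q v * τ.im = -2 * Real.pi * Q v * τ.im by ring]

lemma IsAxis.coneWeight_eq (h : IsAxis v s a) :
    coneWeight v = (Real.sign (param c₂ - s) - Real.sign (param c₁ - s)) / 2 := by
  rw [coneWeight, if_neg h.vec_ne_zero]
  rcases h.weight_eq with ⟨-, h1, h2⟩ | ⟨-, h1, h2⟩ <;> rw [h1, h2] <;> ring

lemma half_posVal_add_half_negVal {τ : ℍ} (h : v = 0 ∨ IsAxis v s a) :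
    1 / 2 * posVal τ v + 1 / 2 * negVal τ v =
      (coneWeight v : ℂ) * (besselK0 (2 * Real.pi * |Q v| * τ.im) : ℂ) *
        Complex.exp (2 * Real.pi * Complex.I * (Q v : ℂ) * (τ.re : ℂ)) := by
  rcases h with rfl | h
  · simp [posVal, negVal, coneWeight]
  · rw [h.posVal_eq, h.negVal_eq, coneWeight, if_neg h.vec_ne_zero]
    push_cast
    ring

lemma IsAxis.integral_kern (h : IsAxis v s a) (τ : ℍ) :
    ∫ t in (param c₁)..(param c₂), kern t τ v =
      1 / 2 * posVal τ v + 1 / 2 * negVal τ v + (shadowVal c₁ τ v - shadowVal c₂ τ v) := by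
  rw [half_posVal_add_half_negVal (Or.inr h), h.shadowVal_eq c₁_mem, h.shadowVal_eq c₂_mem,
    h.coneWeight_eq]
  simp only [h.kern_eq]
  rw [intervalIntegral.integral_const_mul, intervalIntegral.integral_ofReal,
    intervalIntegral.integral_comp_sub_right
      (fun t => Real.exp (-(2 * Real.pi * |Q v| * τ.im) * Real.cosh (2 * t))) s]
  have hc : Continuous fun t =>
    Real.exp (-(2 * Real.pi * |Q v| * τ.im) * Real.cosh (2 * t)) := by fun_prop
  rw [← intervalIntegral.integral_interval_sub_left (hc.intervalIntegrable 0 _)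
    (hc.intervalIntegrable 0 _), ← coshInt, ← coshInt]
  push_cast
  ring

lemma mem_Icc_of_sign_sub_sign_ne_zero
    (h0 : Real.sign (param c₂ - s) - Real.sign (param c₁ - s) ≠ 0) :
    s ∈ Set.Icc (param c₁) (param c₂) := by
  have hlt := param_c₁_lt
  by_contra hs
  refine h0 ?_
  rw [Set.mem_Icc, not_and_or, not_le, not_le] at hs
  rcases hs with hs | hs
  · rw [Real.sign_of_pos (by linarith), Real.sign_of_pos (by linarith), sub_self]
  · rw [Real.sign_of_neg (by linarith), Real.sign_of_neg (by linarith), sub_self]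

lemma IsAxis.maj_self (h : IsAxis v s a) : maj s v = |Q v| := by simp [h.maj_eq]

/-- A nonzero weight forces the axis `s` into `[t₁, t₂]`, and at `t = s` the majorant equals `|Q
v|`. Otherwise both terms vanish and any `t` serves. -/
lemma IsAxis.exists_norm_le (h : IsAxis v s a) (τ : ℍ) : ∃ t ∈ Set.Icc (param c₁) (param c₂),
    ‖posVal τ v‖ ≤ 2 * besselK0 (2 * Real.pi * maj t v * τ.im) ∧
    ‖negVal τ v‖ ≤ 2 * besselK0 (2 * Real.pi * maj t v * τ.im) := by
  have hexp : ‖Complex.exp (2 * Real.pi * Complex.I * (Q v : ℂ) * (τ.re : ℂ))‖ = 1 := by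
    rw [Complex.norm_exp]; simp
  have hK := besselK0_nonneg
  rw [h.posVal_eq, h.negVal_eq, norm_mul, norm_mul, norm_mul, norm_mul, hexp, mul_one, mul_one,
    Complex.norm_real, Complex.norm_real, Complex.norm_real, Real.norm_of_nonneg (hK _)]
  by_cases h0 : Real.sign (param c₂ - s) - Real.sign (param c₁ - s) = 0
  · refine ⟨param c₁, ⟨le_rfl, param_c₁_lt.le⟩, ?_⟩
    have := hK (2 * Real.pi * maj (param c₁) v * τ.im)
    rcases h.weight_eq with ⟨-, h1, h2⟩ | ⟨-, h1, h2⟩ <;> rw [h1, h2, h0] <;> simpa using this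
  · refine ⟨s, mem_Icc_of_sign_sub_sign_ne_zero h0, ?_⟩
    rw [h.maj_self]
    have h2 : ∀ x y, ‖1 - Real.sign x * Real.sign y‖ ≤ 2 := fun x y => by
      rcases Real.sign_apply_eq x with h | h | h <;> rcases Real.sign_apply_eq y with h' | h' | h' <;>
        rw [h, h'] <;> norm_num
    exact ⟨mul_le_mul_of_nonneg_right (h2 _ _) (hK _), mul_le_mul_of_nonneg_right (h2 _ _) (hK _)⟩

end

noncomputable section

/-! ### The series over the cosets -/

lemma exists_isAxis_latPt {a b : ℤ} {n : ℤ × ℤ} (h : latPt a b n ≠ 0) :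
    ∃ s r, IsAxis (latPt a b n) s r :=
  exists_isAxis fun h0 => h (eq_zero_of_Q_latPt h0)

/-- On this coset `Q` takes values in `⅙ℤ`; the gap keeps the Bessel arguments away from zero. -/
lemma one_div_six_le_abs_Q {j : ℤ} {n : ℤ × ℤ} (h : latPt j j n ≠ 0) :
    1 / 6 ≤ |Q (latPt j j n)| := by
  have h0 : Q (latPt j j n) ≠ 0 := fun h0 => h (eq_zero_of_Q_latPt h0)
  have e : Q (latPt j j n) =
      ((6 * (n.1 ^ 2 + n.1 * j - 3 * n.2 ^ 2 - n.2 * j) + j ^ 2 : ℤ) : ℝ) / 6 := by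
    rw [Q_latPt]; push_cast; ring
  rw [e] at h0 ⊢
  generalize 6 * (n.1 ^ 2 + n.1 * j - 3 * n.2 ^ 2 - n.2 * j) + j ^ 2 = k at *
  have hk : k ≠ 0 := by rintro rfl; simp at h0
  have h1 : (1 : ℝ) ≤ |(k : ℝ)| := by exact_mod_cast Int.one_le_abs hk
  rw [abs_div, abs_of_pos (by norm_num : (0 : ℝ) < 6)]
  linarith

lemma summable_of_norm_le_besselK0 {F : ℝ × ℝ → ℂ} (j : ℤ) (τ : ℍ) (h0 : F 0 = 0)
    (h : ∀ v s a, IsAxis v s a → ∃ t ∈ Set.Icc (param c₁) (param c₂),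
      ‖F v‖ ≤ 2 * besselK0 (2 * Real.pi * maj t v * τ.im)) :
    Summable fun n => F (latPt j j n) := by
  have hy := τ.im_pos
  obtain ⟨u, hu, hb⟩ := exists_kern_bound (param c₁) (param c₂) hy one_ne_zero one_ne_zero
    ((j : ℝ) / 2) ((j : ℝ) / 6)
  have hx₀ : 0 < 2 * Real.pi * (1 / 6) * τ.im := by positivity
  refine Summable.of_norm_bounded
    (hu.mul_left (2 * Real.sqrt (2 * Real.pi / (2 * Real.pi * (1 / 6) * τ.im)))) fun n => ?_
  have hle := fun t ht => hb n t ht τ le_rfl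
  simp only [← latPt_eq, norm_kern] at hle
  by_cases hn : latPt j j n = 0
  · rw [hn, h0, norm_zero]
    have := (Real.exp_pos _).le.trans (hle (param c₁) ⟨le_rfl, param_c₁_lt.le⟩)
    positivity
  · obtain ⟨s, r, hs⟩ := exists_isAxis_latPt hn
    obtain ⟨t, ht, hF⟩ := h _ s r hs
    refine hF.trans ?_
    rw [mul_assoc (2 : ℝ) (Real.sqrt _)]
    refine mul_le_mul_of_nonneg_left ((besselK0_le hx₀ ?_).trans ?_) zero_le_two
    · have := (one_div_six_le_abs_Q hn).trans (abs_Q_le_maj _ t)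
      gcongr
    · exact mul_le_mul_of_nonneg_left (hle t ht) (Real.sqrt_nonneg _)

lemma summable_posVal (j : ℤ) (τ : ℍ) : Summable fun n => posVal τ (latPt j j n) :=
  summable_of_norm_le_besselK0 j τ (by simp [posVal]) fun _ _ _ h => by
    obtain ⟨t, ht, h, -⟩ := h.exists_norm_le τ
    exact ⟨t, ht, h⟩

lemma summable_negVal (j : ℤ) (τ : ℍ) : Summable fun n => negVal τ (latPt j j n) :=
  summable_of_norm_le_besselK0 j τ (by simp [negVal]) fun _ _ _ h => by
    obtain ⟨t, ht, -, h⟩ := h.exists_norm_le τ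
    exact ⟨t, ht, h⟩

lemma shadowVal_zero (c : ℝ × ℝ) (τ : ℍ) : shadowVal c τ 0 = 0 := by
  simp [shadowVal, shadowCoeff, B]

lemma summable_shadowVal {c : ℝ × ℝ} (hc : c ∈ CQ)
    (hc' : param c ∈ Set.Icc (param c₁) (param c₂)) (j : ℤ) (τ : ℍ) :
    Summable fun n => shadowVal c τ (latPt j j n) :=
  summable_of_norm_le_besselK0 j τ (shadowVal_zero c τ) fun v _ _ h => ⟨param c, hc', by
    have := besselK0_nonneg (2 * Real.pi * maj (param c) v * τ.im)
    linarith [h.norm_shadowVal_le hc τ]⟩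

lemma summable_shadowVal_c₁ (j : ℤ) (τ : ℍ) : Summable fun n => shadowVal c₁ τ (latPt j j n) :=
  summable_shadowVal c₁_mem ⟨le_rfl, param_c₁_lt.le⟩ j τ

lemma summable_shadowVal_c₂ (j : ℤ) (τ : ℍ) : Summable fun n => shadowVal c₂ τ (latPt j j n) :=
  summable_shadowVal c₂_mem ⟨param_c₁_lt.le, le_rfl⟩ j τ

/-! ### Cancellation of the shadows -/

lemma IsAxis.unitEquiv {j : ℤ} {n : ℤ × ℤ} {s a : ℝ} (h : IsAxis (latPt j j n) s a) :
    IsAxis (latPt j j (unitEquiv j n)) (param c₂ + (s - param c₁)) (-a) := by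
  have hB : ∀ t, B (latPt j j (MockMaass.unitEquiv j n)) (cVec t) =
      -B (latPt j j n) (cVec (t - param c₂ + param c₁)) := fun t => by
    have := B_cVec_unitEquiv j n (t - param c₂)
    rwa [add_sub_cancel, add_comm (param c₁)] at this
  have hB' : ∀ t, B (latPt j j (MockMaass.unitEquiv j n)) (cPerpVec t) =
      -B (latPt j j n) (cPerpVec (t - param c₂ + param c₁)) := fun t => by
    have := B_cPerpVec_unitEquiv j n (t - param c₂)
    rwa [add_sub_cancel, add_comm (param c₁)] at this
  have ht : ∀ t, t - (param c₂ + (s - param c₁)) = t - param c₂ + param c₁ - s := fun t => by ring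
  refine ⟨by rw [Q_unitEquiv, neg_sq, h.sq_eq], ?_⟩
  simp only [Q_unitEquiv, hB, hB', ht]
  rcases h.cases with ⟨hQ, h⟩ | ⟨hQ, h⟩
  · exact Or.inl ⟨hQ, fun t => by rw [(h _).1, (h _).2]; constructor <;> ring⟩
  · exact Or.inr ⟨hQ, fun t => by rw [(h _).1, (h _).2]; constructor <;> ring⟩

/-- A shadow term depends only on `Q` and on the distance from the base point to the axis, and the
unit moves both by `t₂ - t₁`. -/
lemma shadowVal_unitEquiv (j : ℤ) (τ : ℍ) (n : ℤ × ℤ) :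
    shadowVal c₂ τ (latPt j j (unitEquiv j n)) = shadowVal c₁ τ (latPt j j n) := by
  by_cases hn : latPt j j n = 0
  · rw [latPt_unitEquiv, hn]
    simp [shadowVal, shadowCoeff, B]
  · obtain ⟨s, a, h⟩ := exists_isAxis_latPt hn
    rw [h.unitEquiv.shadowVal_eq c₂_mem, h.shadowVal_eq c₁_mem, Q_unitEquiv,
      show param c₂ - (param c₂ + (s - param c₁)) = param c₁ - s by ring]

lemma tsum_shadowVal_eq (j : ℤ) (τ : ℍ) : ∑' n, shadowVal c₂ τ (latPt j j n) =
    ∑' n, shadowVal c₁ τ (latPt j j n) := by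
  rw [← (unitEquiv j).tsum_eq]
  simp only [shadowVal_unitEquiv]

lemma shadowG_eq_zero (j : Fin 4) (τ : ℍ) : shadowG j τ = 0 := by
  have h1 := tsum_shift_add (summable_shadowVal_c₁ (j : ℕ) τ)
  have h2 := tsum_shift_add (summable_shadowVal_c₂ (j : ℕ) τ)
  have e : shadowG j τ = (Real.sqrt τ.im : ℂ) *
      ((∑' m, shadowVal c₁ τ (shift (muVec j) m) +
          ∑' m, shadowVal c₁ τ (shift (muVec j + lamVec) m)) -
        (∑' m, shadowVal c₂ τ (shift (muVec j) m) +
          ∑' m, shadowVal c₂ τ (shift (muVec j + lamVec) m))) := by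
    simp only [shadowG, shadow, shadowTerm, shadowVal]
    ring
  rw [e, h1, h2, tsum_shadowVal_eq, sub_self, mul_zero]

/-! ### The mock Maass theta functions and their completions -/

lemma eq_zero_of_eq_six_mul {j : Fin 4} {k : ℤ} (h : ((j : ℕ) : ℤ) = 6 * k) : j = 0 := by
  have hlt := j.isLt
  generalize hi : (j : ℕ) = i at h hlt
  exact Fin.ext (hi.trans (by simp; lia))

lemma exists_intCast_eq_muVec (j : Fin 4) :
    (∃ m : ℤ × ℤ, muVec j = ((m.1 : ℝ), (m.2 : ℝ))) ↔ j = 0 := by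
  constructor
  · rintro ⟨m, hm⟩
    have h := congrArg Prod.fst hm
    simp only [muVec] at h
    have h' : ((j : ℕ) : ℤ) = 6 * m.1 := by
      have : ((j : ℕ) : ℝ) = 6 * m.1 := by linarith
      exact_mod_cast this
    exact eq_zero_of_eq_six_mul h'
  · rintro rfl
    exact ⟨0, by simp [muVec]⟩

lemma not_exists_intCast_eq_muVec_add (j : Fin 4) :
    ¬∃ m : ℤ × ℤ, muVec j + lamVec = ((m.1 : ℝ), (m.2 : ℝ)) := by
  rintro ⟨m, hm⟩
  have h := congrArg Prod.snd hm
  simp only [muVec, lamVec, Prod.snd_add] at h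
  have h' : (1 : ℤ) = 2 * m.2 := by
    have : (1 : ℝ) = 2 * m.2 := by linarith
    exact_mod_cast this
  lia

lemma G_eq (j : Fin 4) (τ : ℍ) : G j τ = (Real.sqrt τ.im : ℂ) *
      (∑' n, (1 / 2 * posVal τ (latPt (j : ℕ) (j : ℕ) n) +
        1 / 2 * negVal τ (latPt (j : ℕ) (j : ℕ) n))) +
    (if j = 0 then ((param c₂ - param c₁ : ℝ) : ℂ) else 0) * (Real.sqrt τ.im : ℂ) := by
  have hp := summable_posVal (j : ℕ) τ
  have hn := summable_negVal (j : ℕ) τ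
  rw [Summable.tsum_add (hp.mul_left _) (hn.mul_left _), tsum_mul_left, tsum_mul_left,
    ← tsum_shift_add hp, ← tsum_shift_add hn]
  simp only [G, theta, exists_intCast_eq_muVec, not_exists_intCast_eq_muVec_add, if_false,
    Real.sign_of_pos (sub_pos.2 param_c₁_lt), thetaPosTerm, thetaNegTerm, posVal, negVal,
    posWeight, negWeight, ite_mul, zero_mul]
  push_cast
  ring

lemma latPt_eq_zero_iff (j : Fin 4) (n : ℤ × ℤ) :
    latPt (j : ℕ) (j : ℕ) n = 0 ↔ j = 0 ∧ n = 0 := by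
  constructor
  · intro h
    have h1 := congrArg Prod.fst h
    have h2 := congrArg Prod.snd h
    simp only [latPt, pt, Prod.fst_zero, Prod.snd_zero] at h1 h2
    push_cast at h1 h2
    have h3 : ((6 * n.2 + (j : ℕ) : ℤ) : ℝ) = ((0 : ℤ) : ℝ) := by push_cast; linarith
    have h4 : ((2 * n.1 + (j : ℕ) : ℤ) : ℝ) = ((0 : ℤ) : ℝ) := by push_cast; linarith
    have h3' := Int.cast_injective h3
    have h4' := Int.cast_injective h4
    have hj : j = 0 := eq_zero_of_eq_six_mul (k := -n.2) (by linarith)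
    refine ⟨hj, ?_⟩
    rw [hj] at h3' h4'
    ext
    · simp at h4' ⊢; exact h4'
    · simp at h3' ⊢; exact h3'
  · rintro ⟨rfl, rfl⟩
    simp [latPt, pt]

lemma kern_zero (t : ℝ) (z : ℂ) : kern t z 0 = 1 := by
  simp [kern, Q, maj, B]

lemma G_eq_GHat (j : Fin 4) (τ : ℍ) : G j τ = GHat j τ := by
  have hp := summable_posVal (j : ℕ) τ
  have hn := summable_negVal (j : ℕ) τ
  have h1 := summable_shadowVal_c₁ (j : ℕ) τ
  have h2 := summable_shadowVal_c₂ (j : ℕ) τ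
  -- The zero vector occurs only for `j = 0`; its kernel is `1`, so it contributes `t₂ - t₁`.
  have h0 : HasSum (fun n => if latPt (j : ℕ) (j : ℕ) n = 0 then
      ((param c₂ - param c₁ : ℝ) : ℂ) else 0)
      (if j = 0 then ((param c₂ - param c₁ : ℝ) : ℂ) else 0) := by
    simp only [latPt_eq_zero_iff]
    by_cases hj : j = 0
    · simp only [hj, true_and, if_true]
      exact hasSum_ite_eq 0 _
    · simp only [hj, false_and, if_false]
      exact hasSum_zero
  have hterm : ∀ n, ∫ t in (param c₁)..(param c₂), kern t τ (latPt (j : ℕ) (j : ℕ) n) =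
      (1 / 2 * posVal τ (latPt (j : ℕ) (j : ℕ) n) + 1 / 2 * negVal τ (latPt (j : ℕ) (j : ℕ) n)) +
      (shadowVal c₁ τ (latPt (j : ℕ) (j : ℕ) n) - shadowVal c₂ τ (latPt (j : ℕ) (j : ℕ) n)) +
      (if latPt (j : ℕ) (j : ℕ) n = 0 then ((param c₂ - param c₁ : ℝ) : ℂ) else 0) := fun n => by
    by_cases hn : latPt (j : ℕ) (j : ℕ) n = 0
    · rw [hn]
      simp [kern_zero, posVal, negVal, shadowVal_zero]
    · obtain ⟨s, a, h⟩ := exists_isAxis_latPt hn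
      rw [h.integral_kern, if_neg hn, add_zero]
  rw [G_eq, GHat_eq, thetaVec, cosetForm]
  simp only [hterm]
  rw [Summable.tsum_add (((hp.mul_left _).add (hn.mul_left _)).add (h1.sub h2)) h0.summable,
    Summable.tsum_add ((hp.mul_left _).add (hn.mul_left _)) (h1.sub h2), h1.tsum_sub h2,
    tsum_shadowVal_eq, sub_self, add_zero, h0.tsum_eq]
  ring

/-! ### Fourier expansion -/

/-- The integer `Q - j²/6` at the point `latPt j j n`. -/
def fourierIndex (j : ℤ) (n : ℤ × ℤ) : ℤ := n.1 ^ 2 + n.1 * j - 3 * n.2 ^ 2 - n.2 * j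

lemma Q_latPt_eq_fourierIndex (j : ℤ) (n : ℤ × ℤ) :
    Q (latPt j j n) = (fourierIndex j n : ℝ) + (j : ℝ) ^ 2 / 6 := by
  rw [Q_latPt, fourierIndex]; ring

/-- The Fourier coefficients of `thetaVec`. -/
def fourierCoeffVal (j : ℤ) (m : ℤ) : ℂ :=
  ∑' n : fourierIndex j ⁻¹' {m}, (coneWeight (latPt j j n) : ℂ)

lemma IsAxis.abs_coneWeight_le {v : ℝ × ℝ} {s a : ℝ} (h : IsAxis v s a) : |coneWeight v| ≤ 1 := by
  rw [h.coneWeight_eq]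
  rcases Real.sign_apply_eq (param c₂ - s) with h | h | h <;>
    rcases Real.sign_apply_eq (param c₁ - s) with h' | h' | h' <;>
    rw [h, h', abs_le] <;> norm_num

lemma coneWeight_zero : coneWeight 0 = 0 := by simp [coneWeight]

lemma norm_coneWeight_latPt_le (j : ℤ) (n : ℤ × ℤ) :
    ‖(coneWeight (latPt j j n) : ℂ)‖ ≤ 1 := by
  rw [Complex.norm_real, Real.norm_eq_abs]
  by_cases hn : latPt j j n = 0
  · rw [hn, coneWeight_zero]; norm_num
  · obtain ⟨s, a, h⟩ := exists_isAxis_latPt hn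
    exact h.abs_coneWeight_le

/-- A contributing vector has its axis in `[t₁, t₂]`, where the indefinite `|Q|` agrees with the
majorant and is therefore coercive. -/
lemma exists_sq_le_abs_Q (j : ℤ) : ∃ κ > 0, ∀ n : ℤ × ℤ, coneWeight (latPt j j n) ≠ 0 →
    κ * ((n.1 + (j : ℝ) / 2) ^ 2 + (n.2 + (j : ℝ) / 6) ^ 2) ≤ |Q (latPt j j n)| := by
  obtain ⟨κ, hκ, h⟩ := exists_le_maj (param c₁) (param c₂)
  refine ⟨κ, hκ, fun n hn => ?_⟩
  have h0 : latPt j j n ≠ 0 := fun h0 => hn (by rw [h0, coneWeight_zero])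
  obtain ⟨s, a, hs⟩ := exists_isAxis_latPt h0
  rw [← hs.maj_self]
  exact h s (mem_Icc_of_sign_sub_sign_ne_zero fun h0 =>
    hn (by rw [hs.coneWeight_eq, h0, zero_div])) _ _

lemma norm_fourierCoeffVal_le (j : ℤ) :
    ∃ (C : ℝ) (N : ℕ), ∀ m : ℤ, ‖fourierCoeffVal j m‖ ≤ C * (1 + |(m : ℝ)|) ^ N := by
  obtain ⟨κ, hκ, h⟩ := exists_sq_le_abs_Q j
  -- Chosen so that `|x + c| ≤ 1 + (x + c)²` yields coordinates bounded linearly in `1 + |m|`; a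
  -- square-root bound is not needed.
  set A : ℝ := (1 + (j : ℝ) ^ 2) / κ + 1 + |(j : ℝ)| with hA
  have hA0 : 0 < A := by positivity
  have hbound : ∀ (m : ℤ) (n : ℤ × ℤ), fourierIndex j n = m → coneWeight (latPt j j n) ≠ 0 →
      |(n.1 : ℝ)| ≤ A * (1 + |(m : ℝ)|) ∧ |(n.2 : ℝ)| ≤ A * (1 + |(m : ℝ)|) := by
    intro m n hm hn
    have h1 := h n hn
    rw [Q_latPt_eq_fourierIndex, hm] at h1
    have h2 : |(m : ℝ) + (j : ℝ) ^ 2 / 6| ≤ (1 + (j : ℝ) ^ 2) * (1 + |(m : ℝ)|) := by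
      refine (abs_add_le _ _).trans ?_
      rw [abs_of_nonneg (by positivity : 0 ≤ (j : ℝ) ^ 2 / 6)]
      nlinarith [abs_nonneg (m : ℝ), mul_nonneg (sq_nonneg (j : ℝ)) (abs_nonneg (m : ℝ)),
        sq_nonneg (j : ℝ)]
    have h3 : (n.1 + (j : ℝ) / 2) ^ 2 + (n.2 + (j : ℝ) / 6) ^ 2 ≤
        (1 + (j : ℝ) ^ 2) / κ * (1 + |(m : ℝ)|) := by
      rw [div_mul_eq_mul_div, le_div_iff₀ hκ, mul_comm]
      exact h1.trans h2
    have h4 : ∀ x c : ℝ, (x + c) ^ 2 ≤ (1 + (j : ℝ) ^ 2) / κ * (1 + |(m : ℝ)|) → |c| ≤ |(j : ℝ)| →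
        |x| ≤ A * (1 + |(m : ℝ)|) := by
      intro x c hx hc
      have h5 : |x + c| ≤ 1 + (x + c) ^ 2 := by
        rw [← sq_abs (x + c)]; nlinarith [sq_nonneg (|x + c| - 1), abs_nonneg (x + c)]
      have h6 : |x| ≤ |x + c| + |c| := by
        have := abs_sub (x + c) c
        rwa [add_sub_cancel_right] at this
      have h7 := mul_nonneg (abs_nonneg (j : ℝ)) (abs_nonneg (m : ℝ))
      rw [hA]
      nlinarith [abs_nonneg (m : ℝ)]
    refine ⟨h4 _ _ ((le_add_of_nonneg_right (sq_nonneg _)).trans h3) ?_,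
      h4 _ _ ((le_add_of_nonneg_left (sq_nonneg _)).trans h3) ?_⟩
    · rw [abs_div, abs_two]
      linarith [abs_nonneg (j : ℝ)]
    · rw [abs_div, abs_of_pos (by norm_num : (0 : ℝ) < 6)]
      linarith [abs_nonneg (j : ℝ)]
  refine ⟨(2 * A + 1) ^ 2, 2, fun m => ?_⟩
  set N : ℕ := ⌊A * (1 + |(m : ℝ)|)⌋₊ with hN
  have hN' : (N : ℝ) ≤ A * (1 + |(m : ℝ)|) := Nat.floor_le (by positivity)
  set S : Finset (ℤ × ℤ) := Finset.Icc (-(N : ℤ)) N ×ˢ Finset.Icc (-(N : ℤ)) N with hS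
  have hcard : (S.card : ℝ) = (2 * N + 1) ^ 2 := by
    rw [hS, Finset.card_product, Int.card_Icc]
    have : ((N : ℤ) + 1 - -(N : ℤ)).toNat = 2 * N + 1 := by lia
    rw [this]
    push_cast
    ring
  have hmem : ∀ k : ℤ, |(k : ℝ)| ≤ A * (1 + |(m : ℝ)|) → k ∈ Finset.Icc (-(N : ℤ)) N := by
    intro k hk
    have h1 : k.natAbs ≤ N := Nat.le_floor (by rw [Nat.cast_natAbs]; exact_mod_cast hk)
    rw [Finset.mem_Icc]
    lia
  rw [fourierCoeffVal, tsum_subtype (fourierIndex j ⁻¹' {m}) fun n => (coneWeight (latPt j j n) : ℂ),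
    tsum_eq_sum (s := S)]
  · refine (norm_sum_le_of_le S (n := fun _ => 1) fun n _ => ?_).trans ?_
    · exact (norm_indicator_le_norm_self _ _).trans (norm_coneWeight_latPt_le j n)
    · rw [Finset.sum_const, nsmul_eq_mul, mul_one, hcard, ← mul_pow]
      refine pow_le_pow_left₀ (by positivity) ?_ 2
      nlinarith [abs_nonneg (m : ℝ)]
  · intro n hn
    by_contra h0
    have h1 : n ∈ fourierIndex j ⁻¹' {m} := Set.mem_of_indicator_ne_zero h0
    rw [Set.indicator_of_mem h1] at h0
    have h2 := hbound m n h1 (by exact_mod_cast h0)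
    exact hn (Finset.mem_product.2 ⟨hmem _ h2.1, hmem _ h2.2⟩)

lemma hasFourierExpansion_G (j : Fin 4) :
    HasFourierExpansion (G j) (((j : ℕ) : ℝ) ^ 2 / 6)
      (if j = 0 then ((2 * Real.artanh (1 / Real.sqrt 3) : ℝ) : ℂ) else 0)
      (fourierCoeffVal (j : ℕ)) := by
  refine ⟨norm_fourierCoeffVal_le _, fun τ => ?_⟩
  have hp := summable_posVal (j : ℕ) τ
  have hn := summable_negVal (j : ℕ) τ
  -- Grouping by the fibres of `fourierIndex` collects all vectors with the same value of `Q`.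
  have hs := (((hp.mul_left (1 / 2)).add (hn.mul_left (1 / 2))).hasSum.mul_left
    (Real.sqrt τ.im : ℂ)).tsum_fiberwise (fourierIndex (j : ℕ))
  have hc : (if j = 0 then ((2 * Real.artanh (1 / Real.sqrt 3) : ℝ) : ℂ) else 0) =
      if j = 0 then ((param c₂ - param c₁ : ℝ) : ℂ) else 0 := by
    rw [← param_c₂_eq_artanh, param_c₁]
    congr 3
    ring
  rw [hc, G_eq, add_sub_cancel_right]
  refine hs.congr_fun fun m => ?_
  have hval : ∀ n, 1 / 2 * posVal τ (latPt (j : ℕ) (j : ℕ) n) +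
      1 / 2 * negVal τ (latPt (j : ℕ) (j : ℕ) n) =
      (coneWeight (latPt (j : ℕ) (j : ℕ) n) : ℂ) *
        (besselK0 (2 * Real.pi * |Q (latPt (j : ℕ) (j : ℕ) n)| * τ.im) : ℂ) *
        Complex.exp (2 * Real.pi * Complex.I * (Q (latPt (j : ℕ) (j : ℕ) n) : ℂ) * (τ.re : ℂ)) := by
    intro n
    by_cases hn : latPt (j : ℕ) (j : ℕ) n = 0
    · exact half_posVal_add_half_negVal (s := 0) (a := 0) (Or.inl hn)
    · obtain ⟨s, a, h⟩ := exists_isAxis_latPt hn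
      exact half_posVal_add_half_negVal (Or.inr h)
  have hfib : ∀ n : fourierIndex (j : ℕ) ⁻¹' {m},
      Q (latPt (j : ℕ) (j : ℕ) n) = (m : ℝ) + ((j : ℕ) : ℝ) ^ 2 / 6 := fun n => by
    have := n.2
    rw [Set.mem_preimage, Set.mem_singleton_iff] at this
    rw [Q_latPt_eq_fourierIndex, this, Int.cast_natCast]
  simp only [hval, hfib]
  split_ifs with h0
  -- The fibre at frequency zero can contain only the zero vector, whose `coneWeight` is zero.
  · have hz : ∀ n : fourierIndex (j : ℕ) ⁻¹' {m}, latPt (j : ℕ) (j : ℕ) n = 0 := fun n =>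
      eq_zero_of_Q_latPt ((hfib n).trans h0)
    simp [hz, coneWeight_zero]
  · rw [tsum_mul_left, tsum_mul_right, tsum_mul_right, fourierCoeffVal]
    ring

end

noncomputable section

/-! ### The Maass form -/

lemma G_eq_thetaVec (j : Fin 4) : G j = fun τ => thetaVec τ j :=
  funext fun τ => (G_eq_GHat j τ).trans (GHat_eq j τ)

lemma isMaassForm_G : IsMaassForm (CongruenceSubgroup.Gamma0 2) thetaMultiplier (1 / 4) G where
  smooth j := by rw [G_eq_thetaVec]; exact contDiffOn_thetaVec j
  diag M hM := thetaMultiplier_isDiag M hM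
  transform M j τ := by
    simp only [G_eq_thetaVec]
    rw [isThetaMultiplier_thetaMultiplier M τ]
    rfl
  eigen j τ := by rw [G_eq_thetaVec]; exact hypLaplacian_thetaVec j τ
  growth j γ := ⟨1, by simp only [G_eq_thetaVec]; exact thetaVec_smul_isBigO j γ⟩

/-- The series in the definitions of `Θ_μ`, `Θ̂_μ` and the shadows, for `μ = μ_j` and
`μ = μ_j + λ`. -/
lemma summable_all (j : Fin 4) (τ : ℍ) {μ : ℝ × ℝ}
    (hμ : μ ∈ ({muVec j, muVec j + lamVec} : Set (ℝ × ℝ))) :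
    Summable (thetaPosTerm μ τ) ∧ Summable (thetaNegTerm μ τ) ∧ Summable (thetaHatTerm μ τ) ∧
      Summable (shadowTerm c₁ μ τ) ∧ Summable (shadowTerm c₂ μ τ) := by
  have h1 := summable_shift (summable_posVal (j : ℕ) τ)
  have h2 := summable_shift (summable_negVal (j : ℕ) τ)
  have h3 := summable_shift (F := fun v => ∫ t in (param c₁)..(param c₂), kern t τ v)
    (summable_thetaHat_coset j τ)
  have h4 := summable_shift (summable_shadowVal_c₁ (j : ℕ) τ)
  have h5 := summable_shift (summable_shadowVal_c₂ (j : ℕ) τ)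
  have e : ∀ μ, thetaHatTerm μ τ = fun n => ∫ t in (param c₁)..(param c₂), kern t τ (shift μ n) :=
    fun μ => funext fun n => thetaHatTerm_eq μ τ n
  rw [e]
  rcases hμ with rfl | rfl
  · exact ⟨h1.1, h2.1, h3.1, h4.1, h5.1⟩
  · exact ⟨h1.2, h2.2, h3.2, h4.2, h5.2⟩

end

end MockMaass

theorem proposition5p3 :
    -- every series that defines the functions converges absolutely
    (∀ (j : Fin 4) (τ : UpperHalfPlane),
      ∀ μ ∈ ({MockMaass.muVec j, MockMaass.muVec j + MockMaass.lamVec} : Set (ℝ × ℝ)),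
        Summable (MockMaass.thetaPosTerm μ τ) ∧ Summable (MockMaass.thetaNegTerm μ τ) ∧
        Summable (MockMaass.thetaHatTerm μ τ) ∧
        Summable (MockMaass.shadowTerm MockMaass.c₁ μ τ) ∧
        Summable (MockMaass.shadowTerm MockMaass.c₂ μ τ)) ∧
    -- the shadow contributions cancel
    (∀ (j : Fin 4) (τ : UpperHalfPlane),
      MockMaass.G j τ = MockMaass.GHat j τ ∧
      MockMaass.GHat j τ = MockMaass.G j τ + MockMaass.shadowG j τ ∧
      MockMaass.shadowG j τ = 0) ∧
    -- vector-valued Maass form on `Γ₀(2)` with the explicit multipliers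
    (∃ Φ : CongruenceSubgroup.Gamma0 2 →* Matrix (Fin 4) (Fin 4) ℂ,
      Φ MockMaass.T = MockMaass.PhiT ∧ Φ MockMaass.R = MockMaass.PhiR ∧
      MockMaass.IsMaassForm (CongruenceSubgroup.Gamma0 2) Φ (1 / 4) MockMaass.G) ∧
    -- Fourier expansions, with nonzero constant term
    (∃ d : Fin 4 → ℤ → ℂ, ∀ j : Fin 4,
      MockMaass.HasFourierExpansion (MockMaass.G j) (((j : ℕ) : ℝ) ^ 2 / 6)
        (if j = 0 then ((2 * Real.artanh (1 / Real.sqrt 3) : ℝ) : ℂ) else 0) (d j)) ∧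
    Real.artanh (1 / Real.sqrt 3) ≠ 0 := by
  refine ⟨fun j τ μ hμ => MockMaass.summable_all j τ hμ, fun j τ => ⟨MockMaass.G_eq_GHat j τ, ?_,
    MockMaass.shadowG_eq_zero j τ⟩, ⟨MockMaass.thetaMultiplier, MockMaass.thetaMultiplier_T,
    MockMaass.thetaMultiplier_R, MockMaass.isMaassForm_G⟩,
    ⟨fun j => MockMaass.fourierCoeffVal (j : ℕ), MockMaass.hasFourierExpansion_G⟩, ?_⟩
  · rw [MockMaass.shadowG_eq_zero, add_zero, MockMaass.G_eq_GHat]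
  · rw [← MockMaass.param_c₂_eq_artanh]
    exact MockMaass.param_c₂_pos.ne'
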